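/- Let $d\ge 2$ and let $\Omega\subset\mathbb{R}^d$ be a bounded open set with Lipschitz boundary. Equip $\partial\Omega$ with the surface measure $\mathcal{H}^{d-1}$. For $\mathcal{H}^{d-1}$-a.e. $x\in\partial\Omega$ let $T_x\partial\Omega$ be the tangent space of $\partial\Omega$ at $x$. For $1\le p\le\infty$, $W^{1,p}(\partial\Omega;\mathbb{R}^d)$ is the space of those $u\in L^p(\partial\Omega;\mathbb{R}^d)$ that have a tangential derivative $D^\tau u\in L^p$: for a.e. $x$, $D^\tau u(x):T_x\partial\Omega\to\mathbb{R}^d$ is linear, and for each bi-Lipschitz parametrization $\Psi:U\to\partial\Omega$ ($U\subset\mathbb{R}^{d-1}$ open) of a relatively open part of $\partial\Omega$, the weak derivative of $u\circ\Psi$ in $U$ is $z\mapsto D^\tau u(\Psi(z))\circ D\Psi(z)$. The space is normed by $\|u\|_{L^p}$ and $\|D^\tau u\|_{L^p}$. An $L^\infty$ basis of the tangent bundle $T\partial\Omega$ is a family $\mathcal{V}=\{v_1,\dots,v_{d-1}\}$ of measurable maps $v_i:\partial\Omega\to\mathbb{R}^d$ such that, for a.e. $x$, $\{v_1(x),\dots,v_{d-1}(x)\}$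 is a basis of $T_x\partial\Omega$ and the linear map $\mathbb{R}^{d-1}\to T_x\partial\Omega$, $e_i\mapsto v_i(x)$, has an invertible linear extension $\tilde P_x:\mathbb{R}^d\to\mathbb{R}^d$ with $x\mapsto\tilde P_x$ and $x\mapsto\tilde P_x^{-1}$ in $L^\infty(\partial\Omega;\mathcal{L}(\mathbb{R}^d;\mathbb{R}^d))$. For such $\mathcal{V}$ and $u\in W^{1,p}(\partial\Omega;\mathbb{R}^d)$, let $M_{\mathcal{V}}(D^\tau u)(x)\in\mathbb{R}^{\nu}$, $\nu=\sum_{k=1}^{d-1}\binom{d-1}{k}\binom{d}{k}$, be the vector of all minors, of all orders $1\le k\le d-1$, of the $d\times(d-1)$ matrix of $D^\tau u(x)$ with respect to $\{v_1(x),\dots,v_{d-1}(x)\}$ and the canonical basis of $\mathbb{R}^d$. **Proposition.** Let $d-1<p\le\infty$, let $u\in W^{1,p}(\partial\Omega;\mathbb{R}^d)$, and let $(u_n)_{n\in\mathbb{N}}\subset W^{1,p}(\partial\Omega;\mathbb{R}^d)$ converge weakly to $u$ in the normed space $W^{1,p}(\partial\Omega;\mathbb{R}^d)$. Then $L^\infty$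 bases of $T\partial\Omega$ exist, and for every $L^\infty$ basis $\mathcal{V}$ of $T\partial\Omega$ the functions $M_{\mathcal{V}}(D^\tau u_n)$ and $M_{\mathcal{V}}(D^\tau u)$ belong to $L^1(\partial\Omega;\mathbb{R}^\nu)$ and $$M_{\mathcal{V}}(D^\tau u_n)\rightharpoonup M_{\mathcal{V}}(D^\tau u)\quad\text{weakly in }L^1(\partial\Omega;\mathbb{R}^{\nu})\text{ as }n\to\infty.$$ -/

import Mathlib

open MeasureTheory Measure Filter Topology Set
open scoped ENNReal NNReal ContDiff

noncomputable section

/-- `f` is bi-Lipschitz on `s`. -/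
def BiLipschitzOn {X Y : Type*} [PseudoEMetricSpace X] [PseudoEMetricSpace Y]
    (f : X → Y) (s : Set X) : Prop :=
  ∃ K : ℝ≥0, LipschitzOnWith K f s ∧ AntilipschitzWith K (s.domRestrict f)

/-- A bounded open set with Lipschitz boundary: near each boundary point there are bi-Lipschitz
coordinates `G` in which the boundary is the hyperplane `{t = 0}` and the set is the side
`{0 < t}`. (If the boundary is locally the graph of a Lipschitz function `γ` in orthonormal
coordinates, take `G (z, t) = (z, γ z + t)` in these coordinates, up to translation and sign.) -/
structure IsLipschitzDomain {d : ℕ} (Ω : Set (EuclideanSpace ℝ (Fin d))) : Prop where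
  isOpen : IsOpen Ω
  isBounded : Bornology.IsBounded Ω
  exists_coordinates : ∀ x ∈ frontier Ω, ∃ (r β : ℝ)
    (G : EuclideanSpace ℝ (Fin (d - 1)) × ℝ → EuclideanSpace ℝ (Fin d)),
    0 < r ∧ 0 < β ∧
    BiLipschitzOn G (Metric.ball 0 r ×ˢ Ioo (-β) β) ∧
    IsOpen (G '' (Metric.ball 0 r ×ˢ Ioo (-β) β)) ∧
    G (0, 0) = x ∧
    ∀ q ∈ Metric.ball 0 r ×ˢ Ioo (-β) β,
      (G q ∈ Ω ↔ 0 < q.2) ∧ (G q ∈ frontier Ω ↔ q.2 = 0)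

/-- The surface measure `ℋ^{d-1}` on `∂Ω` (with the usual normalization, for which `ℋ^{d-1}` is
Lebesgue measure on `ℝ^{d-1}`). -/
def surfaceMeasure {d : ℕ} (Ω : Set (EuclideanSpace ℝ (Fin d))) :
    Measure (EuclideanSpace ℝ (Fin d)) :=
  (euclideanHausdorffMeasure (d - 1)).restrict (frontier Ω)

/-- The tangent space `T_x ∂Ω`, spanned by the tangent directions to `∂Ω` at `x`. On a Lipschitz
boundary it is, for `ℋ^{d-1}`-almost every `x`, the classical `(d-1)`-dimensional tangent
hyperplane. -/
def tangentSpaceAt {d : ℕ} (Ω : Set (EuclideanSpace ℝ (Fin d))) (x : EuclideanSpace ℝ (Fin d)) :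
    Submodule ℝ (EuclideanSpace ℝ (Fin d)) :=
  Submodule.span ℝ (tangentConeAt ℝ (frontier Ω) x)

/-- `Ψ : U → ∂Ω` is a bi-Lipschitz local parametrization of `∂Ω`: the parameter set `U ⊆ ℝ^{d-1}`
is open and `Ψ` is bi-Lipschitz from `U` onto a relatively open subset of `∂Ω`. -/
structure IsBoundaryParam {d : ℕ} (Ω : Set (EuclideanSpace ℝ (Fin d)))
    (U : Set (EuclideanSpace ℝ (Fin (d - 1))))
    (Ψ : EuclideanSpace ℝ (Fin (d - 1)) → EuclideanSpace ℝ (Fin d)) : Prop where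
  isOpen : IsOpen U
  biLipschitz : BiLipschitzOn Ψ U
  isOpen_image : ∃ V : Set (EuclideanSpace ℝ (Fin d)), IsOpen V ∧ Ψ '' U = V ∩ frontier Ω

/-- `g` is the weak derivative of `f` on the open set `U ⊆ ℝ^m`. -/
structure HasWeakFDerivOn {m : ℕ} {W : Type*} [NormedAddCommGroup W] [NormedSpace ℝ W]
    (f : EuclideanSpace ℝ (Fin m) → W)
    (g : EuclideanSpace ℝ (Fin m) → EuclideanSpace ℝ (Fin m) →L[ℝ] W)
    (U : Set (EuclideanSpace ℝ (Fin m))) : Prop where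
  locallyIntegrableOn : LocallyIntegrableOn f U
  locallyIntegrableOn_deriv : LocallyIntegrableOn g U
  integral_eq : ∀ φ : EuclideanSpace ℝ (Fin m) → ℝ, ContDiff ℝ ∞ φ → HasCompactSupport φ →
    tsupport φ ⊆ U → ∀ v : EuclideanSpace ℝ (Fin m),
      ∫ z in U, (fderiv ℝ φ z v) • f z = - ∫ z in U, φ z • g z v

/-- `F` is the tangential derivative `D^τ u` of `u : ∂Ω → ℝ^d`. The linear map
`D^τ u(x) : T_x ∂Ω → ℝ^d` is represented by its extension to `ℝ^d` that vanishes on the orthogonal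
complement of `T_x ∂Ω`. In every local parametrization `Ψ`, the weak derivative of `u ∘ Ψ` is
`D^τ u(Ψ(z)) ∘ DΨ(z)`. -/
structure IsTangentialDeriv {d : ℕ} (Ω : Set (EuclideanSpace ℝ (Fin d)))
    (u : EuclideanSpace ℝ (Fin d) → EuclideanSpace ℝ (Fin d))
    (F : EuclideanSpace ℝ (Fin d) → EuclideanSpace ℝ (Fin d) →L[ℝ] EuclideanSpace ℝ (Fin d)) :
    Prop where
  normal : ∀ᵐ x ∂(surfaceMeasure Ω), ∀ v ∈ (tangentSpaceAt Ω x)ᗮ, F x v = 0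
  weakDeriv : ∀ U Ψ, IsBoundaryParam Ω U Ψ →
    HasWeakFDerivOn (fun z => u (Ψ z)) (fun z => (F (Ψ z)).comp (fderiv ℝ Ψ z)) U

section Linear

variable {m : ℕ} {W : Type*} [NormedAddCommGroup W] [NormedSpace ℝ W]
  {f f₁ f₂ : EuclideanSpace ℝ (Fin m) → W}
  {g g₁ g₂ : EuclideanSpace ℝ (Fin m) → EuclideanSpace ℝ (Fin m) →L[ℝ] W}
  {U : Set (EuclideanSpace ℝ (Fin m))}

theorem LocallyIntegrableOn.integrable_testFunction_smul (hf : LocallyIntegrableOn f U)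
    {ψ : EuclideanSpace ℝ (Fin m) → ℝ} (hψ : Continuous ψ) (hc : HasCompactSupport ψ)
    (hs : tsupport ψ ⊆ U) : IntegrableOn (fun z => ψ z • f z) U := by
  have h1 : IntegrableOn f (tsupport ψ) := hf.integrableOn_compact_subset hs hc
  have h2 : IntegrableOn (fun z => ψ z • f z) (tsupport ψ) :=
    h1.continuousOn_smul hψ.continuousOn hc
  refine ((integrableOn_iff_integrable_of_support_subset ?_).1 h2).integrableOn
  intro z hz
  apply subset_tsupport
  intro h0
  exact hz (by simp [h0])

theorem HasWeakFDerivOn.integrable_left (h : HasWeakFDerivOn f g U)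
    {φ : EuclideanSpace ℝ (Fin m) → ℝ} (hφ : ContDiff ℝ ∞ φ) (hc : HasCompactSupport φ)
    (hs : tsupport φ ⊆ U) (v : EuclideanSpace ℝ (Fin m)) :
    IntegrableOn (fun z => (fderiv ℝ φ z v) • f z) U := by
  refine LocallyIntegrableOn.integrable_testFunction_smul h.locallyIntegrableOn
    ((hφ.continuous_fderiv (by simp)).clm_apply continuous_const)
    (hc.fderiv_apply (𝕜 := ℝ) v) ((tsupport_fderiv_apply_subset ℝ v).trans hs)

theorem HasWeakFDerivOn.integrable_right (h : HasWeakFDerivOn f g U)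
    {φ : EuclideanSpace ℝ (Fin m) → ℝ} (hφ : ContDiff ℝ ∞ φ) (hc : HasCompactSupport φ)
    (hs : tsupport φ ⊆ U) (v : EuclideanSpace ℝ (Fin m)) :
    IntegrableOn (fun z => φ z • g z v) U := by
  have := LocallyIntegrableOn.integrable_testFunction_smul h.locallyIntegrableOn_deriv
    hφ.continuous hc hs
  exact this.apply_continuousLinearMap v

theorem HasWeakFDerivOn.zero :
    HasWeakFDerivOn (fun _ => (0 : W)) (fun _ => 0) U := by
  refine ⟨?_, ?_, ?_⟩
  · exact continuous_const.locallyIntegrable.locallyIntegrableOn U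
  · exact continuous_const.locallyIntegrable.locallyIntegrableOn U
  · intro φ _ _ _ v
    simp

theorem HasWeakFDerivOn.add (h₁ : HasWeakFDerivOn f₁ g₁ U) (h₂ : HasWeakFDerivOn f₂ g₂ U) :
    HasWeakFDerivOn (fun z => f₁ z + f₂ z) (fun z => g₁ z + g₂ z) U := by
  refine ⟨LocallyIntegrableOn.add (f := f₁) (g := f₂) h₁.1 h₂.1,
    LocallyIntegrableOn.add (f := g₁) (g := g₂) h₁.2 h₂.2, ?_⟩
  intro φ hφ hc hs v
  simp only [smul_add, _root_.add_apply]
  rw [integral_add (h₁.integrable_left hφ hc hs v) (h₂.integrable_left hφ hc hs v),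
    integral_add (h₁.integrable_right hφ hc hs v) (h₂.integrable_right hφ hc hs v),
    h₁.3 φ hφ hc hs v, h₂.3 φ hφ hc hs v, neg_add]

theorem HasWeakFDerivOn.const_smul (h : HasWeakFDerivOn f g U) (c : ℝ) :
    HasWeakFDerivOn (fun z => c • f z) (fun z => c • g z) U := by
  refine ⟨h.1.smul c, h.2.smul c, ?_⟩
  intro φ hφ hc hs v
  simp only [_root_.smul_apply]
  simp_rw [smul_comm _ c]
  rw [integral_smul, integral_smul, h.3 φ hφ hc hs v, smul_neg]

theorem HasWeakFDerivOn.congr (h : HasWeakFDerivOn f₁ g₁ U)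
    (hf : f₁ =ᵐ[volume.restrict U] f₂) (hg : g₁ =ᵐ[volume.restrict U] g₂) :
    HasWeakFDerivOn f₂ g₂ U := by
  refine ⟨?_, ?_, ?_⟩
  · intro x hx
    obtain ⟨s, hs, hi⟩ := h.1 x hx
    refine ⟨s ∩ U, inter_mem hs self_mem_nhdsWithin, ?_⟩
    exact (hi.mono_set inter_subset_left).congr
      (ae_mono (Measure.restrict_mono inter_subset_right le_rfl) hf)
  · intro x hx
    obtain ⟨s, hs, hi⟩ := h.2 x hx
    refine ⟨s ∩ U, inter_mem hs self_mem_nhdsWithin, ?_⟩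
    exact (hi.mono_set inter_subset_left).congr
      (ae_mono (Measure.restrict_mono inter_subset_right le_rfl) hg)
  · intro φ hφ hc hs v
    have := h.3 φ hφ hc hs v
    have e1 : ∫ z in U, (fderiv ℝ φ z v) • f₁ z = ∫ z in U, (fderiv ℝ φ z v) • f₂ z :=
      integral_congr_ae (hf.mono fun z hz => by simp only [hz])
    have e2 : ∫ z in U, φ z • g₁ z v = ∫ z in U, φ z • g₂ z v :=
      integral_congr_ae (hg.mono fun z hz => by simp only [hz])
    rw [← e1, ← e2, this]

end Linear

/-- Local parametrizations pull back `ℋ^{d-1}`-null sets of `∂Ω` to Lebesgue null sets. -/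
theorem IsBoundaryParam.ae_comp {d : ℕ} {Ω : Set (EuclideanSpace ℝ (Fin d))}
    {U : Set (EuclideanSpace ℝ (Fin (d - 1)))}
    {Ψ : EuclideanSpace ℝ (Fin (d - 1)) → EuclideanSpace ℝ (Fin d)}
    (hΨ : IsBoundaryParam Ω U Ψ) {P : EuclideanSpace ℝ (Fin d) → Prop}
    (hP : ∀ᵐ x ∂(surfaceMeasure Ω), P x) : ∀ᵐ z ∂(volume.restrict U), P (Ψ z) := by
  obtain ⟨V, hV, hVU⟩ := hΨ.isOpen_image
  obtain ⟨K, -, hK⟩ := hΨ.biLipschitz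
  rw [ae_restrict_iff' hΨ.isOpen.measurableSet, ae_iff]
  have hset : {z | ¬ (z ∈ U → P (Ψ z))} = (↑) '' {z : U | ¬ P (Ψ z)} := by
    ext z
    simp [and_comm]
  have hfr : MeasurableSet (frontier Ω) := isClosed_frontier.measurableSet
  have h0 : (μH[(d - 1 : ℕ)] : Measure (EuclideanSpace ℝ (Fin d)))
      ({x | ¬ P x} ∩ frontier Ω) = 0 := by
    have h := hP
    rw [surfaceMeasure, ae_restrict_iff' hfr, ae_iff, euclideanHausdorffMeasure_def,
      Measure.smul_apply, ENNReal.smul_def, smul_eq_mul, mul_eq_zero] at h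
    rcases h with h | h
    · exact absurd (by exact_mod_cast h)
        (addHaarScalarFactor_volume_hausdorffMeasure_ne_zero (d - 1))
    · refine measure_mono_null (fun x hx => ?_) h
      simp only [mem_ofPred_eq, Classical.not_imp]
      exact ⟨hx.2, hx.1⟩
  have h1 : (μH[(d - 1 : ℕ)] : Measure (EuclideanSpace ℝ (Fin (d - 1))))
      ((↑) '' {z : U | ¬ P (Ψ z)}) = 0 := by
    rw [isometry_subtype_coe.hausdorffMeasure_image (Or.inl (by positivity))]
    refine le_antisymm ?_ zero_le
    refine (hK.le_hausdorffMeasure_image (by positivity) _).trans ?_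
    have : (μH[(d - 1 : ℕ)] : Measure (EuclideanSpace ℝ (Fin d)))
        (U.domRestrict Ψ '' {z : U | ¬ P (Ψ z)}) = 0 := by
      refine measure_mono_null ?_ h0
      rintro _ ⟨z, hz, rfl⟩
      refine ⟨hz, ?_⟩
      have : Ψ z ∈ V ∩ frontier Ω := hVU ▸ mem_image_of_mem Ψ z.2
      exact this.2
    rw [this, mul_zero]
  rw [hset]
  exact (absolutelyContinuous_isAddHaarMeasure volume
    (μH[(d - 1 : ℕ)] : Measure (EuclideanSpace ℝ (Fin (d - 1))))) h1

theorem IsTangentialDeriv.congr {d : ℕ} {Ω : Set (EuclideanSpace ℝ (Fin d))}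
    {u₁ u₂ : EuclideanSpace ℝ (Fin d) → EuclideanSpace ℝ (Fin d)}
    {F₁ F₂ : EuclideanSpace ℝ (Fin d) → EuclideanSpace ℝ (Fin d) →L[ℝ] EuclideanSpace ℝ (Fin d)}
    (h : IsTangentialDeriv Ω u₁ F₁) (hu : u₁ =ᵐ[surfaceMeasure Ω] u₂)
    (hF : F₁ =ᵐ[surfaceMeasure Ω] F₂) : IsTangentialDeriv Ω u₂ F₂ := by
  refine ⟨?_, fun U Ψ hΨ => (h.2 U Ψ hΨ).congr (hΨ.ae_comp hu) ?_⟩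
  · filter_upwards [h.1, hF] with x hx hx' v hv
    rw [← hx', hx v hv]
  · filter_upwards [hΨ.ae_comp hF] with z hz
    rw [hz]

theorem IsTangentialDeriv.zero {d : ℕ} (Ω : Set (EuclideanSpace ℝ (Fin d))) :
    IsTangentialDeriv Ω (fun _ => 0) (fun _ => 0) := by
  refine ⟨by simp, fun U Ψ _ => ?_⟩
  simpa using HasWeakFDerivOn.zero

theorem IsTangentialDeriv.add {d : ℕ} {Ω : Set (EuclideanSpace ℝ (Fin d))}
    {u₁ u₂ : EuclideanSpace ℝ (Fin d) → EuclideanSpace ℝ (Fin d)}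
    {F₁ F₂ : EuclideanSpace ℝ (Fin d) → EuclideanSpace ℝ (Fin d) →L[ℝ] EuclideanSpace ℝ (Fin d)}
    (h₁ : IsTangentialDeriv Ω u₁ F₁) (h₂ : IsTangentialDeriv Ω u₂ F₂) :
    IsTangentialDeriv Ω (fun x => u₁ x + u₂ x) (fun x => F₁ x + F₂ x) := by
  refine ⟨?_, fun U Ψ hΨ => ?_⟩
  · filter_upwards [h₁.1, h₂.1] with x hx₁ hx₂ v hv
    rw [_root_.add_apply, hx₁ v hv, hx₂ v hv, add_zero]
  · simpa only [ContinuousLinearMap.add_comp] using (h₁.2 U Ψ hΨ).add (h₂.2 U Ψ hΨ)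

theorem IsTangentialDeriv.const_smul {d : ℕ} {Ω : Set (EuclideanSpace ℝ (Fin d))}
    {u : EuclideanSpace ℝ (Fin d) → EuclideanSpace ℝ (Fin d)}
    {F : EuclideanSpace ℝ (Fin d) → EuclideanSpace ℝ (Fin d) →L[ℝ] EuclideanSpace ℝ (Fin d)}
    (h : IsTangentialDeriv Ω u F) (c : ℝ) :
    IsTangentialDeriv Ω (fun x => c • u x) (fun x => c • F x) := by
  refine ⟨?_, fun U Ψ hΨ => ?_⟩
  · filter_upwards [h.1] with x hx v hv
    rw [_root_.smul_apply, hx v hv, smul_zero]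
  · simpa only [ContinuousLinearMap.smul_comp] using (h.2 U Ψ hΨ).const_smul c

/-- The Sobolev space `W^{1,p}(∂Ω; ℝ^d)`: the functions `u ∈ L^p(∂Ω; ℝ^d)` having a tangential
derivative `D^τ u ∈ L^p`, normed by `max (‖u‖_p) (‖D^τ u‖_p)`. Its elements are the pairs
`(u, D^τ u)`. -/
def boundarySobolev {d : ℕ} (Ω : Set (EuclideanSpace ℝ (Fin d))) (p : ℝ≥0∞) [Fact (1 ≤ p)] :
    Submodule ℝ (Lp (EuclideanSpace ℝ (Fin d)) p (surfaceMeasure Ω) ×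
      Lp (EuclideanSpace ℝ (Fin d) →L[ℝ] EuclideanSpace ℝ (Fin d)) p (surfaceMeasure Ω)) where
  carrier := {w | IsTangentialDeriv Ω (w.1 : EuclideanSpace ℝ (Fin d) → EuclideanSpace ℝ (Fin d))
    (w.2 : EuclideanSpace ℝ (Fin d) → EuclideanSpace ℝ (Fin d) →L[ℝ] EuclideanSpace ℝ (Fin d))}
  zero_mem' := (IsTangentialDeriv.zero Ω).congr
    (Lp.coeFn_zero (EuclideanSpace ℝ (Fin d)) p (surfaceMeasure Ω)).symm
    (Lp.coeFn_zero (EuclideanSpace ℝ (Fin d) →L[ℝ] EuclideanSpace ℝ (Fin d)) p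
      (surfaceMeasure Ω)).symm
  add_mem' := fun {w₁ w₂} h₁ h₂ => (IsTangentialDeriv.add h₁ h₂).congr
    (Lp.coeFn_add w₁.1 w₂.1).symm (Lp.coeFn_add w₁.2 w₂.2).symm
  smul_mem' := fun c w h => (IsTangentialDeriv.const_smul h c).congr
    (Lp.coeFn_smul c w.1).symm (Lp.coeFn_smul c w.2).symm

/-- The tangential derivative `D^τ u` of `u ∈ W^{1,p}(∂Ω; ℝ^d)`. -/
def tangentialDeriv {d : ℕ} {Ω : Set (EuclideanSpace ℝ (Fin d))} {p : ℝ≥0∞} [Fact (1 ≤ p)]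
    (u : boundarySobolev Ω p) :
    EuclideanSpace ℝ (Fin d) → EuclideanSpace ℝ (Fin d) →L[ℝ] EuclideanSpace ℝ (Fin d) :=
  u.1.2

/-- Weak convergence of a sequence in a normed space. -/
def WeaklyConverges {X : Type*} [NormedAddCommGroup X] [NormedSpace ℝ X]
    (x : ℕ → X) (a : X) : Prop :=
  Tendsto (fun n => toWeakSpace ℝ X (x n)) atTop (𝓝 (toWeakSpace ℝ X a))

/-- `f n ⇀ g` in `L¹(μ; W)`; in particular all these functions are in `L¹(μ; W)`. -/
def WeaklyConvergesL1 {X W : Type*} [MeasurableSpace X] [NormedAddCommGroup W] [NormedSpace ℝ W]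
    (μ : Measure X) (f : ℕ → X → W) (g : X → W) : Prop :=
  ∃ (hf : ∀ n, Integrable (f n) μ) (hg : Integrable g μ),
    WeaklyConverges (fun n => (hf n).toL1 (f n)) (hg.toL1 g)

/-- An `L^∞` basis of the tangent bundle of `∂Ω`: measurable fields `v₁, …, v_{d-1}` that form a
basis of `T_x ∂Ω` for almost every `x`, such that the map `ℝ^{d-1} → T_x ∂Ω`, `e_i ↦ v_i(x)`, has
an invertible linear extension `P x : ℝ^d → ℝ^d` with `P` and its inverse `Q` both in `L^∞`. -/
structure IsLInftyBasis {d : ℕ} (Ω : Set (EuclideanSpace ℝ (Fin d)))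
    (v : Fin (d - 1) → EuclideanSpace ℝ (Fin d) → EuclideanSpace ℝ (Fin d)) : Prop where
  aemeasurable : ∀ i, AEMeasurable (v i) (surfaceMeasure Ω)
  basis : ∀ᵐ x ∂(surfaceMeasure Ω), LinearIndependent ℝ (fun i => v i x) ∧
    Submodule.span ℝ (Set.range fun i => v i x) = tangentSpaceAt Ω x
  bounded : ∃ P Q : EuclideanSpace ℝ (Fin d) →
      EuclideanSpace ℝ (Fin d) →L[ℝ] EuclideanSpace ℝ (Fin d),
    MemLp P ∞ (surfaceMeasure Ω) ∧ MemLp Q ∞ (surfaceMeasure Ω) ∧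
    ∀ᵐ x ∂(surfaceMeasure Ω),
      (P x).comp (Q x) = ContinuousLinearMap.id ℝ _ ∧
      (Q x).comp (P x) = ContinuousLinearMap.id ℝ _ ∧
      ∀ i : Fin (d - 1), P x (EuclideanSpace.single (Fin.castLE (Nat.sub_le d 1) i) 1) = v i x

/-- The matrix of `L` restricted to the span of `b₁, …, b_m`, with respect to `b₁, …, b_m` and the
canonical basis of `ℝ^d`. -/
def matrixWrt {d m : ℕ} (b : Fin m → EuclideanSpace ℝ (Fin d))
    (L : EuclideanSpace ℝ (Fin d) →L[ℝ] EuclideanSpace ℝ (Fin d)) : Matrix (Fin d) (Fin m) ℝ :=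
  Matrix.of fun i j => L (b j) i

/-- Indices of the minors of a `d × m` matrix: an order `k + 1` with `1 ≤ k + 1 ≤ m`, together with
increasing choices of `k + 1` rows and of `k + 1` columns. -/
abbrev MinorIndex (d m : ℕ) : Type :=
  Σ k : Fin m, (Fin (k + 1) ↪o Fin d) × (Fin (k + 1) ↪o Fin m)

instance MinorIndex.instFintype (d m : ℕ) : Fintype (MinorIndex d m) :=
  Fintype.ofFinite _

/-- The vector of all minors, of all orders, of a matrix. -/
def minors {d m : ℕ} (A : Matrix (Fin d) (Fin m) ℝ) : EuclideanSpace ℝ (MinorIndex d m) :=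
  WithLp.toLp 2 fun I => (A.submatrix I.2.1 I.2.2).det

end

/-!
Minors are weakly continuous because they are null Lagrangians, and the statement on `∂Ω` is local.

In a bi-Lipschitz chart `Ψ : U → ∂Ω` the fields of an `L^∞` basis are combinations of the columns of
`DΨ` with bounded measurable coefficients (`IsBoundaryParam.exists_coefficients`). Hence a minor of
`D^τ u` is, in the chart, a combination with bounded coefficients of determinants `gradDet` formed
from directional derivatives of components of `u ∘ Ψ` (`minors_matrixWrt_eq_sum`). Since the surface
measure has a bounded density in the chart (`IsBoundaryParam.exists_density`), it is enough to prove
`∫ ψ gradDet (D f n) → ∫ ψ gradDet (D f₀)` for bounded `ψ` on the open set `U`, where the `f n` are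
bounded in `W^{1,p}(U)` and converge weakly to `f₀`.

The integral of `gradDet` vanishes if one of the functions has compact support: for smooth functions
by integration by parts and the symmetry of second derivatives (`integral_gradDet_fderiv_eq_zero`),
for Sobolev functions by mollification (`integral_gradDet_eq_zero`). For a smooth test function this
moves a derivative from `f n - f₀` to the test function, and `f n - f₀` tends to `0` strongly by
Rellich's theorem (`tendsto_eLpNorm_restrict_of_weakly_null`). Exchanging the rows one at a time
gives `tendsto_integral_mul_gradDet`. As `p` exceeds the number of rows, the determinants are
bounded in `L^s` for some `s > 1`, so that smooth test functions may be replaced by bounded ones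
(`tendsto_setIntegral_mul_gradDet`). The bounds needed here come from the uniform boundedness
principle (`WeaklyConverges.exists_norm_le`).

By compactness, finitely many charts cover `∂Ω`, and the local limits add up
(`exists_superset_tendsto_setIntegral_mul`). The functionals on `L¹` of a finite measure are given
by bounded functions (`exists_memLp_top_forall_eq_integral`), so this is weak convergence in `L¹`.

An `L^∞` basis exists because `DΨ`, which is bounded from above and below, can be completed by the
vector product of its columns to an invertible map (`crossExtension`); the inverses are bounded by
compactness. Finitely many charts are then combined measurably
(`IsLipschitzDomain.exists_isLInftyBasis`).
-/

set_option linter.unusedSectionVars false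

noncomputable section

/-! ### Mollification in `L^r` -/

/-- Minkowski's integral inequality for a probability measure: averaging over the parameter `t`
does not increase a uniform bound for the `L^r` norms of the functions `F (·, t)`. -/
theorem eLpNorm_integral_le_of_ae_le {X T W : Type*} [MeasurableSpace X] [MeasurableSpace T]
    [NormedAddCommGroup W] [NormedSpace ℝ W] {μ : Measure X} [SFinite μ] {ν : Measure T}
    [IsProbabilityMeasure ν] {F : X → T → W}
    (hF : AEStronglyMeasurable (Function.uncurry F) (μ.prod ν)) {r : ℝ≥0∞} (hr : 1 ≤ r)
    (hr' : r ≠ ⊤) {C : ℝ≥0∞} (hC : ∀ᵐ t ∂ν, eLpNorm (fun x => F x t) r μ ≤ C) :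
    eLpNorm (fun x => ∫ t, F x t ∂ν) r μ ≤ C := by
  have hr0 : r ≠ 0 := (one_pos.trans_le hr).ne'
  have hrpos : 0 < r.toReal := ENNReal.toReal_pos hr0 hr'
  have hmeas : ∀ᵐ x ∂μ, AEStronglyMeasurable (F x) ν := hF.prodMk_left
  rw [eLpNorm_eq_lintegral_rpow_enorm_toReal hr0 hr', one_div, ENNReal.rpow_inv_le_iff hrpos]
  calc ∫⁻ x, ‖∫ t, F x t ∂ν‖ₑ ^ r.toReal ∂μ
      ≤ ∫⁻ x, ∫⁻ t, ‖F x t‖ₑ ^ r.toReal ∂ν ∂μ := by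
        refine lintegral_mono_ae ?_
        filter_upwards [hmeas] with x hx
        have h1 : ‖∫ t, F x t ∂ν‖ₑ ≤ eLpNorm (F x) r ν := by
          refine (enorm_integral_le_lintegral_enorm _).trans ?_
          rw [← eLpNorm_one_eq_lintegral_enorm]
          exact eLpNorm_le_eLpNorm_of_exponent_le hr hx
        rw [eLpNorm_eq_lintegral_rpow_enorm_toReal hr0 hr'] at h1
        rwa [← ENNReal.le_rpow_inv_iff hrpos, ← one_div]
    _ = ∫⁻ t, ∫⁻ x, ‖F x t‖ₑ ^ r.toReal ∂μ ∂ν := by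
        refine lintegral_lintegral_swap ?_
        exact (hF.enorm.pow_const _)
    _ ≤ ∫⁻ t, C ^ r.toReal ∂ν := by
        refine lintegral_mono_ae ?_
        filter_upwards [hC] with t ht
        rw [eLpNorm_eq_lintegral_rpow_enorm_toReal hr0 hr',
          one_div, ENNReal.rpow_inv_le_iff hrpos] at ht
        exact ht
    _ = C ^ r.toReal := by simp

section Mollify

variable {E W : Type*} [NormedAddCommGroup E] [NormedSpace ℝ E] [FiniteDimensional ℝ E]
  [MeasurableSpace E] [BorelSpace E] [NormedAddCommGroup W] [NormedSpace ℝ W] [CompleteSpace W]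

/-- A bump function supported in the ball of radius `1 / (n + 1)`. -/
def mollifier (E : Type*) [NormedAddCommGroup E] [NormedSpace ℝ E] [FiniteDimensional ℝ E]
    (n : ℕ) : ContDiffBump (0 : E) where
  rIn := 1 / (2 * (n + 1))
  rOut := 1 / (n + 1)
  rIn_pos := by positivity
  rIn_lt_rOut := by
    rw [div_lt_div_iff₀ (by positivity) (by positivity)]
    have : (0 : ℝ) ≤ n := n.cast_nonneg
    linarith

/-- The mollification of `f` at scale `1 / (n + 1)`. -/
def mollify (μ : Measure E) (n : ℕ) (f : E → W) : E → W :=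
  convolution ((mollifier E n).normed μ) f (ContinuousLinearMap.lsmul ℝ ℝ) μ

theorem mollifier_rOut_tendsto : Tendsto (fun n => (mollifier E n).rOut) atTop (𝓝 0) :=
  tendsto_one_div_add_atTop_nhds_zero_nat

variable {μ : Measure E} [IsAddHaarMeasure μ] {f : E → W}

theorem contDiff_mollify (hf : LocallyIntegrable f μ) (n : ℕ) :
    ContDiff ℝ ∞ (mollify μ n f) :=
  (mollifier E n).hasCompactSupport_normed.contDiff_convolution_left _
    (mollifier E n).contDiff_normed hf

theorem integrable_mollifier_smul (hf : LocallyIntegrable f μ) (n : ℕ) (x : E) :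
    Integrable (fun t => (mollifier E n).normed μ t • f (x - t)) μ :=
  (mollifier E n).hasCompactSupport_normed.convolutionExists_left
    (ContinuousLinearMap.lsmul ℝ ℝ) (mollifier E n).continuous_normed hf x

theorem mollify_apply (n : ℕ) (x : E) :
    mollify μ n f x = ∫ t, (mollifier E n).normed μ t • f (x - t) ∂μ := rfl

theorem mollify_apply' (n : ℕ) (x : E) :
    mollify μ n f x = ∫ t, (mollifier E n).normed μ (x - t) • f t ∂μ := by
  rw [mollify_apply, ← integral_sub_left_eq_self _ μ x]
  simp

theorem mollify_sub_eq (hf : LocallyIntegrable f μ) (n : ℕ) (x : E) :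
    mollify μ n f x - f x
      = ∫ t, (mollifier E n).normed μ t • (f (x - t) - f x) ∂μ := by
  rw [mollify_apply]
  simp_rw [smul_sub]
  rw [integral_sub (integrable_mollifier_smul hf n x)
    ((mollifier E n).integrable_normed.smul_const _), ContDiffBump.integral_normed_smul]

/-- The probability measure with density `mollifier n`. -/
def mollifierMeasure (μ : Measure E) (n : ℕ) : Measure E :=
  μ.withDensity fun t => ENNReal.ofReal ((mollifier E n).normed μ t)

instance (n : ℕ) : IsProbabilityMeasure (mollifierMeasure μ n) := by
  constructor
  rw [mollifierMeasure, withDensity_apply _ MeasurableSet.univ, restrict_univ,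
    ← ofReal_integral_eq_lintegral_ofReal (mollifier E n).integrable_normed
      (Eventually.of_forall fun x => (mollifier E n).nonneg_normed x),
    (mollifier E n).integral_normed]
  simp

theorem ae_mollifierMeasure_norm_le (n : ℕ) :
    ∀ᵐ t ∂(mollifierMeasure μ n), ‖t‖ ≤ (mollifier E n).rOut := by
  rw [mollifierMeasure, ae_withDensity_iff
    ((mollifier E n).continuous_normed.measurable.ennreal_ofReal)]
  refine Eventually.of_forall fun t ht => ?_
  have h0 : (mollifier E n).normed μ t ≠ 0 := by
    intro h
    simp [h] at ht
  have : t ∈ Function.support ((mollifier E n).normed μ) := h0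
  rw [ContDiffBump.support_normed_eq] at this
  exact (mem_ball_zero_iff.1 this).le

theorem integral_mollifierMeasure (n : ℕ) (h : E → W) :
    ∫ t, h t ∂(mollifierMeasure μ n) = ∫ t, (mollifier E n).normed μ t • h t ∂μ := by
  rw [mollifierMeasure, integral_withDensity_eq_integral_toReal_smul
    ((mollifier E n).continuous_normed.measurable.ennreal_ofReal) (by simp)]
  refine integral_congr_ae (Eventually.of_forall fun t => ?_)
  simp only [ENNReal.toReal_ofReal ((mollifier E n).nonneg_normed t)]

/-- Mollifying moves `f` in `L^r` by at most the largest `L^r` distance to a translate by a vector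
in the support of the mollifier. -/
theorem eLpNorm_mollify_sub_le (hf : LocallyIntegrable f μ) (n : ℕ) {r : ℝ≥0∞} (hr : 1 ≤ r)
    (hr' : r ≠ ⊤) {C : ℝ≥0∞}
    (hC : ∀ t, ‖t‖ ≤ (mollifier E n).rOut → eLpNorm (fun x => f (x - t) - f x) r μ ≤ C) :
    eLpNorm (fun x => mollify μ n f x - f x) r μ ≤ C := by
  have hfm : AEStronglyMeasurable f μ := hf.aestronglyMeasurable
  have hac : μ.prod (mollifierMeasure μ n) ≪ μ.prod μ :=
    AbsolutelyContinuous.rfl.prod (withDensity_absolutelyContinuous _ _)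
  have key := eLpNorm_integral_le_of_ae_le (μ := μ) (ν := mollifierMeasure μ n)
    (F := fun x t => f (x - t) - f x) (C := C) ?_ hr hr' ?_
  · convert key using 2
    ext x
    rw [mollify_sub_eq hf, integral_mollifierMeasure]
  · refine AEStronglyMeasurable.sub ?_ hfm.comp_fst
    exact (hfm.comp_quasiMeasurePreserving
      (quasiMeasurePreserving_sub_of_right_invariant μ μ)).mono_ac hac
  · filter_upwards [ae_mollifierMeasure_norm_le (μ := μ) n] with t ht using hC t ht

theorem tendsto_eLpNorm_translate_sub {r : ℝ≥0∞} (hr : 1 ≤ r) (hr' : r ≠ ⊤) (hf : MemLp f r μ) :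
    Tendsto (fun t => eLpNorm (fun x => f (x - t) - f x) r μ) (𝓝 0) (𝓝 0) := by
  have : Fact (1 ≤ r) := ⟨hr⟩
  let g : E → C(E, E) := fun t => ⟨fun x => x - t, by fun_prop⟩
  have hg : Continuous g := by
    refine ContinuousMap.continuous_of_continuous_uncurry _ ?_
    show Continuous fun p : E × E => p.2 - p.1
    fun_prop
  have hgm : ∀ t, MeasurePreserving (g t) μ μ := fun t => measurePreserving_sub_right μ t
  have h1 : Continuous fun t => Lp.compMeasurePreserving (g t) (hgm t) (hf.toLp f) :=
    continuous_const.compMeasurePreservingLp hg hgm hr'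
  have h2 := (tendsto_iff_edist_tendsto_0.1 (h1.tendsto 0))
  refine h2.congr fun t => ?_
  rw [Lp.edist_def]
  refine eLpNorm_congr_ae ?_
  have e1 : ∀ t, Lp.compMeasurePreserving (g t) (hgm t) (hf.toLp f) =ᵐ[μ] fun x => f (x - t) := by
    intro t
    refine (Lp.coeFn_compMeasurePreserving _ _).trans ?_
    exact (hgm t).quasiMeasurePreserving.ae_eq_comp hf.coeFn_toLp
  filter_upwards [e1 t, e1 0] with x hx hx0
  simp only [Pi.sub_apply, hx, hx0, sub_zero]

/-- Mollifications converge in `L^r` for finite `r`. -/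
theorem tendsto_eLpNorm_mollify_sub {r : ℝ≥0∞} (hr : 1 ≤ r) (hr' : r ≠ ⊤) (hf : MemLp f r μ) :
    Tendsto (fun n => eLpNorm (fun x => mollify μ n f x - f x) r μ) atTop (𝓝 0) := by
  rw [ENNReal.tendsto_nhds_zero]
  intro ε hε
  have h1 := (ENNReal.tendsto_nhds_zero.1 (tendsto_eLpNorm_translate_sub hr hr' hf)) ε hε
  obtain ⟨δ, hδ, hδ'⟩ := Metric.eventually_nhds_iff.1 h1
  filter_upwards [(mollifier_rOut_tendsto (E := E)).eventually (gt_mem_nhds hδ)] with n hn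
  refine eLpNorm_mollify_sub_le (hf.locallyIntegrable hr) n hr hr' fun t ht => hδ' ?_
  simpa using ht.trans_lt hn

theorem memLp_mollify {r : ℝ≥0∞} (hr : 1 ≤ r) (hr' : r ≠ ⊤) (hf : MemLp f r μ)
    (n : ℕ) : MemLp (mollify μ n f) r μ := by
  have hm : AEStronglyMeasurable (mollify μ n f) μ :=
    (contDiff_mollify (hf.locallyIntegrable hr) n).continuous.aestronglyMeasurable
  have h1 : MemLp (fun x => mollify μ n f x - f x) r μ := by
    refine ⟨hm.sub hf.1, ?_⟩
    refine (eLpNorm_mollify_sub_le (C := 2 * eLpNorm f r μ) (hf.locallyIntegrable hr) n hr hr'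
      fun t _ => ?_).trans_lt (ENNReal.mul_lt_top (by simp) hf.2)
    have hmp := measurePreserving_sub_right μ t
    refine (eLpNorm_sub_le (hf.1.comp_measurePreserving hmp) hf.1 hr).trans ?_
    rw [two_mul]
    gcongr
    exact (eLpNorm_comp_measurePreserving hf.1 hmp).le
  have := h1.add hf
  refine this.congr_norm hm (Eventually.of_forall fun x => ?_)
  simp

end Mollify

/-! ### Sobolev functions -/

section Sobolev

variable {m : ℕ} {W W' : Type*} [NormedAddCommGroup W] [NormedSpace ℝ W]
  [NormedAddCommGroup W'] [NormedSpace ℝ W']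

theorem HasWeakFDerivOn.clm_comp [CompleteSpace W] [CompleteSpace W']
    {f : EuclideanSpace ℝ (Fin m) → W}
    {g : EuclideanSpace ℝ (Fin m) → EuclideanSpace ℝ (Fin m) →L[ℝ] W}
    {U : Set (EuclideanSpace ℝ (Fin m))} (h : HasWeakFDerivOn f g U) (L : W →L[ℝ] W') :
    HasWeakFDerivOn (fun z => L (f z)) (fun z => L.comp (g z)) U := by
  refine ⟨fun x hx => ?_, fun x hx => ?_, ?_⟩
  · obtain ⟨s, hs, hi⟩ := h.1 x hx
    exact ⟨s, hs, L.integrable_comp hi⟩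
  · obtain ⟨s, hs, hi⟩ := h.2 x hx
    exact ⟨s, hs, ((ContinuousLinearMap.compL ℝ (EuclideanSpace ℝ (Fin m)) W W') L).integrable_comp
      hi⟩
  · intro φ hφ hc hs v
    have h1 := congrArg L (h.3 φ hφ hc hs v)
    rw [map_neg, ← L.integral_comp_comm (h.integrable_left hφ hc hs v),
      ← L.integral_comp_comm (h.integrable_right hφ hc hs v)] at h1
    simpa using h1

/-- Multiplying a weakly differentiable function on `U` by a cutoff function with compact support
in `U` gives a function that is weakly differentiable on the whole space. -/
theorem HasWeakFDerivOn.cutoff {f : EuclideanSpace ℝ (Fin m) → ℝ}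
    {g : EuclideanSpace ℝ (Fin m) → EuclideanSpace ℝ (Fin m) →L[ℝ] ℝ}
    {U : Set (EuclideanSpace ℝ (Fin m))} (h : HasWeakFDerivOn f g U)
    {χ : EuclideanSpace ℝ (Fin m) → ℝ} (hχ : ContDiff ℝ ∞ χ) (hχc : HasCompactSupport χ)
    (hχU : tsupport χ ⊆ U) :
    HasWeakFDerivOn (fun z => χ z * f z) (fun z => χ z • g z + f z • fderiv ℝ χ z) univ := by
  have hχ' : Continuous (fderiv ℝ χ) := hχ.continuous_fderiv (by simp)
  have hz : ∀ z ∉ U, χ z = 0 := fun z hz => image_eq_zero_of_notMem_tsupport fun h => hz (hχU h)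
  have hz' : ∀ z ∉ U, fderiv ℝ χ z = 0 := fun z hz =>
    image_eq_zero_of_notMem_tsupport fun h => hz (hχU (tsupport_fderiv_subset ℝ h))
  have extend : ∀ {V : Type} [NormedAddCommGroup V] {s : Set (EuclideanSpace ℝ (Fin m))}
      (h : EuclideanSpace ℝ (Fin m) → V),
      (∀ z ∉ s, h z = 0) → IntegrableOn h s → Integrable h := by
    intro V _ s h h0 hi
    refine (integrableOn_iff_integrable_of_support_subset fun z hz0 => ?_).1 hi
    by_contra hn
    exact hz0 (h0 z hn)
  have hi1 : Integrable (fun z => χ z * f z) :=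
    extend _ (fun z hzU => by simp [hz z hzU])
      (LocallyIntegrableOn.integrable_testFunction_smul h.1 hχ.continuous hχc hχU)
  have hi2 : Integrable (fun z => χ z • g z) :=
    extend _ (fun z hzU => by simp [hz z hzU])
      (LocallyIntegrableOn.integrable_testFunction_smul h.2 hχ.continuous hχc hχU)
  have hi3 : Integrable (fun z => f z • fderiv ℝ χ z) := by
    have hK : IntegrableOn f (tsupport χ) := h.1.integrableOn_compact_subset hχU hχc
    refine extend (s := tsupport χ) _ (fun z hz0 => ?_) (hK.smul_continuousOn hχ'.continuousOn hχc)
    simp [image_eq_zero_of_notMem_tsupport fun h => hz0 (tsupport_fderiv_subset ℝ h)]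
  have hi23 : Integrable (fun z => χ z • g z + f z • fderiv ℝ χ z) :=
    Integrable.add (f := fun z => χ z • g z) (g := fun z => f z • fderiv ℝ χ z) hi2 hi3
  refine ⟨hi1.locallyIntegrable.locallyIntegrableOn _,
    hi23.locallyIntegrable.locallyIntegrableOn _, ?_⟩
  intro φ hφ hc _ v
  have hφχ : ContDiff ℝ ∞ (fun z => φ z * χ z) := hφ.mul hχ
  have hφχc : HasCompactSupport (fun z => φ z * χ z) := hχc.mul_left
  have hφχU : tsupport (fun z => φ z * χ z) ⊆ U :=
    (closure_mono (Function.support_mul_subset_right φ χ)).trans hχU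
  have hd : ∀ z, fderiv ℝ (fun z => φ z * χ z) z v
      = φ z * fderiv ℝ χ z v + χ z * fderiv ℝ φ z v := by
    intro z
    rw [fderiv_fun_mul (hφ.differentiable (by simp) z) (hχ.differentiable (by simp) z)]
    simp
  have key := h.3 _ hφχ hφχc hφχU v
  have iA : Integrable fun z => fderiv ℝ (fun z => φ z * χ z) z v • f z :=
    extend _ (fun z hzU => by simp [hd, hz z hzU, hz' z hzU])
      (h.integrable_left hφχ hφχc hφχU v)
  have iC : Integrable fun z => (φ z * χ z) • g z v :=
    extend _ (fun z hzU => by simp [hz z hzU]) (h.integrable_right hφχ hφχc hφχU v)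
  have iB : Integrable fun z => φ z * (f z * fderiv ℝ χ z v) := by
    have h4 := (hi3.apply_continuousLinearMap v).locallyIntegrable.locallyIntegrableOn univ
    simpa using LocallyIntegrableOn.integrable_testFunction_smul h4 hφ.continuous hc
      (subset_univ _)
  rw [setIntegral_eq_integral_of_forall_compl_eq_zero
      (fun z hzU => by simp [hd, hz z hzU, hz' z hzU]),
    setIntegral_eq_integral_of_forall_compl_eq_zero (fun z hzU => by simp [hz z hzU])] at key
  simp only [restrict_univ]
  have e1 : ∫ z, fderiv ℝ φ z v • (χ z * f z)
      = (∫ z, fderiv ℝ (fun z => φ z * χ z) z v • f z) - ∫ z, φ z * (f z * fderiv ℝ χ z v) := by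
    rw [← integral_sub iA iB]
    refine integral_congr_ae (Eventually.of_forall fun z => ?_)
    simp only [hd, smul_eq_mul]
    ring
  have e2 : ∫ z, φ z • (χ z • g z + f z • fderiv ℝ χ z) v
      = (∫ z, (φ z * χ z) • g z v) + ∫ z, φ z * (f z * fderiv ℝ χ z v) := by
    rw [← integral_add iC iB]
    refine integral_congr_ae (Eventually.of_forall fun z => ?_)
    simp only [_root_.add_apply, _root_.smul_apply, smul_eq_mul]
    ring
  rw [e1, e2, key]
  ring

theorem HasWeakFDerivOn.fderiv_mollify [CompleteSpace W] {f : EuclideanSpace ℝ (Fin m) → W}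
    {g : EuclideanSpace ℝ (Fin m) → EuclideanSpace ℝ (Fin m) →L[ℝ] W}
    (h : HasWeakFDerivOn f g univ) (n : ℕ) (x : EuclideanSpace ℝ (Fin m)) :
    fderiv ℝ (mollify volume n f) x = mollify volume n g x := by
  have hf : LocallyIntegrable f := locallyIntegrableOn_univ.1 h.1
  have hg : LocallyIntegrable g := locallyIntegrableOn_univ.1 h.2
  have hρ : ContDiff ℝ ∞ ((mollifier (EuclideanSpace ℝ (Fin m)) n).normed volume) :=
    (mollifier _ n).contDiff_normed
  have hρc : HasCompactSupport ((mollifier (EuclideanSpace ℝ (Fin m)) n).normed volume) :=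
    (mollifier _ n).hasCompactSupport_normed
  set ρ := (mollifier (EuclideanSpace ℝ (Fin m)) n).normed volume with hρdef
  have h1 := hρc.hasFDerivAt_convolution_left (ContinuousLinearMap.lsmul ℝ ℝ) (hρ.of_le (by simp))
    hf x
  have h1' : fderiv ℝ (mollify volume n f) x = _ := h1.fderiv
  rw [h1']
  ext v
  have hex : ConvolutionExistsAt (fderiv ℝ ρ) f x
      ((ContinuousLinearMap.lsmul ℝ ℝ : ℝ →L[ℝ] W →L[ℝ] W).precompL (EuclideanSpace ℝ (Fin m)))
      volume :=
    (hρc.fderiv (𝕜 := ℝ)).convolutionExists_left _ (hρ.continuous_fderiv (by simp)) hf x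
  have e1 : (convolution (fderiv ℝ ρ) f
      ((ContinuousLinearMap.lsmul ℝ ℝ : ℝ →L[ℝ] W →L[ℝ] W).precompL (EuclideanSpace ℝ (Fin m)))
      volume x) v = ∫ t, (fderiv ℝ ρ t v) • f (x - t) := by
    rw [convolution_def, ContinuousLinearMap.integral_apply hex]
    simp [ContinuousLinearMap.precompL_apply]
  rw [e1]
  have e2 : mollify volume n g x v = ∫ t, ρ (x - t) • g t v := by
    rw [mollify_apply', ContinuousLinearMap.integral_apply]
    · rfl
    · have := (integrable_mollifier_smul hg n x).comp_sub_left x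
      simpa using this
  rw [e2]
  have hφ : ContDiff ℝ ∞ (fun t => ρ (x - t)) := hρ.comp (contDiff_const.sub contDiff_id)
  have hφc : HasCompactSupport (fun t => ρ (x - t)) :=
    hρc.comp_homeomorph (Homeomorph.subLeft x)
  have key := h.3 _ hφ hφc (subset_univ _) v
  simp only [restrict_univ] at key
  rw [eq_comm, neg_eq_iff_eq_neg] at key
  rw [key, ← integral_sub_left_eq_self _ volume x, ← integral_neg]
  refine integral_congr_ae (Eventually.of_forall fun t => ?_)
  have hd : fderiv ℝ (fun t => ρ (x - t)) t v = - fderiv ℝ ρ (x - t) v := by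
    have h3 : HasFDerivAt (fun t => ρ (x - t)) ((fderiv ℝ ρ (x - t)).comp
        (-ContinuousLinearMap.id ℝ _)) t := by
      refine HasFDerivAt.comp t (hρ.differentiable (by simp) _).hasFDerivAt ?_
      simpa using (hasFDerivAt_id t).const_sub x
    rw [h3.fderiv]
    simp
  simp only [hd]
  simp

/-- Translating a `C¹` function by `t` moves it in `L^r` by at most `‖t‖` times the norm of its
derivative. -/
theorem eLpNorm_translate_sub_le_of_contDiff [CompleteSpace W] {f : EuclideanSpace ℝ (Fin m) → W}
    (hf : ContDiff ℝ 1 f)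
    {r : ℝ≥0∞} (hr : 1 ≤ r) (hr' : r ≠ ⊤) (t : EuclideanSpace ℝ (Fin m)) :
    eLpNorm (fun x => f (x - t) - f x) r volume ≤ ‖t‖ₑ * eLpNorm (fderiv ℝ f) r volume := by
  have hf' : Continuous (fderiv ℝ f) := hf.continuous_fderiv one_ne_zero
  have hν : IsProbabilityMeasure (volume.restrict (Ioc (0 : ℝ) 1)) := ⟨by simp⟩
  have key := eLpNorm_integral_le_of_ae_le (μ := (volume : Measure (EuclideanSpace ℝ (Fin m))))
    (ν := volume.restrict (Ioc (0 : ℝ) 1)) (F := fun x s => fderiv ℝ f (x - s • t) (-t))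
    (C := ‖t‖ₑ * eLpNorm (fderiv ℝ f) r volume) ?_ hr hr' ?_
  · convert key using 2
    ext x
    rw [← intervalIntegral.integral_of_le zero_le_one]
    have hderiv : ∀ s ∈ uIcc (0 : ℝ) 1,
        HasDerivAt (fun s : ℝ => f (x - s • t)) (fderiv ℝ f (x - s • t) (-t)) s := by
      intro s _
      have h2 : HasDerivAt (fun s : ℝ => x - s • t) (-t) s := by
        simpa using ((hasDerivAt_id s).smul_const t).const_sub x
      exact ((hf.differentiable one_ne_zero _).hasFDerivAt.comp_hasDerivAt s h2)
    rw [intervalIntegral.integral_eq_sub_of_hasDerivAt hderiv]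
    · simp
    · refine Continuous.intervalIntegrable ?_ _ _
      fun_prop
  · refine Continuous.aestronglyMeasurable ?_
    simp only [Function.uncurry_def]
    fun_prop
  · refine Eventually.of_forall fun s => ?_
    have hmp := measurePreserving_sub_right (volume : Measure (EuclideanSpace ℝ (Fin m))) (s • t)
    rw [← eLpNorm_comp_measurePreserving hf'.aestronglyMeasurable hmp]
    refine eLpNorm_le_mul_eLpNorm_of_ae_le_mul'' (c := ‖t‖ₑ) r
      (hf'.aestronglyMeasurable.comp_measurePreserving hmp) (Eventually.of_forall fun x => ?_)
    have := (fderiv ℝ f (x - s • t)).le_opENorm (-t)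
    simpa [mul_comm] using this

section

variable {f : EuclideanSpace ℝ (Fin m) → W}
    {g : EuclideanSpace ℝ (Fin m) → EuclideanSpace ℝ (Fin m) →L[ℝ] W} {r : ℝ≥0∞}

theorem HasWeakFDerivOn.eLpNorm_translate_sub_le [CompleteSpace W]
    (h : HasWeakFDerivOn f g univ) (hr : 1 ≤ r) (hr' : r ≠ ⊤) (hf : MemLp f r) (hg : MemLp g r)
    (t : EuclideanSpace ℝ (Fin m)) :
    eLpNorm (fun x => f (x - t) - f x) r volume ≤ ‖t‖ₑ * eLpNorm g r volume := by
  have hmp := measurePreserving_sub_right (volume : Measure (EuclideanSpace ℝ (Fin m))) t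
  have hcont : ∀ n, ContDiff ℝ ∞ (mollify volume n f) :=
    contDiff_mollify (hf.locallyIntegrable hr)
  have hfn := memLp_mollify hr hr' hf
  have hgn := memLp_mollify hr hr' hg
  set a : ℕ → ℝ≥0∞ := fun n => eLpNorm (fun x => mollify volume n f x - f x) r volume
  set b : ℕ → ℝ≥0∞ := fun n => eLpNorm (fun x => mollify volume n g x - g x) r volume
  have ha : Tendsto a atTop (𝓝 0) := tendsto_eLpNorm_mollify_sub hr hr' hf
  have hb : Tendsto b atTop (𝓝 0) := tendsto_eLpNorm_mollify_sub hr hr' hg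
  have hlim : Tendsto (fun n => a n + (‖t‖ₑ * (b n + eLpNorm g r volume) + a n)) atTop
      (𝓝 (0 + (‖t‖ₑ * (0 + eLpNorm g r volume) + 0))) :=
    ha.add ((ENNReal.Tendsto.const_mul (hb.add tendsto_const_nhds) (Or.inr (by simp))).add ha)
  rw [zero_add, zero_add, add_zero] at hlim
  refine ge_of_tendsto' hlim fun n => ?_
  have m1 : AEStronglyMeasurable (fun x => mollify volume n f x - f x) :=
    (hfn n).1.sub hf.1
  have m1' : AEStronglyMeasurable (fun x => mollify volume n f (x - t) - f (x - t)) :=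
    m1.comp_measurePreserving hmp
  have m2 : AEStronglyMeasurable (fun x => mollify volume n f (x - t) - mollify volume n f x) :=
    ((hfn n).1.comp_measurePreserving hmp).sub (hfn n).1
  have e1 : (fun x => f (x - t) - f x)
      = (-fun x => mollify volume n f (x - t) - f (x - t)) +
        ((fun x => mollify volume n f (x - t) - mollify volume n f x)
          + fun x => mollify volume n f x - f x) := by
    ext x
    simp only [Pi.add_apply, Pi.neg_apply]
    abel
  rw [e1]
  refine (eLpNorm_add_le (f := -fun x => mollify volume n f (x - t) - f (x - t)) m1'.neg
    (m2.add m1) hr).trans ?_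
  refine add_le_add ?_ ((eLpNorm_add_le m2 m1 hr).trans (add_le_add ?_ le_rfl))
  · rw [eLpNorm_neg]
    exact (eLpNorm_comp_measurePreserving m1 hmp).le
  · refine (eLpNorm_translate_sub_le_of_contDiff ((hcont n).of_le (by simp)) hr hr' t).trans ?_
    gcongr
    have m3 : AEStronglyMeasurable (fun x => mollify volume n g x - g x) := (hgn n).1.sub hg.1
    have e2 := eLpNorm_add_le (f := fun x => mollify volume n g x - g x) (g := g) m3 hg.1 hr
    refine le_trans (le_of_eq (eLpNorm_congr_ae (Eventually.of_forall fun x => ?_))) e2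
    simp [h.fderiv_mollify n x]

theorem HasWeakFDerivOn.eLpNorm_mollify_sub_le [CompleteSpace W]
    (h : HasWeakFDerivOn f g univ) (hr : 1 ≤ r) (hr' : r ≠ ⊤) (hf : MemLp f r) (hg : MemLp g r)
    (n : ℕ) :
    eLpNorm (fun x => mollify volume n f x - f x) r volume
      ≤ ENNReal.ofReal (1 / (n + 1)) * eLpNorm g r volume := by
  refine _root_.eLpNorm_mollify_sub_le (hf.locallyIntegrable hr) n hr hr' fun t ht => ?_
  refine (h.eLpNorm_translate_sub_le hr hr' hf hg t).trans ?_
  gcongr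
  rw [← ofReal_norm]
  exact ENNReal.ofReal_le_ofReal ht

end

/-- Rellich's theorem for a weakly null sequence of Sobolev functions: mollifying at a small scale
moves all of them little, and the mollified functions tend to `0` boundedly. -/
theorem tendsto_eLpNorm_restrict_of_weakly_null {f : ℕ → EuclideanSpace ℝ (Fin m) → ℝ}
    {g : ℕ → EuclideanSpace ℝ (Fin m) → EuclideanSpace ℝ (Fin m) →L[ℝ] ℝ} {r : ℝ≥0∞}
    (hr : 1 ≤ r) (hr' : r ≠ ⊤) (h : ∀ n, HasWeakFDerivOn (f n) (g n) univ)
    (hf : ∀ n, MemLp (f n) r) (hg : ∀ n, MemLp (g n) r) {M : ℝ≥0}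
    (hM : ∀ n, eLpNorm (g n) r volume ≤ M) (hM1 : ∀ n, eLpNorm (f n) 1 volume ≤ M)
    (hw : ∀ ψ : EuclideanSpace ℝ (Fin m) → ℝ, Continuous ψ → HasCompactSupport ψ →
      Tendsto (fun n => ∫ z, ψ z * f n z) atTop (𝓝 0))
    {K : Set (EuclideanSpace ℝ (Fin m))} (hK : volume K ≠ ⊤) :
    Tendsto (fun n => eLpNorm (f n) r (volume.restrict K)) atTop (𝓝 0) := by
  have hr0 : r ≠ 0 := (one_pos.trans_le hr).ne'
  have hrpos : 0 < r.toReal := ENNReal.toReal_pos hr0 hr'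
  have hmoll : ∀ j, Tendsto (fun n => eLpNorm (mollify volume j (f n)) r (volume.restrict K))
      atTop (𝓝 0) := by
    intro j
    obtain ⟨B, hB⟩ := (mollifier (EuclideanSpace ℝ (Fin m)) j).continuous_normed
      (μ := volume) |>.bounded_above_of_compact_support
        (mollifier (EuclideanSpace ℝ (Fin m)) j).hasCompactSupport_normed
    have hpt : ∀ x, Tendsto (fun n => mollify volume j (f n) x) atTop (𝓝 0) := by
      intro x
      simp_rw [mollify_apply', smul_eq_mul]
      refine hw _ ?_ ?_
      · exact (mollifier _ j).continuous_normed.comp (continuous_const.sub continuous_id)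
      · exact (mollifier _ j).hasCompactSupport_normed.comp_homeomorph (Homeomorph.subLeft x)
    have hbd : ∀ n x, ‖mollify volume j (f n) x‖ₑ ≤ ENNReal.ofReal B * M := by
      intro n x
      rw [mollify_apply']
      refine (enorm_integral_le_lintegral_enorm _).trans ?_
      calc ∫⁻ t, ‖(mollifier (EuclideanSpace ℝ (Fin m)) j).normed volume (x - t) • f n t‖ₑ
          ≤ ∫⁻ t, ENNReal.ofReal B * ‖f n t‖ₑ := by
            refine lintegral_mono fun t => ?_
            rw [enorm_smul]
            gcongr
            rw [← ofReal_norm]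
            exact ENNReal.ofReal_le_ofReal (hB _)
        _ = ENNReal.ofReal B * eLpNorm (f n) 1 volume := by
            rw [lintegral_const_mul' _ _ (by simp), eLpNorm_one_eq_lintegral_enorm]
        _ ≤ _ := by gcongr; exact hM1 n
    have hlim : Tendsto (fun n => ∫⁻ x in K, ‖mollify volume j (f n) x‖ₑ ^ r.toReal) atTop
        (𝓝 (∫⁻ x in K, 0)) := by
      refine tendsto_lintegral_of_dominated_convergence'
        (fun _ => (ENNReal.ofReal B * M) ^ r.toReal) (fun n => ?_)
        (fun n => Eventually.of_forall fun x => ?_) ?_ (Eventually.of_forall fun x => ?_)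
      · exact ((memLp_mollify hr hr' (hf n) j).1.restrict.enorm.pow_const _)
      · exact ENNReal.rpow_le_rpow (hbd n x) hrpos.le
      · rw [setLIntegral_const]
        refine ENNReal.mul_ne_top (ENNReal.rpow_ne_top_of_nonneg hrpos.le ?_) hK
        exact ENNReal.mul_ne_top (by simp) (by simp)
      · have := ((hpt x).enorm).ennrpow_const r.toReal
        simpa [hrpos] using this
    have := hlim.ennrpow_const (1 / r.toReal)
    simp only [lintegral_zero] at this
    rw [ENNReal.zero_rpow_of_pos (by positivity)] at this
    refine this.congr fun n => ?_
    rw [eLpNorm_eq_lintegral_rpow_enorm_toReal hr0 hr']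
  rw [ENNReal.tendsto_nhds_zero]
  intro ε hε
  have h1 : Tendsto (fun j : ℕ => ENNReal.ofReal (1 / ((j : ℝ) + 1)) * M) atTop (𝓝 0) := by
    have := ENNReal.tendsto_ofReal (tendsto_one_div_add_atTop_nhds_zero_nat (𝕜 := ℝ))
    simpa using ENNReal.Tendsto.mul_const this (Or.inr (ENNReal.coe_ne_top (r := M)))
  have hε2 : 0 < ε / 2 := ENNReal.half_pos hε.ne'
  obtain ⟨j, hj⟩ := ((ENNReal.tendsto_nhds_zero.1 h1) _ hε2).exists
  filter_upwards [(ENNReal.tendsto_nhds_zero.1 (hmoll j)) _ hε2] with n hn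
  have m1 := (memLp_mollify hr hr' (hf n) j).1
  have e1 : f n = mollify volume j (f n) - fun x => mollify volume j (f n) x - f n x := by
    ext x
    simp
  rw [e1, ← ENNReal.add_halves ε]
  refine (eLpNorm_sub_le m1.restrict (m1.sub (hf n).1).restrict hr).trans (add_le_add hn ?_)
  refine (eLpNorm_restrict_le _ _ _ _).trans ?_
  refine ((h n).eLpNorm_mollify_sub_le hr hr' (hf n) (hg n) j).trans (le_trans ?_ hj)
  gcongr
  exact hM n

end Sobolev

/-! ### Determinants of gradients -/

section GradDet

variable {ι : Type} [Fintype ι] [DecidableEq ι] {m : ℕ}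

/-- The determinant of the matrix `(L i (e j))`, for linear forms `L i` and vectors `e j`. -/
def gradDet (e : ι → EuclideanSpace ℝ (Fin m)) (L : ι → EuclideanSpace ℝ (Fin m) →L[ℝ] ℝ) : ℝ :=
  (Matrix.of fun i j => L i (e j)).det

variable (e : ι → EuclideanSpace ℝ (Fin m)) (L : ι → EuclideanSpace ℝ (Fin m) →L[ℝ] ℝ)

theorem gradDet_update (a : ι) (X : EuclideanSpace ℝ (Fin m) →L[ℝ] ℝ) :
    gradDet e (Function.update L a X)
      = ((Matrix.of fun i j => L i (e j)).updateRow a fun j => X (e j)).det := by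
  rw [gradDet]
  congr 1
  ext i j
  by_cases h : i = a
  · subst h
    simp
  · simp [h]

theorem gradDet_update_sub (a : ι) (X Y : EuclideanSpace ℝ (Fin m) →L[ℝ] ℝ) :
    gradDet e (Function.update L a (X - Y))
      = gradDet e (Function.update L a X) - gradDet e (Function.update L a Y) := by
  rw [eq_sub_iff_add_eq]
  simp only [gradDet_update]
  rw [← Matrix.det_updateRow_add]
  congr 2
  ext j
  simp

theorem gradDet_update_add (a : ι) (X Y : EuclideanSpace ℝ (Fin m) →L[ℝ] ℝ) :
    gradDet e (Function.update L a (X + Y))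
      = gradDet e (Function.update L a X) + gradDet e (Function.update L a Y) := by
  simp only [gradDet_update]
  rw [← Matrix.det_updateRow_add]
  congr 2

theorem gradDet_update_smul (a : ι) (c : ℝ) (X : EuclideanSpace ℝ (Fin m) →L[ℝ] ℝ) :
    gradDet e (Function.update L a (c • X)) = c * gradDet e (Function.update L a X) := by
  simp only [gradDet_update]
  rw [← Matrix.det_updateRow_smul]
  congr 2

theorem gradDet_eq_sum :
    gradDet e L = ∑ σ : Equiv.Perm ι, ((Equiv.Perm.sign σ : ℤ) : ℝ) * ∏ i, L i (e (σ i)) := by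
  rw [gradDet, ← Matrix.det_transpose, Matrix.det_apply']
  rfl

/-- The constant in the pointwise bound for `gradDet`. -/
def gradDetBound (e : ι → EuclideanSpace ℝ (Fin m)) : ℝ≥0 :=
  (Fintype.card (Equiv.Perm ι) : ℝ≥0) * ∏ i, ‖e i‖₊

theorem nnnorm_gradDet_le : ‖gradDet e L‖₊ ≤ gradDetBound e * ∏ i, ‖L i‖₊ := by
  rw [gradDet_eq_sum]
  refine (nnnorm_sum_le _ _).trans ?_
  have : ∀ σ ∈ (Finset.univ : Finset (Equiv.Perm ι)),
      ‖((Equiv.Perm.sign σ : ℤ) : ℝ) * ∏ i, L i (e (σ i))‖₊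
        ≤ (∏ i, ‖e i‖₊) * ∏ i, ‖L i‖₊ := by
    intro σ _
    have h1 : ‖((Equiv.Perm.sign σ : ℤ) : ℝ)‖₊ = 1 := by
      rcases Int.units_eq_one_or (Equiv.Perm.sign σ) with h | h <;> simp [h]
    rw [nnnorm_mul, h1, one_mul, nnnorm_prod, ← Equiv.prod_comp σ fun i => ‖e i‖₊,
      ← Finset.prod_mul_distrib]
    refine Finset.prod_le_prod' fun i _ => ?_
    rw [mul_comm]
    exact (L i).le_opNNNorm _
  refine (Finset.sum_le_card_nsmul _ _ _ this).trans (le_of_eq ?_)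
  rw [gradDetBound, nsmul_eq_mul, mul_assoc, Finset.card_univ]

theorem enorm_gradDet_le : ‖gradDet e L‖ₑ ≤ gradDetBound e * ∏ i, ‖L i‖ₑ := by
  simp only [enorm_eq_nnnorm]
  exact_mod_cast nnnorm_gradDet_le e L

variable {α : Type*} [MeasurableSpace α] {μ : Measure α}
  {G : ι → α → EuclideanSpace ℝ (Fin m) →L[ℝ] ℝ}

theorem aestronglyMeasurable_gradDet (hG : ∀ i, AEStronglyMeasurable (G i) μ) :
    AEStronglyMeasurable (fun x => gradDet e fun i => G i x) μ := by
  simp only [gradDet_eq_sum]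
  refine Finset.aestronglyMeasurable_fun_sum _ fun σ _ => ?_
  refine AEStronglyMeasurable.const_mul ?_ _
  refine Finset.aestronglyMeasurable_fun_prod _ fun i _ => ?_
  exact (hG i).apply_continuousLinearMap _

/-- Hölder's inequality for the determinant of a gradient: its `L^s` norm is controlled by the
`L^(k s)` norms of the rows, where `k` is the number of rows. -/
theorem eLpNorm_gradDet_le [Nonempty ι] (hG : ∀ i, AEStronglyMeasurable (G i) μ) {s : ℝ}
    (hs : 0 < s) :
    eLpNorm (fun x => gradDet e fun i => G i x) (ENNReal.ofReal s) μ
      ≤ gradDetBound e * ∏ i, eLpNorm (G i) (ENNReal.ofReal (Fintype.card ι * s)) μ := by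
  set k : ℝ := ((Fintype.card ι : ℕ) : ℝ) with hk
  have hkpos : 0 < k := by
    rw [hk]
    exact_mod_cast Fintype.card_pos
  have hks : 0 < k * s := mul_pos hkpos hs
  have hGe : ∀ i, eLpNorm (G i) (ENNReal.ofReal (k * s)) μ
      = (∫⁻ x, ‖G i x‖ₑ ^ (k * s) ∂μ) ^ (1 / (k * s)) := fun i => by
    rw [eLpNorm_eq_lintegral_rpow_enorm_toReal (by simpa using hks) (by simp),
      ENNReal.toReal_ofReal hks.le]
  rw [eLpNorm_eq_lintegral_rpow_enorm_toReal (by simpa using hs) (by simp),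
    ENNReal.toReal_ofReal hs.le, one_div, ENNReal.rpow_inv_le_iff hs]
  simp_rw [hGe]
  calc ∫⁻ x, ‖gradDet e fun i => G i x‖ₑ ^ s ∂μ
      ≤ ∫⁻ x, (gradDetBound e : ℝ≥0∞) ^ s * ∏ i, (‖G i x‖ₑ ^ (k * s)) ^ (1 / k) ∂μ := by
        refine lintegral_mono fun x =>
          (ENNReal.rpow_le_rpow (enorm_gradDet_le e _) hs.le).trans (le_of_eq ?_)
        rw [ENNReal.mul_rpow_of_nonneg _ _ hs.le, ← ENNReal.prod_rpow_of_nonneg hs.le]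
        congr 1
        refine Finset.prod_congr rfl fun i _ => ?_
        rw [← ENNReal.rpow_mul]
        congr 1
        field_simp
    _ = (gradDetBound e : ℝ≥0∞) ^ s * ∫⁻ x, ∏ i, (‖G i x‖ₑ ^ (k * s)) ^ (1 / k) ∂μ :=
        lintegral_const_mul' _ _ (ENNReal.rpow_ne_top_of_nonneg hs.le (by simp))
    _ ≤ (gradDetBound e : ℝ≥0∞) ^ s * ∏ i, (∫⁻ x, ‖G i x‖ₑ ^ (k * s) ∂μ) ^ (1 / k) := by
        gcongr
        refine ENNReal.lintegral_prod_norm_pow_le _ (fun i _ => ?_) ?_ (fun i _ => by positivity)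
        · exact (hG i).enorm.pow_const _
        · rw [Finset.sum_const, Finset.card_univ, nsmul_eq_mul, ← hk]
          field_simp
    _ = _ := by
        rw [ENNReal.mul_rpow_of_nonneg _ _ hs.le, ← ENNReal.prod_rpow_of_nonneg hs.le]
        congr 1
        refine Finset.prod_congr rfl fun i _ => ?_
        rw [← ENNReal.rpow_mul]
        congr 1
        field_simp

theorem lintegral_enorm_gradDet_le [Nonempty ι] (hG : ∀ i, AEStronglyMeasurable (G i) μ) :
    ∫⁻ x, ‖gradDet e fun i => G i x‖ₑ ∂μ
      ≤ gradDetBound e * ∏ i, eLpNorm (G i) (Fintype.card ι) μ := by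
  simpa [eLpNorm_one_eq_lintegral_enorm] using eLpNorm_gradDet_le e hG one_pos

theorem integrable_gradDet [Nonempty ι] (hG : ∀ i, MemLp (G i) (Fintype.card ι) μ) :
    Integrable (fun x => gradDet e fun i => G i x) μ := by
  refine ⟨aestronglyMeasurable_gradDet e fun i => (hG i).1, ?_⟩
  refine (lintegral_enorm_gradDet_le e fun i => (hG i).1).trans_lt ?_
  refine ENNReal.mul_lt_top (by simp) ?_
  exact ENNReal.prod_lt_top fun i _ => (hG i).2

/-- If one row tends to `0` in `L^k` while the others stay bounded in `L^k`, the integral of the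
determinant tends to `0`. -/
theorem tendsto_integral_gradDet_zero [Nonempty ι]
    {G : ℕ → ι → α → EuclideanSpace ℝ (Fin m) →L[ℝ] ℝ}
    (hG : ∀ n i, AEStronglyMeasurable (G n i) μ) (a : ι) {M : ℝ≥0}
    (hM : ∀ n, ∀ i ≠ a, eLpNorm (G n i) (Fintype.card ι) μ ≤ M)
    (ha : Tendsto (fun n => eLpNorm (G n a) (Fintype.card ι) μ) atTop (𝓝 0)) :
    Tendsto (fun n => ∫ x, gradDet e (fun i => G n i x) ∂μ) atTop (𝓝 0) := by
  rw [tendsto_zero_iff_enorm_tendsto_zero]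
  set C : ℝ≥0∞ := gradDetBound e * ∏ i ∈ Finset.univ.erase a, (M : ℝ≥0∞)
  have hC : C ≠ ⊤ := ENNReal.mul_ne_top (by simp) (ENNReal.prod_ne_top fun _ _ => by simp)
  have h0 : Tendsto (fun n => C * eLpNorm (G n a) (Fintype.card ι) μ) atTop (𝓝 0) := by
    simpa using ENNReal.Tendsto.const_mul ha (Or.inr hC)
  refine tendsto_of_tendsto_of_tendsto_of_le_of_le tendsto_const_nhds h0
    (fun _ => zero_le) fun n => ?_
  refine (enorm_integral_le_lintegral_enorm _).trans
    ((lintegral_enorm_gradDet_le e (hG n)).trans ?_)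
  rw [← Finset.mul_prod_erase _ _ (Finset.mem_univ a), mul_assoc,
    mul_comm (eLpNorm (G n a) _ μ)]
  gcongr with i hi
  exact hM n i (Finset.ne_of_mem_erase hi)

/-! ### The determinant is a null Lagrangian -/

/-- The integral of the determinant of smooth gradients vanishes if one of the functions has compact
support: after integrating by parts in that row, the terms for `σ` and `σ ∘ (a l)` cancel by the
symmetry of second derivatives. -/
theorem integral_gradDet_fderiv_eq_zero (h : ι → EuclideanSpace ℝ (Fin m) → ℝ)
    (hh : ∀ i, ContDiff ℝ ∞ (h i)) (a : ι) (ha : HasCompactSupport (h a)) :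
    ∫ x, gradDet e (fun i => fderiv ℝ (h i) x) = 0 := by
  have hd : ∀ i (w : EuclideanSpace ℝ (Fin m)), ContDiff ℝ ∞ fun x => fderiv ℝ (h i) x w :=
    fun i w => ((hh i).fderiv_right (m := ∞) (by simp)).clm_apply contDiff_const
  set P : Equiv.Perm ι → EuclideanSpace ℝ (Fin m) → ℝ := fun σ x =>
    ∏ i ∈ Finset.univ.erase a, fderiv ℝ (h i) x (e (σ i)) with hP
  have hPd : ∀ σ, ContDiff ℝ ∞ (P σ) := fun σ => contDiff_prod fun i _ => hd i _
  have hac : ∀ w, HasCompactSupport fun x => fderiv ℝ (h a) x w :=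
    fun w => ha.fderiv_apply (𝕜 := ℝ) w
  have hPc : ∀ σ (w : EuclideanSpace ℝ (Fin m)), Continuous fun x => fderiv ℝ (P σ) x w :=
    fun σ w => ((hPd σ).continuous_fderiv (by simp)).clm_apply continuous_const
  have i1 : ∀ σ, Integrable fun x => fderiv ℝ (h a) x (e (σ a)) * P σ x := fun σ =>
    ((hd a _).continuous.mul (hPd σ).continuous).integrable_of_hasCompactSupport
      (hac _).mul_right
  have i2 : ∀ σ, Integrable fun x => h a x * fderiv ℝ (P σ) x (e (σ a)) := fun σ =>
    ((hh a).continuous.mul (hPc σ _)).integrable_of_hasCompactSupport ha.mul_right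
  have i3 : ∀ σ, Integrable fun x => h a x * P σ x := fun σ =>
    ((hh a).continuous.mul (hPd σ).continuous).integrable_of_hasCompactSupport ha.mul_right
  have ibp : ∀ σ : Equiv.Perm ι, ∫ x, fderiv ℝ (h a) x (e (σ a)) * P σ x
      = - ∫ x, h a x * fderiv ℝ (P σ) x (e (σ a)) := fun σ => by
    rw [integral_mul_fderiv_eq_neg_fderiv_mul_of_integrable (i1 σ) (i2 σ) (i3 σ)
      (fun x _ => (hh a).differentiable (by simp) x)
      (fun x _ => (hPd σ).differentiable (by simp) x), neg_neg]
  have hzero : ∀ x, ∑ σ : Equiv.Perm ι,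
      ((Equiv.Perm.sign σ : ℤ) : ℝ) * fderiv ℝ (P σ) x (e (σ a)) = 0 := by
    intro x
    have hder : ∀ σ : Equiv.Perm ι, fderiv ℝ (P σ) x (e (σ a))
        = ∑ l ∈ Finset.univ.erase a, (∏ i ∈ (Finset.univ.erase a).erase l,
          fderiv ℝ (h i) x (e (σ i))) * fderiv ℝ (fderiv ℝ (h l)) x (e (σ a)) (e (σ l)) := by
      intro σ
      have h1 : HasFDerivAt (P σ) _ x := HasFDerivAt.finsetProd (u := Finset.univ.erase a)
        (g := fun i x => fderiv ℝ (h i) x (e (σ i)))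
        fun i _ => ((hd i (e (σ i))).differentiable (by simp) x).hasFDerivAt
      rw [h1.fderiv]
      simp only [_root_.sum_apply, _root_.smul_apply, smul_eq_mul]
      refine Finset.sum_congr rfl fun l _ => ?_
      congr 1
      have h2 : DifferentiableAt ℝ (fderiv ℝ (h l)) x :=
        ((hh l).fderiv_right (m := ∞) (by simp)).differentiable (by simp) x
      rw [fderiv_clm_apply h2 (differentiableAt_const _)]
      simp
    simp_rw [hder, Finset.mul_sum]
    rw [Finset.sum_comm]
    refine Finset.sum_eq_zero fun l hl => ?_
    have hla : l ≠ a := Finset.ne_of_mem_erase hl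
    set T : Equiv.Perm ι → ℝ := fun σ => ((Equiv.Perm.sign σ : ℤ) : ℝ) *
      ((∏ i ∈ (Finset.univ.erase a).erase l, fderiv ℝ (h i) x (e (σ i))) *
        fderiv ℝ (fderiv ℝ (h l)) x (e (σ a)) (e (σ l))) with hT
    have hTs : ∀ σ, T (σ * Equiv.swap a l) = - T σ := by
      intro σ
      have hsymm := ((contDiff_infty.1 (hh l) 2).contDiffAt (x := x)).isSymmSndFDerivAt (by simp)
      have hprod : ∏ i ∈ (Finset.univ.erase a).erase l,
          fderiv ℝ (h i) x (e (σ (Equiv.swap a l i)))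
          = ∏ i ∈ (Finset.univ.erase a).erase l, fderiv ℝ (h i) x (e (σ i)) := by
        refine Finset.prod_congr rfl fun i hi => ?_
        rw [Finset.mem_erase, Finset.mem_erase] at hi
        rw [Equiv.swap_apply_of_ne_of_ne hi.2.1 hi.1]
      simp only [hT, Equiv.Perm.sign_mul, Equiv.Perm.sign_swap hla.symm,
        Equiv.Perm.mul_apply, hprod, Equiv.swap_apply_left, Equiv.swap_apply_right]
      rw [hsymm (e (σ l)) (e (σ a))]
      simp
    have h3 : ∑ σ, T σ = - ∑ σ, T σ := by
      conv_lhs => rw [← Equiv.sum_comp (Equiv.mulRight (Equiv.swap a l)) T]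
      simp only [Equiv.coe_mulRight, hTs, Finset.sum_neg_distrib]
    linarith
  calc ∫ x, gradDet e (fun i => fderiv ℝ (h i) x)
      = ∫ x, ∑ σ : Equiv.Perm ι,
          ((Equiv.Perm.sign σ : ℤ) : ℝ) * (fderiv ℝ (h a) x (e (σ a)) * P σ x) := by
        refine integral_congr_ae (Eventually.of_forall fun x => ?_)
        simp only [gradDet_eq_sum, hP]
        refine Finset.sum_congr rfl fun σ _ => ?_
        rw [Finset.mul_prod_erase _ (fun i => fderiv ℝ (h i) x (e (σ i))) (Finset.mem_univ a)]
    _ = ∑ σ : Equiv.Perm ι, ((Equiv.Perm.sign σ : ℤ) : ℝ) *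
          ∫ x, fderiv ℝ (h a) x (e (σ a)) * P σ x := by
        rw [integral_finsetSum _ fun σ _ => (i1 σ).const_mul _]
        simp_rw [integral_const_mul]
    _ = - ∫ x, h a x * ∑ σ : Equiv.Perm ι,
          ((Equiv.Perm.sign σ : ℤ) : ℝ) * fderiv ℝ (P σ) x (e (σ a)) := by
        simp_rw [ibp, Finset.mul_sum]
        rw [integral_finsetSum _ fun σ _ => ?_, ← Finset.sum_neg_distrib]
        · refine Finset.sum_congr rfl fun σ _ => ?_
          rw [mul_neg, ← integral_const_mul]
          congr 2
          ext x
          ring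
        · refine ((i2 σ).const_mul ((Equiv.Perm.sign σ : ℤ) : ℝ)).congr
            (Eventually.of_forall fun x => ?_)
          simp only
          ring
    _ = 0 := by simp [hzero]

end GradDet

theorem HasWeakFDerivOn.sub {m : ℕ} {W : Type*} [NormedAddCommGroup W] [NormedSpace ℝ W]
    {f₁ f₂ : EuclideanSpace ℝ (Fin m) → W}
    {g₁ g₂ : EuclideanSpace ℝ (Fin m) → EuclideanSpace ℝ (Fin m) →L[ℝ] W}
    {U : Set (EuclideanSpace ℝ (Fin m))} (h₁ : HasWeakFDerivOn f₁ g₁ U)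
    (h₂ : HasWeakFDerivOn f₂ g₂ U) :
    HasWeakFDerivOn (fun z => f₁ z - f₂ z) (fun z => g₁ z - g₂ z) U := by
  simpa [sub_eq_add_neg] using h₁.add (h₂.const_smul (-1))

theorem eval_update {ι X V : Type*} [DecidableEq ι] (g : ι → X → V) (b : ι) (Y : X → V) (x : X) :
    (fun i => Function.update g b Y i x) = Function.update (fun i => g i x) b (Y x) := by
  ext1 i
  by_cases hib : i = b
  · subst hib
    simp
  · simp [hib]

theorem memLp_update {ι X V : Type*} [DecidableEq ι] [MeasurableSpace X] [NormedAddCommGroup V]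
    {μ : Measure X} {r : ℝ≥0∞} {g : ι → X → V} (hg : ∀ i, MemLp (g i) r μ) (b : ι) {Y : X → V}
    (hY : MemLp Y r μ) (i : ι) : MemLp (Function.update g b Y i) r μ := by
  by_cases hib : i = b
  · subst hib
    simpa using hY
  · simpa [hib] using hg i

/-! ### Determinants of weak derivatives -/

section SobolevGradDet

variable {ι : Type} [Fintype ι] [DecidableEq ι] [Nonempty ι] {m : ℕ}
  (e : ι → EuclideanSpace ℝ (Fin m))

/-- The determinant is a null Lagrangian on Sobolev functions. The rows are replaced by their
mollifications one at a time, so that each limit is that of a continuous linear functional. -/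
theorem integral_gradDet_eq_zero {f : ι → EuclideanSpace ℝ (Fin m) → ℝ}
    {g : ι → EuclideanSpace ℝ (Fin m) → EuclideanSpace ℝ (Fin m) →L[ℝ] ℝ}
    (h : ∀ i, HasWeakFDerivOn (f i) (g i) univ) (hf : ∀ i, MemLp (f i) (Fintype.card ι))
    (hg : ∀ i, MemLp (g i) (Fintype.card ι)) (a : ι) (ha : HasCompactSupport (f a)) :
    ∫ x, gradDet e (fun i => g i x) = 0 := by
  have hr : (1 : ℝ≥0∞) ≤ (Fintype.card ι : ℕ) := by
    exact_mod_cast (Fintype.card_pos : 0 < Fintype.card ι)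
  have hr' : ((Fintype.card ι : ℕ) : ℝ≥0∞) ≠ ⊤ := by simp
  -- `s` is the set of rows that are not smooth yet
  suffices H : ∀ s : Finset ι, ∀ (f : ι → EuclideanSpace ℝ (Fin m) → ℝ)
      (g : ι → EuclideanSpace ℝ (Fin m) → EuclideanSpace ℝ (Fin m) →L[ℝ] ℝ),
      (∀ i ∈ s, HasWeakFDerivOn (f i) (g i) univ ∧ MemLp (f i) (Fintype.card ι)) →
      (∀ i ∉ s, ContDiff ℝ ∞ (f i) ∧ g i = fderiv ℝ (f i)) →
      (∀ i, MemLp (g i) (Fintype.card ι)) → HasCompactSupport (f a) →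
      ∫ x, gradDet e (fun i => g i x) = 0 from
    H Finset.univ f g (fun i _ => ⟨h i, hf i⟩) (by simp) hg ha
  intro s
  induction s using Finset.induction_on with
  | empty =>
    intro f g _ h2 _ ha
    have : ∀ x, (fun i => g i x) = fun i => fderiv ℝ (f i) x := fun x => by
      ext1 i
      rw [(h2 i (by simp)).2]
    simp_rw [this]
    exact integral_gradDet_fderiv_eq_zero e f (fun i => (h2 i (by simp)).1) a ha
  | insert b s hb ih =>
    intro f g h1 h2 hg ha
    obtain ⟨hwb, hfb⟩ := h1 b (Finset.mem_insert_self b s)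
    have hcd : ∀ n, ContDiff ℝ ∞ (mollify volume n (f b)) :=
      contDiff_mollify (hfb.locallyIntegrable hr)
    have hgn := memLp_mollify hr hr' (hg b)
    have hzero : ∀ n, ∫ x, gradDet e
        (fun i => Function.update g b (mollify volume n (g b)) i x) = 0 := by
      intro n
      refine ih (Function.update f b (mollify volume n (f b))) _ (fun i hi => ?_) (fun i hi => ?_)
        (fun i => ?_) ?_
      · have hib : i ≠ b := fun h => hb (h ▸ hi)
        simpa [hib] using h1 i (Finset.mem_insert_of_mem hi)
      · by_cases hib : i = b
        · subst hib
          simp only [Function.update_self]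
          exact ⟨hcd n, funext fun x => (hwb.fderiv_mollify n x).symm⟩
        · simpa [hib] using h2 i (by simp [hib, hi])
      · by_cases hib : i = b
        · subst hib
          simpa using hgn n
        · simpa [hib] using hg i
      · by_cases hab : a = b
        · subst hab
          simp only [Function.update_self]
          exact (mollifier _ n).hasCompactSupport_normed.convolution _ ha
        · simpa [hab] using ha
    have hmem : ∀ X, MemLp X (Fintype.card ι) → ∀ i,
        MemLp (Function.update g b X i) (Fintype.card ι) := fun X hX => memLp_update hg b hX
    have hlim : Tendsto (fun n => ∫ x, gradDet e (fun i =>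
        Function.update g b (fun x => mollify volume n (g b) x - g b x) i x)) atTop (𝓝 0) := by
      refine tendsto_integral_gradDet_zero e
        (fun n i => (hmem _ ((hgn n).sub (hg b)) i).1) b
        (M := ∑ i, (eLpNorm (g i) (Fintype.card ι) volume).toNNReal) (fun n i hib => ?_) ?_
      · rw [Function.update_of_ne hib]
        have h5 : (eLpNorm (g i) (Fintype.card ι) volume).toNNReal ≤
            ∑ i, (eLpNorm (g i) (Fintype.card ι) volume).toNNReal :=
          Finset.single_le_sum (f := fun i => (eLpNorm (g i) (Fintype.card ι) volume).toNNReal)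
            (fun _ _ => zero_le) (Finset.mem_univ i)
        rw [← ENNReal.coe_toNNReal (hg i).2.ne]
        exact_mod_cast h5
      · simpa using tendsto_eLpNorm_mollify_sub hr hr' (hg b)
    have hconst : ∀ n, ∫ x, gradDet e (fun i =>
        Function.update g b (fun x => mollify volume n (g b) x - g b x) i x)
          = - ∫ x, gradDet e (fun i => g i x) := by
      intro n
      have e1 : ∀ x, gradDet e (fun i =>
          Function.update g b (fun x => mollify volume n (g b) x - g b x) i x)
          = gradDet e (fun i => Function.update g b (mollify volume n (g b)) i x)
            - gradDet e (fun i => g i x) := by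
        intro x
        rw [eval_update, eval_update, gradDet_update_sub]
        congr 2
        exact Function.update_eq_self b fun i => g i x
      simp_rw [e1]
      rw [integral_sub (integrable_gradDet e (hmem _ (hgn n))) (integrable_gradDet e hg), hzero n,
        zero_sub]
    simp_rw [hconst] at hlim
    have := tendsto_nhds_unique hlim tendsto_const_nhds
    linarith

/-- Weak continuity of the determinant on bounded sequences of Sobolev functions, tested against
smooth functions `φ`. The rows are exchanged one at a time: by the null Lagrangian property, the
difference that arises contains the undifferentiated function `f n a - f₀ a`, which tends to `0`
strongly by Rellich's theorem. -/
theorem tendsto_integral_mul_gradDet {f : ℕ → ι → EuclideanSpace ℝ (Fin m) → ℝ}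
    {g : ℕ → ι → EuclideanSpace ℝ (Fin m) → EuclideanSpace ℝ (Fin m) →L[ℝ] ℝ}
    {f₀ : ι → EuclideanSpace ℝ (Fin m) → ℝ}
    {g₀ : ι → EuclideanSpace ℝ (Fin m) → EuclideanSpace ℝ (Fin m) →L[ℝ] ℝ}
    (h : ∀ n i, HasWeakFDerivOn (f n i) (g n i) univ) (h₀ : ∀ i, HasWeakFDerivOn (f₀ i) (g₀ i) univ)
    (hf : ∀ n i, MemLp (f n i) (Fintype.card ι)) (hf₀ : ∀ i, MemLp (f₀ i) (Fintype.card ι))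
    (hg : ∀ n i, MemLp (g n i) (Fintype.card ι)) (hg₀ : ∀ i, MemLp (g₀ i) (Fintype.card ι))
    {M : ℝ≥0} (hM : ∀ n i, eLpNorm (g n i) (Fintype.card ι) volume ≤ M)
    (hM₀ : ∀ i, eLpNorm (g₀ i) (Fintype.card ι) volume ≤ M)
    (hM1 : ∀ n i, eLpNorm (f n i) 1 volume ≤ M) (hM1₀ : ∀ i, eLpNorm (f₀ i) 1 volume ≤ M)
    (hw : ∀ i, ∀ ψ : EuclideanSpace ℝ (Fin m) → ℝ, Continuous ψ → HasCompactSupport ψ →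
      Tendsto (fun n => ∫ z, ψ z * f n i z) atTop (𝓝 (∫ z, ψ z * f₀ i z)))
    {φ : EuclideanSpace ℝ (Fin m) → ℝ} (hφ : ContDiff ℝ ∞ φ) (hφc : HasCompactSupport φ) :
    Tendsto (fun n => ∫ x, φ x * gradDet e (fun i => g n i x)) atTop
      (𝓝 (∫ x, φ x * gradDet e (fun i => g₀ i x))) := by
  have hr : (1 : ℝ≥0∞) ≤ (Fintype.card ι : ℕ) := by
    exact_mod_cast (Fintype.card_pos : 0 < Fintype.card ι)
  have hr' : ((Fintype.card ι : ℕ) : ℝ≥0∞) ≠ ⊤ := by simp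
  obtain ⟨B, hB⟩ := hφ.continuous.bounded_above_of_compact_support hφc
  have hφ' : Continuous (fderiv ℝ φ) := hφ.continuous_fderiv (by simp)
  obtain ⟨B', hB'⟩ := hφ'.bounded_above_of_compact_support (hφc.fderiv (𝕜 := ℝ))
  suffices H : ∀ s : Finset ι, Tendsto (fun n => ∫ x, φ x *
      gradDet e (fun i => (if i ∈ s then g n i else g₀ i) x)) atTop
      (𝓝 (∫ x, φ x * gradDet e (fun i => g₀ i x))) by
    simpa using H Finset.univ
  intro s
  induction s using Finset.induction_on with
  | empty => simp
  | insert a s ha ih =>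
    set G : ℕ → ι → EuclideanSpace ℝ (Fin m) → EuclideanSpace ℝ (Fin m) →L[ℝ] ℝ :=
      fun n i => if i ∈ s then g n i else g₀ i with hGdef
    have hGmem : ∀ n i, MemLp (G n i) (Fintype.card ι) := by
      intro n i
      simp only [hGdef]
      split_ifs
      exacts [hg n i, hg₀ i]
    have hGM : ∀ n i, eLpNorm (G n i) (Fintype.card ι) volume ≤ M := by
      intro n i
      simp only [hGdef]
      split_ifs
      exacts [hM n i, hM₀ i]
    have hGw : ∀ n i, ∃ F, HasWeakFDerivOn F (G n i) univ ∧ MemLp F (Fintype.card ι) := by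
      intro n i
      simp only [hGdef]
      split_ifs
      exacts [⟨_, h n i, hf n i⟩, ⟨_, h₀ i, hf₀ i⟩]
    choose F hFw hFm using hGw
    set d : ℕ → EuclideanSpace ℝ (Fin m) → ℝ := fun n z => f n a z - f₀ a z with hd
    set δ : ℕ → EuclideanSpace ℝ (Fin m) → EuclideanSpace ℝ (Fin m) →L[ℝ] ℝ :=
      fun n z => g n a z - g₀ a z with hδ
    have hdδ : ∀ n, HasWeakFDerivOn (d n) (δ n) univ := fun n => (h n a).sub (h₀ a)
    have hdm : ∀ n, MemLp (d n) (Fintype.card ι) := fun n => (hf n a).sub (hf₀ a)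
    have hδm : ∀ n, MemLp (δ n) (Fintype.card ι) := fun n => (hg n a).sub (hg₀ a)
    -- strong convergence of the undifferentiated functions
    have hd0 : Tendsto (fun n => eLpNorm (d n) (Fintype.card ι) (volume.restrict (tsupport φ)))
        atTop (𝓝 0) := by
      refine tendsto_eLpNorm_restrict_of_weakly_null hr hr' hdδ hdm hδm (M := M + M)
        (fun n => ?_) (fun n => ?_) (fun ψ hψ hψc => ?_) hφc.measure_lt_top.ne
      · refine (eLpNorm_sub_le (hg n a).1 (hg₀ a).1 hr).trans ?_
        push_cast
        exact add_le_add (hM n a) (hM₀ a)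
      · refine (eLpNorm_sub_le (hf n a).1 (hf₀ a).1 le_rfl).trans ?_
        push_cast
        exact add_le_add (hM1 n a) (hM1₀ a)
      · have hint : ∀ F : EuclideanSpace ℝ (Fin m) → ℝ, MemLp F (Fintype.card ι) →
            Integrable fun z => ψ z * F z := fun F hF =>
          (hF.locallyIntegrable hr).integrable_smul_left_of_hasCompactSupport hψ hψc
        have h3 := (hw a ψ hψ hψc).sub_const (∫ z, ψ z * f₀ a z)
        rw [sub_self] at h3
        refine h3.congr fun n => ?_
        rw [← integral_sub (hint _ (hf n a)) (hint _ (hf₀ a))]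
        simp only [hd, mul_sub]
    set X : ℕ → EuclideanSpace ℝ (Fin m) → EuclideanSpace ℝ (Fin m) →L[ℝ] ℝ :=
      fun n z => d n z • fderiv ℝ φ z with hX
    have hXmeas : ∀ n, AEStronglyMeasurable (X n) := fun n =>
      (hdm n).1.smul hφ'.aestronglyMeasurable
    have hXle : ∀ n z, ‖X n z‖ ≤ B' * ‖d n z‖ := fun n z => by
      simp only [hX, norm_smul]
      rw [mul_comm]
      gcongr
      exact hB' z
    have hXm : ∀ n, MemLp (X n) (Fintype.card ι) := fun n =>
      (hdm n).of_le_mul (hXmeas n) (Eventually.of_forall (hXle n))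
    have hX0 : Tendsto (fun n => eLpNorm (X n) (Fintype.card ι) volume) atTop (𝓝 0) := by
      have h4 : Tendsto (fun n => ENNReal.ofReal B' *
          eLpNorm (d n) (Fintype.card ι) (volume.restrict (tsupport φ))) atTop (𝓝 0) := by
        simpa using ENNReal.Tendsto.const_mul hd0 (Or.inr ENNReal.ofReal_ne_top)
      refine tendsto_of_tendsto_of_tendsto_of_le_of_le tendsto_const_nhds h4
        (fun _ => zero_le) fun n => ?_
      have hsupp : Function.support (X n) ⊆ tsupport φ := fun z hz => by
        by_contra hzs
        exact hz (by
          simp [hX, image_eq_zero_of_notMem_tsupport fun h => hzs (tsupport_fderiv_subset ℝ h)])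
      simp only
      rw [← eLpNorm_restrict_eq_of_support_subset (f := X n) hsupp]
      exact eLpNorm_le_mul_eLpNorm_of_ae_le_mul (Eventually.of_forall (hXle n)) _
    have hφδm : ∀ n, MemLp (fun z => φ z • δ n z) (Fintype.card ι) := fun n =>
      (hδm n).of_le_mul (c := B) (hφ.continuous.aestronglyMeasurable.smul (hδm n).1)
        (Eventually.of_forall fun z => by
          rw [norm_smul]
          gcongr
          exact hB z)
    have hlim : Tendsto (fun n => ∫ x, gradDet e fun i => Function.update (G n) a (X n) i x)
        atTop (𝓝 0) := by
      refine tendsto_integral_gradDet_zero e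
        (fun n i => (memLp_update (hGmem n) a (hXm n) i).1) a (M := M) (fun n i hia => ?_) ?_
      · rw [Function.update_of_ne hia]
        exact hGM n i
      · simpa using hX0
    -- the null Lagrangian property for the row `D(φ d) = φ δ + d Dφ`
    have hnull : ∀ n, (∫ x, gradDet e fun i => Function.update (G n) a (fun z => φ z • δ n z) i x)
        = - ∫ x, gradDet e fun i => Function.update (G n) a (X n) i x := by
      intro n
      have hsum : MemLp (fun z => φ z • δ n z + X n z) (Fintype.card ι) :=
        MemLp.add (f := fun z => φ z • δ n z) (g := X n) (hφδm n) (hXm n)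
      have h5 := integral_gradDet_eq_zero e
        (f := Function.update (F n) a fun z => φ z * d n z)
        (g := Function.update (G n) a fun z => φ z • δ n z + X n z) (fun i => ?_) (fun i => ?_)
        (memLp_update (hGmem n) a hsum) a ?_
      · rw [eq_neg_iff_add_eq_zero, ← h5,
          ← integral_add (integrable_gradDet e (memLp_update (hGmem n) a (hφδm n)))
            (integrable_gradDet e (memLp_update (hGmem n) a (hXm n)))]
        refine integral_congr_ae (Eventually.of_forall fun x => ?_)
        simp only [eval_update, gradDet_update_add]
      · by_cases hia : i = a
        · subst hia
          simp only [Function.update_self]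
          exact (hdδ n).cutoff hφ hφc (subset_univ _)
        · simpa [hia] using hFw n i
      · refine memLp_update (hFm n) a ?_ i
        exact (hdm n).of_le_mul (c := B) (hφ.continuous.aestronglyMeasurable.mul (hdm n).1)
          (Eventually.of_forall fun z => by
            rw [norm_mul]
            gcongr
            exact hB z)
      · simp only [Function.update_self]
        exact hφc.mul_right
    have hintG : ∀ {L : ι → EuclideanSpace ℝ (Fin m) → EuclideanSpace ℝ (Fin m) →L[ℝ] ℝ},
        (∀ i, MemLp (L i) (Fintype.card ι)) →
        Integrable fun x => φ x * gradDet e fun i => L i x := fun hL =>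
      (integrable_gradDet e hL).bdd_mul hφ.continuous.aestronglyMeasurable
        (Eventually.of_forall hB)
    have hstep : ∀ n, ∫ x, φ x * gradDet e
          (fun i => (if i ∈ insert a s then g n i else g₀ i) x)
        = (∫ x, φ x * gradDet e fun i => G n i x)
          - ∫ x, gradDet e fun i => Function.update (G n) a (X n) i x := by
      intro n
      have e1 : (fun i => if i ∈ insert a s then g n i else g₀ i)
          = Function.update (G n) a (g n a) := by
        ext1 i
        by_cases hia : i = a
        · subst hia
          simp
        · simp [hia, hGdef]
      have e2 : ∀ x, (fun i => (if i ∈ insert a s then g n i else g₀ i) x)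
          = fun i => Function.update (G n) a (g n a) i x := fun x => by
        rw [← e1]
      have e3 : G n a = g₀ a := by simp [hGdef, ha]
      simp only [e2]
      rw [sub_eq_add_neg, ← hnull n, ← integral_add (hintG (hGmem n))
        (integrable_gradDet e (memLp_update (hGmem n) a (hφδm n)))]
      refine integral_congr_ae (Eventually.of_forall fun x => ?_)
      simp only [eval_update, gradDet_update_smul, hδ, gradDet_update_sub]
      have e4 : Function.update (fun i => G n i x) a (g₀ a x) = fun i => G n i x := by
        rw [← e3]
        exact Function.update_eq_self a fun i => G n i x
      rw [e4]
      ring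
    simp_rw [hstep]
    simpa using ih.sub hlim

end SobolevGradDet

/-! ### Weak continuity of the determinant on an open set -/

/-- On a finite measure space, the `L^t` norm is bounded by a multiple of the `L^r` norm if
`t ≤ r`. -/
theorem exists_eLpNorm_le_mul_eLpNorm {α : Type*} [MeasurableSpace α] (μ : Measure α)
    [IsFiniteMeasure μ] {t r : ℝ≥0∞} (ht : 1 ≤ t) (htr : t ≤ r) :
    ∃ C : ℝ≥0, ∀ (V : Type) [NormedAddCommGroup V] (F : α → V), AEStronglyMeasurable F μ →
      eLpNorm F t μ ≤ C * eLpNorm F r μ := by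
  have hne : μ univ ^ (1 / t.toReal - 1 / r.toReal) ≠ ⊤ := by
    refine ENNReal.rpow_ne_top_of_nonneg ?_ (measure_ne_top _ _)
    by_cases hrt : r = ⊤
    · simp [hrt]
    · rw [sub_nonneg]
      have ht0 : 0 < t.toReal := ENNReal.toReal_pos (one_pos.trans_le ht).ne'
        (ne_top_of_le_ne_top hrt htr)
      exact one_div_le_one_div_of_le ht0 (ENNReal.toReal_mono hrt htr)
  refine ⟨(μ univ ^ (1 / t.toReal - 1 / r.toReal)).toNNReal, fun V _ F hF => ?_⟩
  rw [ENNReal.coe_toNNReal hne, mul_comm]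
  exact eLpNorm_le_eLpNorm_mul_rpow_measure_univ htr hF

section Local

variable {m : ℕ} {U : Set (EuclideanSpace ℝ (Fin m))}

theorem exists_contDiff_cutoff {K : Set (EuclideanSpace ℝ (Fin m))} (hK : IsCompact K)
    (hU : IsOpen U) (hKU : K ⊆ U) :
    ∃ χ : EuclideanSpace ℝ (Fin m) → ℝ, ContDiff ℝ ∞ χ ∧ HasCompactSupport χ ∧ tsupport χ ⊆ U ∧
      ∀ᶠ x in 𝓝ˢ K, χ x = 1 := by
  obtain ⟨L, hL, hKL, hLU⟩ := exists_compact_between hK hU hKU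
  obtain ⟨χ, h1, h0, -⟩ := exists_contMDiffMap_one_nhds_of_subset_interior (n := ⊤)
    (modelWithCornersSelf ℝ (EuclideanSpace ℝ (Fin m))) hK.isClosed hKL
  have hsupp : tsupport χ ⊆ L := by
    refine closure_minimal (fun x hx => ?_) hL.isClosed
    by_contra hxL
    exact hx (h0 x hxL)
  exact ⟨χ, χ.contMDiff.contDiff, HasCompactSupport.of_support_subset_isCompact hL
    (subset_closure.trans hsupp), hsupp.trans hLU, h1⟩

/-- Smooth functions with compact support in `U` are dense in `L^r(U)`. -/
theorem exists_contDiff_eLpNorm_sub_le (hU : IsOpen U) (hUfin : volume U ≠ ⊤) {r : ℝ≥0∞}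
    (hr : 1 ≤ r) (hr' : r ≠ ⊤) {ψ : EuclideanSpace ℝ (Fin m) → ℝ}
    (hψ : MemLp ψ r (volume.restrict U)) {ε : ℝ} (hε : 0 < ε) :
    ∃ φ : EuclideanSpace ℝ (Fin m) → ℝ, ContDiff ℝ ∞ φ ∧ HasCompactSupport φ ∧ tsupport φ ⊆ U ∧
      eLpNorm (fun x => ψ x - φ x) r (volume.restrict U) ≤ ENNReal.ofReal ε := by
  obtain ⟨δ, hδ, hind⟩ := hψ.eLpNorm_indicator_le hr hr' (half_pos hε)
  obtain ⟨K, hKU, hK, hKδ⟩ := hU.measurableSet.exists_isCompact_sdiff_lt hUfin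
    (ENNReal.ofReal_pos.2 hδ).ne'
  have hKm : MeasurableSet K := hK.isClosed.measurableSet
  set F : EuclideanSpace ℝ (Fin m) → ℝ := K.indicator ψ with hF
  have hFm : MemLp F r volume := by
    rw [hF, memLp_indicator_iff_restrict hKm]
    exact hψ.mono_measure (Measure.restrict_mono hKU le_rfl)
  obtain ⟨η, hη, hηU⟩ := hK.exists_cthickening_subset_open hU hKU
  have hlim := ENNReal.tendsto_nhds_zero.1 (tendsto_eLpNorm_mollify_sub hr hr' hFm)
    (ENNReal.ofReal (ε / 2)) (ENNReal.ofReal_pos.2 (half_pos hε))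
  obtain ⟨n, hn, hnη⟩ := (hlim.and
    ((mollifier_rOut_tendsto (E := EuclideanSpace ℝ (Fin m))).eventually (gt_mem_nhds hη))).exists
  have hsupp : tsupport (mollify volume n F) ⊆ Metric.cthickening η K := by
    refine closure_minimal (fun x hx => ?_) Metric.isClosed_cthickening
    by_contra hxη
    refine hx ?_
    rw [mollify_apply]
    refine integral_eq_zero_of_ae (Eventually.of_forall fun t => ?_)
    simp only [Pi.zero_apply, smul_eq_mul, mul_eq_zero]
    by_contra! hne
    have h1 : t ∈ Function.support ((mollifier (EuclideanSpace ℝ (Fin m)) n).normed volume) := hne.1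
    rw [ContDiffBump.support_normed_eq, mem_ball_zero_iff] at h1
    have h2 : x - t ∈ K := by
      by_contra h2
      exact hne.2 (by simp [hF, h2])
    refine hxη (Metric.mem_cthickening_of_dist_le x (x - t) η K h2 ?_)
    simpa using (h1.trans hnη).le
  refine ⟨mollify volume n F, contDiff_mollify (hFm.locallyIntegrable hr) n,
    HasCompactSupport.of_support_subset_isCompact hK.cthickening (subset_closure.trans hsupp),
    hsupp.trans hηU, ?_⟩
  have e1 : (fun x => ψ x - mollify volume n F x)
      = Kᶜ.indicator ψ - fun x => mollify volume n F x - F x := by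
    ext x
    by_cases hx : x ∈ K <;> simp [hF, hx]
  rw [e1]
  have hmF : AEStronglyMeasurable (fun x => mollify volume n F x - F x) (volume.restrict U) :=
    ((memLp_mollify hr hr' hFm n).1.sub hFm.1).restrict
  refine (eLpNorm_sub_le (hψ.1.indicator hKm.compl) hmF hr).trans ?_
  rw [← add_halves ε, ENNReal.ofReal_add (half_pos hε).le (half_pos hε).le]
  refine add_le_add (hind _ hKm.compl ?_) ((eLpNorm_restrict_le _ _ _ _).trans hn)
  rw [Measure.restrict_apply hKm.compl, inter_comm]
  exact hKδ.le

theorem eLpNorm_le_of_forall_notMem_eq_zero {V V' : Type*} [NormedAddCommGroup V]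
    [NormedAddCommGroup V'] {r : ℝ≥0∞}
    {F : EuclideanSpace ℝ (Fin m) → V} {h : EuclideanSpace ℝ (Fin m) → V'}
    (hF0 : ∀ z ∉ U, F z = 0) {B : ℝ} (hB : ∀ z, ‖F z‖ ≤ B * ‖h z‖) :
    eLpNorm F r volume ≤ ENNReal.ofReal B * eLpNorm h r (volume.restrict U) := by
  have hsupp : Function.support F ⊆ U := fun z hz => by
    by_contra hzU
    exact hz (hF0 z hzU)
  rw [← eLpNorm_restrict_eq_of_support_subset (f := F) hsupp]
  exact eLpNorm_le_mul_eLpNorm_of_ae_le_mul (Eventually.of_forall hB) _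

theorem memLp_of_forall_notMem_eq_zero {V V' : Type*} [NormedAddCommGroup V]
    [NormedAddCommGroup V'] (hU : MeasurableSet U) {r : ℝ≥0∞}
    {F : EuclideanSpace ℝ (Fin m) → V} {h : EuclideanSpace ℝ (Fin m) → V'}
    (hF : AEStronglyMeasurable F (volume.restrict U)) (hF0 : ∀ z ∉ U, F z = 0)
    (hh : MemLp h r (volume.restrict U)) {B : ℝ} (hB : ∀ z, ‖F z‖ ≤ B * ‖h z‖) :
    MemLp F r volume := by
  have e1 : U.indicator F = F := indicator_eq_self.2 fun z hz => by
    by_contra hzU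
    exact hz (hF0 z hzU)
  rw [← e1, memLp_indicator_iff_restrict hU]
  exact hh.of_le_mul hF (Eventually.of_forall hB)

variable {ι : Type} [Fintype ι] [DecidableEq ι] [Nonempty ι]
  (e : ι → EuclideanSpace ℝ (Fin m))

/-- Weak continuity of the determinant on an open set, tested against smooth functions `φ` with
compact support. This is reduced to functions on the whole space by a cutoff function that is `1`
near the support of `φ`. -/
theorem tendsto_setIntegral_mul_gradDet_of_contDiff (hU : IsOpen U) (hUfin : volume U ≠ ⊤)
    {f : ℕ → ι → EuclideanSpace ℝ (Fin m) → ℝ}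
    {g : ℕ → ι → EuclideanSpace ℝ (Fin m) → EuclideanSpace ℝ (Fin m) →L[ℝ] ℝ}
    {f₀ : ι → EuclideanSpace ℝ (Fin m) → ℝ}
    {g₀ : ι → EuclideanSpace ℝ (Fin m) → EuclideanSpace ℝ (Fin m) →L[ℝ] ℝ}
    (h : ∀ n i, HasWeakFDerivOn (f n i) (g n i) U) (h₀ : ∀ i, HasWeakFDerivOn (f₀ i) (g₀ i) U)
    {r : ℝ≥0∞} (hrι : (Fintype.card ι : ℝ≥0∞) ≤ r)
    (hf : ∀ n i, MemLp (f n i) r (volume.restrict U))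
    (hf₀ : ∀ i, MemLp (f₀ i) r (volume.restrict U))
    (hg : ∀ n i, MemLp (g n i) r (volume.restrict U))
    (hg₀ : ∀ i, MemLp (g₀ i) r (volume.restrict U))
    {M : ℝ≥0} (hfM : ∀ n i, eLpNorm (f n i) r (volume.restrict U) ≤ M)
    (hgM : ∀ n i, eLpNorm (g n i) r (volume.restrict U) ≤ M)
    (hw : ∀ i, ∀ ψ : EuclideanSpace ℝ (Fin m) → ℝ, Continuous ψ → HasCompactSupport ψ →
      Tendsto (fun n => ∫ z in U, ψ z * f n i z) atTop (𝓝 (∫ z in U, ψ z * f₀ i z)))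
    {φ : EuclideanSpace ℝ (Fin m) → ℝ} (hφ : ContDiff ℝ ∞ φ) (hφc : HasCompactSupport φ)
    (hφU : tsupport φ ⊆ U) :
    Tendsto (fun n => ∫ x in U, φ x * gradDet e (fun i => g n i x)) atTop
      (𝓝 (∫ x in U, φ x * gradDet e (fun i => g₀ i x))) := by
  have hcard : (1 : ℝ≥0∞) ≤ (Fintype.card ι : ℕ) := by
    exact_mod_cast (Fintype.card_pos : 0 < Fintype.card ι)
  have hfinU : IsFiniteMeasure (volume.restrict U) := ⟨by simpa using hUfin.lt_top⟩
  obtain ⟨χ, hχ, hχc, hχU, hχ1⟩ := exists_contDiff_cutoff hφc hU hφU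
  have hχ' : Continuous (fderiv ℝ χ) := hχ.continuous_fderiv (by simp)
  obtain ⟨B, hB⟩ := hχ.continuous.bounded_above_of_compact_support hχc
  obtain ⟨B', hB'⟩ := hχ'.bounded_above_of_compact_support (hχc.fderiv (𝕜 := ℝ))
  have hz : ∀ z ∉ U, χ z = 0 := fun z hz => image_eq_zero_of_notMem_tsupport fun h => hz (hχU h)
  have hz' : ∀ z ∉ U, fderiv ℝ χ z = 0 := fun z hz =>
    image_eq_zero_of_notMem_tsupport fun h => hz (hχU (tsupport_fderiv_subset ℝ h))
  obtain ⟨C, hC⟩ : ∃ C : ℝ≥0, ∀ (V : Type) [NormedAddCommGroup V]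
      (F : EuclideanSpace ℝ (Fin m) → V), AEStronglyMeasurable F (volume.restrict U) →
      eLpNorm F 1 (volume.restrict U) ≤ C * eLpNorm F r (volume.restrict U) ∧
      eLpNorm F (Fintype.card ι) (volume.restrict U) ≤ C * eLpNorm F r (volume.restrict U) := by
    obtain ⟨C1, hC1⟩ := exists_eLpNorm_le_mul_eLpNorm (volume.restrict U) le_rfl (hcard.trans hrι)
    obtain ⟨C2, hC2⟩ := exists_eLpNorm_le_mul_eLpNorm (volume.restrict U) hcard hrι
    refine ⟨max C1 C2, fun V _ F hF => ⟨(hC1 V F hF).trans ?_, (hC2 V F hF).trans ?_⟩⟩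
    · gcongr
      exact le_max_left _ _
    · gcongr
      exact le_max_right _ _
  set cf : (EuclideanSpace ℝ (Fin m) → ℝ) → EuclideanSpace ℝ (Fin m) → ℝ :=
    fun F z => χ z * F z with hcf
  set cg : (EuclideanSpace ℝ (Fin m) → ℝ) →
      (EuclideanSpace ℝ (Fin m) → EuclideanSpace ℝ (Fin m) →L[ℝ] ℝ) →
      EuclideanSpace ℝ (Fin m) → EuclideanSpace ℝ (Fin m) →L[ℝ] ℝ :=
    fun F G z => χ z • G z + F z • fderiv ℝ χ z with hcg
  have cf0 : ∀ F z, z ∉ U → cf F z = 0 := fun F z hzU => by simp [hcf, hz z hzU]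
  have cfB : ∀ F z, ‖cf F z‖ ≤ B * ‖F z‖ := fun F z => by
    simp only [hcf, norm_mul]
    gcongr
    exact hB z
  have cfm : ∀ F, MemLp F r (volume.restrict U) → AEStronglyMeasurable (cf F) (volume.restrict U) :=
    fun F hF => hχ.continuous.aestronglyMeasurable.mul hF.1
  have hcfm : ∀ F, MemLp F r (volume.restrict U) → MemLp (cf F) (Fintype.card ι) volume :=
    fun F hF => memLp_of_forall_notMem_eq_zero hU.measurableSet (cfm F hF) (cf0 F)
      (hF.mono_exponent hrι) (cfB F)
  have g1B : ∀ (G : EuclideanSpace ℝ (Fin m) → EuclideanSpace ℝ (Fin m) →L[ℝ] ℝ) z,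
      ‖χ z • G z‖ ≤ B * ‖G z‖ := fun G z => by
    rw [norm_smul]
    gcongr
    exact hB z
  have g2B : ∀ (F : EuclideanSpace ℝ (Fin m) → ℝ) z,
      ‖F z • fderiv ℝ χ z‖ ≤ B' * ‖F z‖ := fun F z => by
    rw [norm_smul, mul_comm]
    gcongr
    exact hB' z
  have hg1m : ∀ G, MemLp G r (volume.restrict U) →
      MemLp (fun z => χ z • G z) (Fintype.card ι) volume := fun G hG =>
    memLp_of_forall_notMem_eq_zero hU.measurableSet
      (hχ.continuous.aestronglyMeasurable.smul hG.1) (fun z hzU => by simp [hz z hzU])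
      (hG.mono_exponent hrι) (g1B G)
  have hg2m : ∀ F, MemLp F r (volume.restrict U) →
      MemLp (fun z => F z • fderiv ℝ χ z) (Fintype.card ι) volume := fun F hF =>
    memLp_of_forall_notMem_eq_zero hU.measurableSet
      (hF.1.smul hχ'.aestronglyMeasurable) (fun z hzU => by simp [hz' z hzU])
      (hF.mono_exponent hrι) (g2B F)
  have hcgm : ∀ F G, MemLp F r (volume.restrict U) → MemLp G r (volume.restrict U) →
      MemLp (cg F G) (Fintype.card ι) volume := fun F G hF hG =>
    MemLp.add (f := fun z => χ z • G z) (g := fun z => F z • fderiv ℝ χ z) (hg1m G hG) (hg2m F hF)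
  have bf : ∀ F, MemLp F r (volume.restrict U) → eLpNorm (cf F) 1 volume
      ≤ ENNReal.ofReal B * (C * eLpNorm F r (volume.restrict U)) := fun F hF =>
    (eLpNorm_le_of_forall_notMem_eq_zero (cf0 F) (cfB F)).trans
      (mul_le_mul_right (hC ℝ F hF.1).1 _)
  have bg : ∀ F G, MemLp F r (volume.restrict U) → MemLp G r (volume.restrict U) →
      eLpNorm (cg F G) (Fintype.card ι) volume
        ≤ ENNReal.ofReal B * (C * eLpNorm G r (volume.restrict U))
          + ENNReal.ofReal B' * (C * eLpNorm F r (volume.restrict U)) := by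
    intro F G hF hG
    refine (eLpNorm_add_le (f := fun z => χ z • G z) (g := fun z => F z • fderiv ℝ χ z)
      (hg1m G hG).1 (hg2m F hF).1 hcard).trans (add_le_add ?_ ?_)
    · exact (eLpNorm_le_of_forall_notMem_eq_zero
        (fun z hzU => by simp [hz z hzU]) (g1B G)).trans (mul_le_mul_right (hC _ G hG.1).2 _)
    · exact (eLpNorm_le_of_forall_notMem_eq_zero
        (fun z hzU => by simp [hz' z hzU]) (g2B F)).trans (mul_le_mul_right (hC _ F hF.1).2 _)
  -- a common bound, including the limit functions
  set M₀ : ℝ≥0 := M + (∑ i, (eLpNorm (f₀ i) r (volume.restrict U)).toNNReal)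
    + ∑ i, (eLpNorm (g₀ i) r (volume.restrict U)).toNNReal with hM₀
  have bf₀ : ∀ i, eLpNorm (f₀ i) r (volume.restrict U) ≤ M₀ := by
    intro i
    rw [← ENNReal.coe_toNNReal (hf₀ i).2.ne]
    have := Finset.single_le_sum
      (f := fun i => (eLpNorm (f₀ i) r (volume.restrict U)).toNNReal)
      (fun _ _ => zero_le) (Finset.mem_univ i)
    refine ENNReal.coe_le_coe.2 (this.trans ?_)
    rw [hM₀, add_comm M, add_assoc]
    exact le_self_add
  have bg₀ : ∀ i, eLpNorm (g₀ i) r (volume.restrict U) ≤ M₀ := by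
    intro i
    rw [← ENNReal.coe_toNNReal (hg₀ i).2.ne]
    have := Finset.single_le_sum
      (f := fun i => (eLpNorm (g₀ i) r (volume.restrict U)).toNNReal)
      (fun _ _ => zero_le) (Finset.mem_univ i)
    exact ENNReal.coe_le_coe.2 (this.trans le_add_self)
  have hMM₀ : (M : ℝ≥0∞) ≤ M₀ := by
    refine ENNReal.coe_le_coe.2 ?_
    rw [hM₀, add_assoc]
    exact le_self_add
  set M₁ : ℝ≥0 := B.toNNReal * (C * M₀) + B'.toNNReal * (C * M₀) with hM₁
  have bf' : ∀ F, MemLp F r (volume.restrict U) → eLpNorm F r (volume.restrict U) ≤ M₀ →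
      eLpNorm (cf F) 1 volume ≤ M₁ := by
    intro F hF hFM
    refine (bf F hF).trans ?_
    rw [hM₁]
    push_cast
    refine le_trans ?_ le_self_add
    rw [ENNReal.ofReal]
    gcongr
  have bg' : ∀ F G, MemLp F r (volume.restrict U) → MemLp G r (volume.restrict U) →
      eLpNorm F r (volume.restrict U) ≤ M₀ → eLpNorm G r (volume.restrict U) ≤ M₀ →
      eLpNorm (cg F G) (Fintype.card ι) volume ≤ M₁ := by
    intro F G hF hG hFM hGM
    refine (bg F G hF hG).trans ?_
    rw [hM₁]
    push_cast
    rw [ENNReal.ofReal, ENNReal.ofReal]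
    gcongr
  have key := tendsto_integral_mul_gradDet e (f := fun n i => cf (f n i))
    (g := fun n i => cg (f n i) (g n i)) (f₀ := fun i => cf (f₀ i))
    (g₀ := fun i => cg (f₀ i) (g₀ i))
    (fun n i => (h n i).cutoff hχ hχc hχU) (fun i => (h₀ i).cutoff hχ hχc hχU)
    (fun n i => hcfm _ (hf n i)) (fun i => hcfm _ (hf₀ i))
    (fun n i => hcgm _ _ (hf n i) (hg n i)) (fun i => hcgm _ _ (hf₀ i) (hg₀ i)) (M := M₁)
    (fun n i => bg' _ _ (hf n i) (hg n i) ((hfM n i).trans hMM₀) ((hgM n i).trans hMM₀))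
    (fun i => bg' _ _ (hf₀ i) (hg₀ i) (bf₀ i) (bg₀ i))
    (fun n i => bf' _ (hf n i) ((hfM n i).trans hMM₀)) (fun i => bf' _ (hf₀ i) (bf₀ i))
    (fun i ψ hψ hψc => ?_) hφ hφc
  · -- the cutoff is `1` near the support of `φ`
    have hcut : ∀ (F : ι → EuclideanSpace ℝ (Fin m) → ℝ)
        (G : ι → EuclideanSpace ℝ (Fin m) → EuclideanSpace ℝ (Fin m) →L[ℝ] ℝ),
        ∫ x, φ x * gradDet e (fun i => cg (F i) (G i) x)
          = ∫ x in U, φ x * gradDet e (fun i => G i x) := by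
      intro F G
      rw [setIntegral_eq_integral_of_forall_compl_eq_zero (fun z hzU => by
        rw [image_eq_zero_of_notMem_tsupport fun h => hzU (hφU h), zero_mul])]
      refine integral_congr_ae (Eventually.of_forall fun x => ?_)
      by_cases hx : x ∈ tsupport φ
      · have hx1 : χ =ᶠ[𝓝 x] fun _ => 1 := (eventually_nhdsSet_iff_forall.1 hχ1) x hx
        have e1 : χ x = 1 := hx1.eq_of_nhds
        have e2 : fderiv ℝ χ x = 0 := by
          rw [hx1.fderiv_eq]
          simp
        simp [hcg, e1, e2]
      · simp only
        rw [image_eq_zero_of_notMem_tsupport hx, zero_mul, zero_mul]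
    simpa only [hcut] using key
  · have e1 : ∀ F : EuclideanSpace ℝ (Fin m) → ℝ,
        ∫ z, ψ z * cf F z = ∫ z in U, (ψ z * χ z) * F z := by
      intro F
      rw [setIntegral_eq_integral_of_forall_compl_eq_zero (fun z hzU => by simp [hz z hzU])]
      simp only [hcf, mul_assoc]
    simp only [e1]
    exact hw i _ (hψ.mul hχ.continuous) hψc.mul_right

end Local

/-! ### Bounded test functions -/

/-- Convergence of `∫ φ D n` for a set of test functions `φ` extends to the functions `ψ` that they
approximate in `L^s'`, if the `D n` are bounded in the dual space `L^s`. -/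
theorem tendsto_integral_mul_of_forall_exists_eLpNorm_sub_le {α : Type*} [MeasurableSpace α]
    {μ : Measure α} {s s' : ℝ≥0∞} [ENNReal.HolderConjugate s' s] {D : ℕ → α → ℝ} {D₀ : α → ℝ}
    (hD : ∀ n, MemLp (D n) s μ) (hD₀ : MemLp D₀ s μ) {C : ℝ≥0} (hC : ∀ n, eLpNorm (D n) s μ ≤ C)
    {ψ : α → ℝ} (hψ : MemLp ψ s' μ)
    (happ : ∀ ε : ℝ, 0 < ε → ∃ φ : α → ℝ, MemLp φ s' μ ∧
      eLpNorm (fun x => ψ x - φ x) s' μ ≤ ENNReal.ofReal ε ∧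
      Tendsto (fun n => ∫ x, φ x * D n x ∂μ) atTop (𝓝 (∫ x, φ x * D₀ x ∂μ))) :
    Tendsto (fun n => ∫ x, ψ x * D n x ∂μ) atTop (𝓝 (∫ x, ψ x * D₀ x ∂μ)) := by
  set C' : ℝ≥0 := max C (eLpNorm D₀ s μ).toNNReal + 1 with hC'
  have hCC' : ∀ n, eLpNorm (D n) s μ ≤ C' := fun n => (hC n).trans
    (ENNReal.coe_le_coe.2 ((le_max_left _ _).trans le_self_add))
  have hC0 : eLpNorm D₀ s μ ≤ C' := by
    rw [← ENNReal.coe_toNNReal hD₀.2.ne]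
    exact ENNReal.coe_le_coe.2 ((le_max_right _ _).trans le_self_add)
  have hC'pos : (0 : ℝ) < C' := by
    rw [hC']
    positivity
  have bound : ∀ {φ F : α → ℝ}, MemLp φ s' μ → MemLp F s μ → eLpNorm F s μ ≤ C' → ∀ {ε : ℝ},
      0 < ε → eLpNorm (fun x => ψ x - φ x) s' μ ≤ ENNReal.ofReal ε →
      |∫ x, ψ x * F x ∂μ - ∫ x, φ x * F x ∂μ| ≤ ε * C' := by
    intro φ F hφ hF hFC ε hε hle
    have i1 : Integrable (fun x => ψ x * F x) μ := hψ.integrable_mul hF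
    have i2 : Integrable (fun x => φ x * F x) μ := hφ.integrable_mul hF
    rw [← integral_sub i1 i2, ← Real.norm_eq_abs]
    have h1 : ∀ x, ψ x * F x - φ x * F x = ((fun x => ψ x - φ x) • F) x := fun x => by
      simp [sub_mul]
    simp_rw [h1]
    have h2 := eLpNorm_smul_le_mul_eLpNorm (p := s') (q := s) (r := 1) hF.1 (hψ.1.sub hφ.1)
    have h3 : ‖∫ x, ((fun x => ψ x - φ x) • F) x ∂μ‖ₑ ≤ ENNReal.ofReal (ε * C') := by
      refine (enorm_integral_le_lintegral_enorm _).trans ?_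
      rw [← eLpNorm_one_eq_lintegral_enorm, ENNReal.ofReal_mul hε.le, ENNReal.ofReal_coe_nnreal]
      exact h2.trans (mul_le_mul' hle hFC)
    rw [← ofReal_norm, ENNReal.ofReal_le_ofReal_iff (by positivity)] at h3
    exact h3
  rw [Metric.tendsto_atTop]
  intro ε hε
  have hε' : 0 < ε / (4 * C') := by positivity
  obtain ⟨φ, hφ, hle, hlim⟩ := happ _ hε'
  obtain ⟨N, hN⟩ := Metric.tendsto_atTop.1 hlim (ε / 2) (half_pos hε)
  refine ⟨N, fun n hn => ?_⟩
  have h1 := bound hφ (hD n) (hCC' n) hε' hle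
  have h2 := bound hφ hD₀ hC0 hε' hle
  have h3 := hN n hn
  have h4 : ε / (4 * C') * C' = ε / 4 := by field_simp
  rw [h4] at h1 h2
  rw [Real.dist_eq] at h3 ⊢
  rw [abs_le] at h1 h2
  rw [abs_lt] at h3 ⊢
  constructor <;> linarith

/-- Weak continuity in `L¹(U)` of the determinant on bounded sequences of Sobolev functions whose
exponent exceeds the number of rows. -/
theorem tendsto_setIntegral_mul_gradDet {m : ℕ} {U : Set (EuclideanSpace ℝ (Fin m))}
    {ι : Type} [Fintype ι] [DecidableEq ι] [Nonempty ι]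
    (e : ι → EuclideanSpace ℝ (Fin m)) (hU : IsOpen U) (hUfin : volume U ≠ ⊤)
    {f : ℕ → ι → EuclideanSpace ℝ (Fin m) → ℝ}
    {g : ℕ → ι → EuclideanSpace ℝ (Fin m) → EuclideanSpace ℝ (Fin m) →L[ℝ] ℝ}
    {f₀ : ι → EuclideanSpace ℝ (Fin m) → ℝ}
    {g₀ : ι → EuclideanSpace ℝ (Fin m) → EuclideanSpace ℝ (Fin m) →L[ℝ] ℝ}
    (h : ∀ n i, HasWeakFDerivOn (f n i) (g n i) U) (h₀ : ∀ i, HasWeakFDerivOn (f₀ i) (g₀ i) U)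
    {r : ℝ≥0∞} (hrι : (Fintype.card ι : ℝ≥0∞) < r)
    (hf : ∀ n i, MemLp (f n i) r (volume.restrict U))
    (hf₀ : ∀ i, MemLp (f₀ i) r (volume.restrict U))
    (hg : ∀ n i, MemLp (g n i) r (volume.restrict U))
    (hg₀ : ∀ i, MemLp (g₀ i) r (volume.restrict U))
    {M : ℝ≥0} (hfM : ∀ n i, eLpNorm (f n i) r (volume.restrict U) ≤ M)
    (hgM : ∀ n i, eLpNorm (g n i) r (volume.restrict U) ≤ M)
    (hw : ∀ i, ∀ ψ : EuclideanSpace ℝ (Fin m) → ℝ, Continuous ψ → HasCompactSupport ψ →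
      Tendsto (fun n => ∫ z in U, ψ z * f n i z) atTop (𝓝 (∫ z in U, ψ z * f₀ i z)))
    {ψ : EuclideanSpace ℝ (Fin m) → ℝ} (hψ : MemLp ψ ⊤ (volume.restrict U)) :
    Tendsto (fun n => ∫ x in U, ψ x * gradDet e (fun i => g n i x)) atTop
      (𝓝 (∫ x in U, ψ x * gradDet e (fun i => g₀ i x))) := by
  have hfinU : IsFiniteMeasure (volume.restrict U) := ⟨by simpa using hUfin.lt_top⟩
  have hcard : (1 : ℝ≥0∞) ≤ (Fintype.card ι : ℕ) := by
    exact_mod_cast (Fintype.card_pos : 0 < Fintype.card ι)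
  set k : ℝ := ((Fintype.card ι : ℕ) : ℝ) with hk
  have hk1 : 1 ≤ k := by
    rw [hk]
    exact_mod_cast (Fintype.card_pos : 0 < Fintype.card ι)
  -- the determinants are bounded in `L^s`, because the rows are bounded in `L^(k s)`
  obtain ⟨s, hs1, hsr⟩ : ∃ s : ℝ, 1 < s ∧ ENNReal.ofReal (k * s) ≤ r := by
    by_cases hr : r = ⊤
    · exact ⟨2, one_lt_two, by simp [hr]⟩
    · refine ⟨r.toReal / k, ?_, ?_⟩
      · rw [one_lt_div (by linarith), hk, ← ENNReal.toReal_natCast]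
        exact (ENNReal.toReal_lt_toReal (by simp) hr).2 hrι
      · rw [mul_div_cancel₀ _ (by linarith : k ≠ 0), ENNReal.ofReal_toReal hr]
  have hs0 : 0 < s := by linarith
  have hks : (1 : ℝ≥0∞) ≤ ENNReal.ofReal (k * s) := by
    rw [ENNReal.one_le_ofReal]
    nlinarith
  have hconj : s.HolderConjugate s.conjExponent := Real.HolderConjugate.conjExponent hs1
  have hconj' : ENNReal.HolderConjugate (ENNReal.ofReal s.conjExponent) (ENNReal.ofReal s) :=
    hconj.symm.ennrealOfReal
  obtain ⟨C, hC⟩ := exists_eLpNorm_le_mul_eLpNorm (volume.restrict U) hks hsr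
  have hmem : ∀ {G : ι → EuclideanSpace ℝ (Fin m) → EuclideanSpace ℝ (Fin m) →L[ℝ] ℝ},
      (∀ i, MemLp (G i) r (volume.restrict U)) →
      MemLp (fun x => gradDet e fun i => G i x) (ENNReal.ofReal s) (volume.restrict U) := by
    intro G hG
    refine ⟨aestronglyMeasurable_gradDet e fun i => (hG i).1, ?_⟩
    refine (eLpNorm_gradDet_le e (fun i => (hG i).1) hs0).trans_lt ?_
    refine ENNReal.mul_lt_top (by simp) (ENNReal.prod_lt_top fun i _ => ?_)
    exact ((hG i).mono_exponent hsr).2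
  have hs' : (1 : ℝ≥0∞) ≤ ENNReal.ofReal s.conjExponent := by
    rw [ENNReal.one_le_ofReal]
    exact hconj.symm.lt.le
  have hψ' : MemLp ψ (ENNReal.ofReal s.conjExponent) (volume.restrict U) :=
    hψ.mono_exponent le_top
  refine tendsto_integral_mul_of_forall_exists_eLpNorm_sub_le
    (s' := ENNReal.ofReal s.conjExponent) (fun n => hmem (hg n)) (hmem hg₀)
    (C := gradDetBound e * ∏ _i : ι, (C * M)) (fun n => ?_) hψ' fun ε hε => ?_
  · refine (eLpNorm_gradDet_le e (fun i => (hg n i).1) hs0).trans ?_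
    push_cast
    gcongr with i
    refine (hC _ (g n i) (hg n i).1).trans ?_
    gcongr
    exact hgM n i
  · obtain ⟨φ, hφ, hφc, hφU, hle⟩ :=
      exists_contDiff_eLpNorm_sub_le hU hUfin hs' ENNReal.ofReal_ne_top hψ' hε
    refine ⟨φ, ?_, hle, tendsto_setIntegral_mul_gradDet_of_contDiff e hU hUfin h h₀ hrι.le hf hf₀
      hg hg₀ hfM hgM hw hφ hφc hφU⟩
    exact (hφ.continuous.memLp_of_hasCompactSupport hφc).restrict U

/-! ### Local parametrizations of the boundary -/

section Charts

variable {d : ℕ} {Ω : Set (EuclideanSpace ℝ (Fin d))} {U : Set (EuclideanSpace ℝ (Fin (d - 1)))}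
  {Ψ : EuclideanSpace ℝ (Fin (d - 1)) → EuclideanSpace ℝ (Fin d)}

/-- The inverse of a parametrization `Ψ : U → ∂Ω`. -/
def chartInv (U : Set (EuclideanSpace ℝ (Fin (d - 1))))
    (Ψ : EuclideanSpace ℝ (Fin (d - 1)) → EuclideanSpace ℝ (Fin d)) :
    EuclideanSpace ℝ (Fin d) → EuclideanSpace ℝ (Fin (d - 1)) :=
  Function.invFunOn Ψ U

/-- The surface measure of `Ψ(U)` in the coordinates given by `Ψ`. -/
def chartMeasure (Ω : Set (EuclideanSpace ℝ (Fin d))) (U : Set (EuclideanSpace ℝ (Fin (d - 1))))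
    (Ψ : EuclideanSpace ℝ (Fin (d - 1)) → EuclideanSpace ℝ (Fin d)) :
    Measure (EuclideanSpace ℝ (Fin (d - 1))) :=
  ((surfaceMeasure Ω).restrict (Ψ '' U)).map (chartInv U Ψ)

theorem chartInv_mem {x : EuclideanSpace ℝ (Fin d)} (hx : x ∈ Ψ '' U) : chartInv U Ψ x ∈ U :=
  Function.invFunOn_mem hx

theorem apply_chartInv {x : EuclideanSpace ℝ (Fin d)} (hx : x ∈ Ψ '' U) :
    Ψ (chartInv U Ψ x) = x :=
  Function.invFunOn_eq hx

namespace IsBoundaryParam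

variable (hΨ : IsBoundaryParam Ω U Ψ)
include hΨ

theorem image_subset_frontier : Ψ '' U ⊆ frontier Ω := by
  obtain ⟨V, -, h⟩ := hΨ.isOpen_image
  rw [h]
  exact inter_subset_right

theorem measurableSet_image : MeasurableSet (Ψ '' U) := by
  obtain ⟨V, hV, h⟩ := hΨ.isOpen_image
  rw [h]
  exact hV.measurableSet.inter isClosed_frontier.measurableSet

theorem continuousOn : ContinuousOn Ψ U := by
  obtain ⟨K, hK, -⟩ := hΨ.biLipschitz
  exact hK.continuousOn

theorem exists_edist_le : ∃ K : ℝ≥0, LipschitzOnWith K Ψ U ∧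
    ∀ z ∈ U, ∀ w ∈ U, edist z w ≤ K * edist (Ψ z) (Ψ w) := by
  obtain ⟨K, hK, hK'⟩ := hΨ.biLipschitz
  exact ⟨K, hK, fun z hz w hw => hK' ⟨z, hz⟩ ⟨w, hw⟩⟩

theorem injOn : InjOn Ψ U := by
  obtain ⟨K, -, hK⟩ := hΨ.exists_edist_le
  intro z hz w hw h
  have := hK z hz w hw
  rw [h, edist_self, mul_zero] at this
  exact edist_le_zero.1 this

theorem chartInv_apply {z : EuclideanSpace ℝ (Fin (d - 1))} (hz : z ∈ U) :
    chartInv U Ψ (Ψ z) = z :=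
  hΨ.injOn (chartInv_mem (mem_image_of_mem Ψ hz)) hz (apply_chartInv (mem_image_of_mem Ψ hz))

theorem aemeasurable_chartInv :
    AEMeasurable (chartInv U Ψ) ((surfaceMeasure Ω).restrict (Ψ '' U)) := by
  obtain ⟨K, -, hK⟩ := hΨ.exists_edist_le
  have : LipschitzOnWith K (chartInv U Ψ) (Ψ '' U) := by
    intro x hx y hy
    have := hK _ (chartInv_mem hx) _ (chartInv_mem hy)
    rwa [apply_chartInv hx, apply_chartInv hy] at this
  exact this.continuousOn.aemeasurable hΨ.measurableSet_image

theorem chartMeasure_apply {A : Set (EuclideanSpace ℝ (Fin (d - 1)))} (hA : MeasurableSet A) :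
    chartMeasure Ω U Ψ A = euclideanHausdorffMeasure (d - 1) (Ψ '' (A ∩ U)) := by
  have hset : chartInv U Ψ ⁻¹' A ∩ Ψ '' U = Ψ '' (A ∩ U) := by
    ext x
    constructor
    · rintro ⟨hxA, hx⟩
      exact ⟨chartInv U Ψ x, ⟨hxA, chartInv_mem hx⟩, apply_chartInv hx⟩
    · rintro ⟨z, ⟨hzA, hzU⟩, rfl⟩
      refine ⟨?_, mem_image_of_mem Ψ hzU⟩
      rw [mem_preimage, hΨ.chartInv_apply hzU]
      exact hzA
  have hsub : Ψ '' (A ∩ U) ⊆ frontier Ω :=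
    (image_mono inter_subset_right).trans hΨ.image_subset_frontier
  rw [chartMeasure, map_apply_of_aemeasurable hΨ.aemeasurable_chartInv hA,
    restrict_apply' hΨ.measurableSet_image, hset, surfaceMeasure,
    restrict_apply' isClosed_frontier.measurableSet, inter_eq_self_of_subset_left hsub]

/-- In the coordinates of a parametrization, the surface measure and Lebesgue measure are
comparable. -/
theorem exists_chartMeasure_le : ∃ C : ℝ≥0, chartMeasure Ω U Ψ ≤ C • volume.restrict U ∧
    volume.restrict U ≤ C • chartMeasure Ω U Ψ := by
  obtain ⟨K, hK, hK'⟩ := hΨ.biLipschitz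
  have h0 : (0 : ℝ) ≤ ((d - 1 : ℕ) : ℝ) := by positivity
  refine ⟨K ^ (d - 1), ?_, ?_⟩
  · refine Measure.le_iff.2 fun A hA => ?_
    rw [hΨ.chartMeasure_apply hA, Measure.smul_apply, restrict_apply hA,
      ← EuclideanSpace.euclideanHausdorffMeasure_eq_volume]
    simp only [euclideanHausdorffMeasure_def, Measure.smul_apply]
    rw [smul_comm]
    gcongr
    have := (hK.mono inter_subset_right).hausdorffMeasure_image_le (s := A ∩ U) h0
    simpa [ENNReal.smul_def] using this
  · refine Measure.le_iff.2 fun A hA => ?_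
    rw [Measure.smul_apply, hΨ.chartMeasure_apply hA, restrict_apply hA,
      ← EuclideanSpace.euclideanHausdorffMeasure_eq_volume]
    simp only [euclideanHausdorffMeasure_def, Measure.smul_apply]
    rw [smul_comm]
    gcongr
    have h1 : ((↑) : U → EuclideanSpace ℝ (Fin (d - 1))) '' ((↑) ⁻¹' (A ∩ U)) = A ∩ U := by
      simp [inter_comm]
    have h2 : U.domRestrict Ψ '' ((↑) ⁻¹' (A ∩ U)) = Ψ '' (A ∩ U) := by
      rw [domRestrict_eq, image_comp, h1]
    have := hK'.le_hausdorffMeasure_image h0 ((↑) ⁻¹' (A ∩ U))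
    rw [← isometry_subtype_coe.hausdorffMeasure_image (Or.inl h0), h1, h2] at this
    simpa [ENNReal.smul_def] using this

theorem chartMeasure_absolutelyContinuous : chartMeasure Ω U Ψ ≪ volume.restrict U := by
  obtain ⟨C, hC, -⟩ := hΨ.exists_chartMeasure_le
  exact (absolutelyContinuous_of_le hC).trans (smul_absolutelyContinuous (c := C))

theorem absolutelyContinuous_chartMeasure : volume.restrict U ≪ chartMeasure Ω U Ψ := by
  obtain ⟨C, -, hC⟩ := hΨ.exists_chartMeasure_le
  exact (absolutelyContinuous_of_le hC).trans (smul_absolutelyContinuous (c := C))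

theorem aemeasurable_chartMeasure : AEMeasurable Ψ (chartMeasure Ω U Ψ) :=
  (hΨ.continuousOn.aemeasurable hΨ.isOpen.measurableSet).mono_ac
    hΨ.chartMeasure_absolutelyContinuous

theorem map_chartMeasure :
    (chartMeasure Ω U Ψ).map Ψ = (surfaceMeasure Ω).restrict (Ψ '' U) := by
  rw [chartMeasure, AEMeasurable.map_map_of_aemeasurable hΨ.aemeasurable_chartMeasure
    hΨ.aemeasurable_chartInv]
  refine (Measure.map_congr ?_).trans Measure.map_id
  filter_upwards [ae_restrict_mem hΨ.measurableSet_image] with x hx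
  exact apply_chartInv hx

theorem ae_image {P : EuclideanSpace ℝ (Fin d) → Prop}
    (hP : ∀ᵐ z ∂(volume.restrict U), P (Ψ z)) :
    ∀ᵐ x ∂((surfaceMeasure Ω).restrict (Ψ '' U)), P x := by
  have h1 := hΨ.chartMeasure_absolutelyContinuous.ae_le hP
  have h2 := ae_of_ae_map hΨ.aemeasurable_chartInv h1
  filter_upwards [h2, ae_restrict_mem hΨ.measurableSet_image] with x hx hxT
  rwa [apply_chartInv hxT] at hx

theorem surfaceMeasure_image_lt_top (hU : volume U ≠ ⊤) : surfaceMeasure Ω (Ψ '' U) < ⊤ := by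
  obtain ⟨C, hC, -⟩ := hΨ.exists_chartMeasure_le
  have h1 : surfaceMeasure Ω (Ψ '' U) = chartMeasure Ω U Ψ univ := by
    rw [chartMeasure, map_apply_of_aemeasurable hΨ.aemeasurable_chartInv MeasurableSet.univ]
    simp
  rw [h1]
  refine (hC univ).trans_lt ?_
  rw [Measure.smul_apply, ENNReal.smul_def, restrict_apply_univ]
  exact ENNReal.mul_lt_top (by simp) hU.lt_top

/-- A parametrization is differentiable almost everywhere, with derivative bounded from above and
from below. -/
theorem exists_ae_differentiableAt : ∃ K : ℝ, 0 < K ∧ ∀ᵐ z ∂(volume.restrict U),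
    DifferentiableAt ℝ Ψ z ∧ ‖fderiv ℝ Ψ z‖ ≤ K ∧ ∀ w, ‖w‖ ≤ K * ‖fderiv ℝ Ψ z w‖ := by
  obtain ⟨K, hK, hK'⟩ := hΨ.exists_edist_le
  have hUo := hΨ.isOpen
  refine ⟨K + 1, by positivity, ?_⟩
  filter_upwards [hK.ae_differentiableWithinAt (μ := volume) hΨ.isOpen.measurableSet,
    ae_restrict_mem hΨ.isOpen.measurableSet] with z hz hzU
  have hUz : U ∈ 𝓝 z := hUo.mem_nhds hzU
  have hd : DifferentiableAt ℝ Ψ z := hz.differentiableAt hUz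
  refine ⟨hd, (hd.hasFDerivAt.le_of_lipschitzOn hUz hK).trans (by linarith), fun w => ?_⟩
  have hlim := hd.hasFDerivAt.lim w (c := fun n : ℕ => ((n : ℝ) + 1)) (l := atTop) ?_
  · have hmem : ∀ᶠ n : ℕ in atTop, z + ((n : ℝ) + 1)⁻¹ • w ∈ U := by
      have h1 : Tendsto (fun n : ℕ => z + ((n : ℝ) + 1)⁻¹ • w) atTop (𝓝 (z + (0 : ℝ) • w)) := by
        refine tendsto_const_nhds.add (Tendsto.smul_const ?_ w)
        simpa using tendsto_one_div_add_atTop_nhds_zero_nat (𝕜 := ℝ)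
      rw [zero_smul, add_zero] at h1
      exact h1.eventually_mem hUz
    have h2 : ‖w‖ ≤ K * ‖fderiv ℝ Ψ z w‖ := by
      refine ge_of_tendsto (hlim.norm.const_mul (K : ℝ)) ?_
      filter_upwards [hmem] with n hn
      have h3 := hK' _ hn z hzU
      have h4 : dist (z + ((n : ℝ) + 1)⁻¹ • w) z
          ≤ K * dist (Ψ (z + ((n : ℝ) + 1)⁻¹ • w)) (Ψ z) := by
        rw [edist_dist, edist_dist, ← ENNReal.ofReal_coe_nnreal, ← ENNReal.ofReal_mul (by simp),
          ENNReal.ofReal_le_ofReal_iff (by positivity)] at h3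
        exact h3
      have hn0 : (0 : ℝ) < (n : ℝ) + 1 := by positivity
      rw [dist_eq_norm, dist_eq_norm, add_sub_cancel_left, norm_smul, norm_inv,
        Real.norm_of_nonneg hn0.le] at h4
      rw [norm_smul, Real.norm_of_nonneg hn0.le]
      calc ‖w‖ = ((n : ℝ) + 1) * (((n : ℝ) + 1)⁻¹ * ‖w‖) := by field_simp
        _ ≤ ((n : ℝ) + 1) * (K * ‖Ψ (z + ((n : ℝ) + 1)⁻¹ • w) - Ψ z‖) := by gcongr
        _ = _ := by ring
    refine h2.trans ?_
    gcongr
    linarith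
  · have h5 : Tendsto (fun n : ℕ => (n : ℝ) + 1) atTop atTop :=
      tendsto_atTop_add_const_right _ _ tendsto_natCast_atTop_atTop
    exact tendsto_norm_atTop_atTop.comp h5

/-- At a point of differentiability of a parametrization, the tangent space is the range of its
derivative. -/
theorem tangentSpaceAt_eq_range {z : EuclideanSpace ℝ (Fin (d - 1))} (hz : z ∈ U)
    (hd : DifferentiableAt ℝ Ψ z) :
    tangentSpaceAt Ω (Ψ z) = LinearMap.range (fderiv ℝ Ψ z).toLinearMap := by
  obtain ⟨K, hK, hK'⟩ := hΨ.exists_edist_le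
  have hUz : U ∈ 𝓝 z := hΨ.isOpen.mem_nhds hz
  refine le_antisymm (Submodule.span_le.2 fun y hy => ?_) ?_
  · obtain ⟨α, l, hl, c, v, hv0, hvm, hcv⟩ := exists_fun_of_mem_tangentConeAt hy
    obtain ⟨V, hV, hVU⟩ := hΨ.isOpen_image
    have hzV : Ψ z ∈ V := by
      have : Ψ z ∈ V ∩ frontier Ω := hVU ▸ mem_image_of_mem Ψ hz
      exact this.1
    have hmem : ∀ᶠ n in l, Ψ z + v n ∈ Ψ '' U := by
      have h1 : Tendsto (fun n => Ψ z + v n) l (𝓝 (Ψ z + 0)) := tendsto_const_nhds.add hv0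
      rw [add_zero] at h1
      filter_upwards [hvm, h1.eventually_mem (hV.mem_nhds hzV)] with n hn hnV
      rw [hVU]
      exact ⟨hnV, hn⟩
    set w : α → EuclideanSpace ℝ (Fin (d - 1)) := fun n => chartInv U Ψ (Ψ z + v n) - z with hw
    have hwv : ∀ᶠ n in l, ‖w n‖ ≤ K * ‖v n‖ := by
      filter_upwards [hmem] with n hn
      have h3 := hK' _ (chartInv_mem hn) z hz
      rw [apply_chartInv hn, edist_dist, edist_dist, ← ENNReal.ofReal_coe_nnreal,
        ← ENNReal.ofReal_mul (by simp), ENNReal.ofReal_le_ofReal_iff (by positivity),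
        dist_eq_norm, dist_eq_norm, add_sub_cancel_left] at h3
      exact h3
    have hw0 : Tendsto w l (𝓝 0) := by
      refine squeeze_zero_norm' hwv ?_
      simpa using hv0.norm.const_mul (K : ℝ)
    have ho : (fun n => v n - fderiv ℝ Ψ z (w n)) =o[l] w := by
      have h1 := (hasFDerivAt_iff_isLittleO_nhds_zero.1 hd.hasFDerivAt).comp_tendsto hw0
      refine h1.congr' ?_ EventuallyEq.rfl
      filter_upwards [hmem] with n hn
      simp only [Function.comp_apply, hw, add_sub_cancel, apply_chartInv hn]
      abel
    have hwO : w =O[l] v := Asymptotics.IsBigO.of_bound K hwv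
    have hcO : (fun n => c n • (v n - fderiv ℝ Ψ z (w n))) =o[l] fun n => c n • v n :=
      (Asymptotics.isBigO_refl c l).smul_isLittleO (ho.trans_isBigO hwO)
    have hc0 : Tendsto (fun n => c n • (v n - fderiv ℝ Ψ z (w n))) l (𝓝 0) :=
      (Asymptotics.isLittleO_one_iff ℝ).1 (hcO.trans_isBigO (hcv.isBigO_one ℝ))
    have hlim : Tendsto (fun n => fderiv ℝ Ψ z (c n • w n)) l (𝓝 y) := by
      have h2 := hcv.sub hc0
      rw [sub_zero] at h2
      refine h2.congr fun n => ?_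
      rw [smul_sub, sub_sub_cancel, map_smul]
    refine (Submodule.closed_of_finiteDimensional
      (LinearMap.range (fderiv ℝ Ψ z).toLinearMap)).mem_of_tendsto hlim
      (Eventually.of_forall fun n => ⟨c n • w n, rfl⟩)
  · rintro _ ⟨w, rfl⟩
    refine Submodule.subset_span ?_
    have h1 := (hd.hasFDerivAt.hasFDerivWithinAt (s := U)).mapsTo_tangent_cone
    refine tangentConeAt_mono hΨ.image_subset_frontier (h1 (x := w) ?_)
    rw [tangentConeAt_of_mem_nhds hUz]
    trivial

end IsBoundaryParam

/-- Lipschitz domains have local parametrizations near each boundary point. -/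
theorem IsLipschitzDomain.exists_isBoundaryParam (hΩ : IsLipschitzDomain Ω)
    {x : EuclideanSpace ℝ (Fin d)} (hx : x ∈ frontier Ω) :
    ∃ U Ψ, IsBoundaryParam Ω U Ψ ∧ volume U ≠ ⊤ ∧ Ψ '' U ∈ 𝓝[frontier Ω] x := by
  obtain ⟨r, β, G, hr, hβ, ⟨K, hK, hK'⟩, hGo, hG0, hG⟩ := hΩ.exists_coordinates x hx
  have hmem : ∀ z ∈ Metric.ball (0 : EuclideanSpace ℝ (Fin (d - 1))) r,
      (z, (0 : ℝ)) ∈ Metric.ball (0 : EuclideanSpace ℝ (Fin (d - 1))) r ×ˢ Ioo (-β) β :=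
    fun z hz => ⟨hz, by simp [hβ]⟩
  have hedist : ∀ z w : EuclideanSpace ℝ (Fin (d - 1)),
      edist (z, (0 : ℝ)) (w, (0 : ℝ)) = edist z w := fun z w => by simp [Prod.edist_eq]
  have himage : (fun z => G (z, 0)) '' Metric.ball 0 r
      = G '' (Metric.ball 0 r ×ˢ Ioo (-β) β) ∩ frontier Ω := by
    ext y
    constructor
    · rintro ⟨z, hz, rfl⟩
      exact ⟨mem_image_of_mem G (hmem z hz), ((hG _ (hmem z hz)).2).2 rfl⟩
    · rintro ⟨⟨⟨z, t⟩, hq, rfl⟩, hy⟩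
      have ht : t = 0 := ((hG _ hq).2).1 hy
      subst ht
      exact ⟨z, hq.1, rfl⟩
  refine ⟨Metric.ball 0 r, fun z => G (z, 0), ⟨Metric.isOpen_ball, ⟨K, ?_, ?_⟩, _, hGo, himage⟩,
    measure_ball_lt_top.ne, ?_⟩
  · intro z hz w hw
    have := hK (hmem z hz) (hmem w hw)
    rwa [hedist] at this
  · intro z w
    have := hK' ⟨_, hmem z z.2⟩ ⟨_, hmem w w.2⟩
    change edist ((z : EuclideanSpace ℝ (Fin (d - 1))), (0 : ℝ)) (w, 0) ≤ _ at this
    rw [hedist] at this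
    exact this
  · rw [himage, inter_comm]
    refine inter_mem_nhdsWithin _ (hGo.mem_nhds ?_)
    exact ⟨(0, 0), hmem 0 (Metric.mem_ball_self hr), hG0⟩

theorem IsLipschitzDomain.isCompact_frontier (hΩ : IsLipschitzDomain Ω) :
    IsCompact (frontier Ω) :=
  Metric.isCompact_of_isClosed_isBounded isClosed_frontier
    (hΩ.isBounded.closure.subset frontier_subset_closure)

end Charts

/-! ### Bases of the tangent bundle -/

section Extension

variable {m : ℕ}

/-- The linear form `w ↦ det (A e₁, …, A e_m, w)`. -/
def crossForm (A : EuclideanSpace ℝ (Fin m) →L[ℝ] EuclideanSpace ℝ (Fin (m + 1))) :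
    (Fin (m + 1) → ℝ) →ₗ[ℝ] ℝ :=
  (Matrix.detRowAlternating (n := Fin (m + 1)) (R := ℝ)).toMultilinearMap.toLinearMap
    (Fin.snoc (α := fun _ => Fin (m + 1) → ℝ)
      (fun j : Fin m => (A (EuclideanSpace.single j 1)).ofLp) 0) (Fin.last m)

/-- The vector product of the columns `A e₁, …, A e_m`. -/
def crossVector (A : EuclideanSpace ℝ (Fin m) →L[ℝ] EuclideanSpace ℝ (Fin (m + 1))) :
    EuclideanSpace ℝ (Fin (m + 1)) :=
  WithLp.toLp 2 fun i => crossForm A (Pi.single i 1)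

variable (A : EuclideanSpace ℝ (Fin m) →L[ℝ] EuclideanSpace ℝ (Fin (m + 1)))

theorem crossForm_apply (w : Fin (m + 1) → ℝ) : crossForm A w = Matrix.det
    (Fin.snoc (α := fun _ => Fin (m + 1) → ℝ)
      (fun j : Fin m => (A (EuclideanSpace.single j 1)).ofLp) w) := by
  rw [crossForm, MultilinearMap.toLinearMap_apply, Fin.update_snoc_last]
  rfl

theorem inner_crossVector (w : EuclideanSpace ℝ (Fin (m + 1))) :
    inner ℝ (crossVector A) w = crossForm A w.ofLp := by
  rw [LinearMap.pi_apply_eq_sum_univ (crossForm A) w.ofLp, PiLp.inner_apply]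
  refine Finset.sum_congr rfl fun i _ => ?_
  have : (Pi.single i 1 : Fin (m + 1) → ℝ) = fun j => if i = j then 1 else 0 := by
    ext j
    simp [Pi.single_apply, eq_comm]
  simp [crossVector, this]

theorem inner_crossVector_apply (w : EuclideanSpace ℝ (Fin m)) :
    inner ℝ (crossVector A) (A w) = 0 := by
  have h1 : ∀ j : Fin m, inner ℝ (crossVector A) (A (EuclideanSpace.single j 1)) = 0 := by
    intro j
    rw [inner_crossVector, crossForm_apply]
    refine Matrix.det_zero_of_row_eq (i := Fin.castSucc j) (j := Fin.last m)
      (Fin.castSucc_lt_last j).ne ?_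
    rw [Fin.snoc_castSucc, Fin.snoc_last]
  have h2 : (innerSL ℝ (crossVector A)).toLinearMap ∘ₗ A.toLinearMap = 0 := by
    refine (EuclideanSpace.basisFun (Fin m) ℝ).toBasis.ext fun j => ?_
    simpa using h1 j
  exact LinearMap.congr_fun h2 w

theorem crossVector_ne_zero (hA : Function.Injective A) : crossVector A ≠ 0 := by
  intro h0
  obtain ⟨w, hw⟩ : ∃ w, w ∉ LinearMap.range A.toLinearMap := by
    by_contra! hall
    have h1 : LinearMap.range A.toLinearMap = ⊤ := eq_top_iff.2 fun w _ => hall w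
    have h2 := LinearMap.finrank_range_le A.toLinearMap
    rw [h1, finrank_top, finrank_euclideanSpace_fin, finrank_euclideanSpace_fin] at h2
    omega
  have hdet : crossForm A w.ofLp = 0 := by
    rw [← inner_crossVector, h0, inner_zero_left]
  rw [crossForm_apply] at hdet
  set e := (WithLp.linearEquiv 2 ℝ (Fin (m + 1) → ℝ))
  set v : Fin m → Fin (m + 1) → ℝ := fun j => (A (EuclideanSpace.single j 1)).ofLp with hv
  have hli : LinearIndependent ℝ (Fin.snoc (α := fun _ => Fin (m + 1) → ℝ) v w.ofLp) := by
    rw [linearIndependent_finSnoc]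
    have hli0 : LinearIndependent ℝ fun j : Fin m => A (EuclideanSpace.single j 1) := by
      have := (EuclideanSpace.basisFun (Fin m) ℝ).toBasis.linearIndependent.map' A.toLinearMap
        (LinearMap.ker_eq_bot.2 hA)
      simpa [Function.comp_def] using this
    constructor
    · exact hli0.map' e.toLinearMap e.ker
    · intro hmem
      refine hw ?_
      have h3 : Submodule.span ℝ (range v) ≤ (LinearMap.range A.toLinearMap).map e.toLinearMap := by
        rw [Submodule.span_le]
        rintro _ ⟨j, rfl⟩
        exact ⟨_, ⟨EuclideanSpace.single j 1, rfl⟩, rfl⟩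
      obtain ⟨y, hy, hyw⟩ := h3 hmem
      have : y = w := e.injective hyw
      rwa [this] at hy
  have hunit := (Matrix.linearIndependent_rows_iff_isUnit
    (A := (Fin.snoc (α := fun _ => Fin (m + 1) → ℝ) v w.ofLp :
      Matrix (Fin (m + 1)) (Fin (m + 1)) ℝ))).1 hli
  have hunit' := (Matrix.isUnit_iff_isUnit_det _).1 hunit
  exact hunit'.ne_zero hdet

theorem continuous_crossVector : Continuous
    (crossVector : (EuclideanSpace ℝ (Fin m) →L[ℝ] EuclideanSpace ℝ (Fin (m + 1))) → _) := by
  refine (PiLp.continuous_toLp 2 _).comp (continuous_pi fun i => ?_)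
  simp only [crossForm_apply]
  refine Continuous.matrix_det (continuous_pi fun j => ?_)
  induction j using Fin.lastCases with
  | last => simpa using continuous_const
  | cast j =>
    simp only [Fin.snoc_castSucc]
    exact (PiLp.continuous_ofLp 2 _).comp (by fun_prop)

/-- The first `m` coordinates. -/
def initCLM (m : ℕ) : EuclideanSpace ℝ (Fin (m + 1)) →L[ℝ] EuclideanSpace ℝ (Fin m) :=
  LinearMap.toContinuousLinearMap
    { toFun := fun w => WithLp.toLp 2 fun i => w i.castSucc
      map_add' := fun _ _ => rfl
      map_smul' := fun _ _ => rfl }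

@[simp]
theorem initCLM_apply (w : EuclideanSpace ℝ (Fin (m + 1))) (i : Fin m) :
    initCLM m w i = w i.castSucc := rfl

/-- The extension of `A` to `ℝ^{m+1}` that maps the last basis vector to the vector product of the
columns of `A`. It depends continuously on `A`, and is invertible if `A` is injective. -/
def crossExtension : EuclideanSpace ℝ (Fin (m + 1)) →L[ℝ] EuclideanSpace ℝ (Fin (m + 1)) :=
  A.comp (initCLM m) + (EuclideanSpace.proj (Fin.last m) :
    EuclideanSpace ℝ (Fin (m + 1)) →L[ℝ] ℝ).smulRight (crossVector A)

theorem crossExtension_apply (w : EuclideanSpace ℝ (Fin (m + 1))) :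
    crossExtension A w = A (initCLM m w) + w (Fin.last m) • crossVector A := rfl

theorem crossExtension_single (i : Fin m) :
    crossExtension A (EuclideanSpace.single i.castSucc 1) = A (EuclideanSpace.single i 1) := by
  rw [crossExtension_apply]
  have h1 : initCLM m (EuclideanSpace.single i.castSucc 1) = EuclideanSpace.single i 1 := by
    ext j
    simp
  simp [h1]

theorem continuous_crossExtension : Continuous
    (crossExtension : (EuclideanSpace ℝ (Fin m) →L[ℝ] EuclideanSpace ℝ (Fin (m + 1))) → _) := by
  unfold crossExtension
  refine Continuous.add (by fun_prop) ?_
  exact ((ContinuousLinearMap.smulRightL ℝ _ _ _).continuous).comp continuous_crossVector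

theorem isUnit_crossExtension (hA : Function.Injective A) : IsUnit (crossExtension A) := by
  have hinj : Function.Injective (crossExtension A) := by
    rw [injective_iff_map_eq_zero]
    intro w hw
    rw [crossExtension_apply] at hw
    have h1 : w (Fin.last m) = 0 := by
      have h2 := congrArg (inner ℝ (crossVector A)) hw
      rw [inner_add_right, inner_crossVector_apply, inner_smul_right, inner_zero_right, zero_add,
        mul_eq_zero] at h2
      exact h2.resolve_right (inner_self_ne_zero.2 (crossVector_ne_zero A hA))
    rw [h1, zero_smul, add_zero] at hw
    have h3 : initCLM m w = 0 := hA (by rw [hw, map_zero])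
    ext i
    induction i using Fin.lastCases with
    | last => simpa using h1
    | cast i => simpa using congrArg (fun y : EuclideanSpace ℝ (Fin m) => y i) h3
  refine ⟨(ContinuousLinearEquiv.unitsEquiv ℝ (EuclideanSpace ℝ (Fin (m + 1)))).symm
    (LinearEquiv.ofInjectiveEndo (crossExtension A).toLinearMap hinj).toContinuousLinearEquiv, ?_⟩
  ext w
  rfl

end Extension

/-- Measurable and bounded invertible extensions, together with their inverses, of the linear maps
`A` that satisfy `‖A‖ ≤ K` and `‖w‖ ≤ K ‖A w‖`. -/
theorem exists_measurable_extension {d : ℕ} (hd : 1 ≤ d) (K : ℝ) :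
    ∃ (P Q : (EuclideanSpace ℝ (Fin (d - 1)) →L[ℝ] EuclideanSpace ℝ (Fin d)) →
      EuclideanSpace ℝ (Fin d) →L[ℝ] EuclideanSpace ℝ (Fin d)) (C : ℝ),
      Measurable P ∧ Measurable Q ∧ (∀ A, ‖P A‖ ≤ C) ∧ (∀ A, ‖Q A‖ ≤ C) ∧
      ∀ A : EuclideanSpace ℝ (Fin (d - 1)) →L[ℝ] EuclideanSpace ℝ (Fin d),
        ‖A‖ ≤ K → (∀ w, ‖w‖ ≤ K * ‖A w‖) →
        (P A).comp (Q A) = ContinuousLinearMap.id ℝ _ ∧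
        (Q A).comp (P A) = ContinuousLinearMap.id ℝ _ ∧
        ∀ i : Fin (d - 1), P A (EuclideanSpace.single (Fin.castLE (Nat.sub_le d 1) i) 1)
          = A (EuclideanSpace.single i 1) := by
  obtain ⟨m, rfl⟩ : ∃ m, d = m + 1 := ⟨d - 1, by omega⟩
  change ∃ (P Q : (EuclideanSpace ℝ (Fin m) →L[ℝ] EuclideanSpace ℝ (Fin (m + 1))) →
      EuclideanSpace ℝ (Fin (m + 1)) →L[ℝ] EuclideanSpace ℝ (Fin (m + 1))) (C : ℝ),
      Measurable P ∧ Measurable Q ∧ (∀ A, ‖P A‖ ≤ C) ∧ (∀ A, ‖Q A‖ ≤ C) ∧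
      ∀ A : EuclideanSpace ℝ (Fin m) →L[ℝ] EuclideanSpace ℝ (Fin (m + 1)),
        ‖A‖ ≤ K → (∀ w, ‖w‖ ≤ K * ‖A w‖) →
        (P A).comp (Q A) = ContinuousLinearMap.id ℝ _ ∧
        (Q A).comp (P A) = ContinuousLinearMap.id ℝ _ ∧
        ∀ i : Fin m, P A (EuclideanSpace.single i.castSucc 1) = A (EuclideanSpace.single i 1)
  set S : Set (EuclideanSpace ℝ (Fin m) →L[ℝ] EuclideanSpace ℝ (Fin (m + 1))) :=
    {A | ‖A‖ ≤ K ∧ ∀ w, ‖w‖ ≤ K * ‖A w‖} with hS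
  have hSc : IsClosed S := by
    have h1 : S = {A | ‖A‖ ≤ K} ∩ ⋂ w, {A | ‖w‖ ≤ K * ‖A w‖} := by
      ext A
      simp [hS]
    rw [h1]
    exact (isClosed_le continuous_norm continuous_const).inter
      (isClosed_iInter fun w => isClosed_le continuous_const (by fun_prop))
  have hScpt : IsCompact S := Metric.isCompact_of_isClosed_isBounded hSc
    (Metric.isBounded_closedBall.subset fun A hA => mem_closedBall_zero_iff.2 hA.1)
  have hSu : ∀ A ∈ S, IsUnit (crossExtension A) := by
    intro A hA
    refine isUnit_crossExtension A ((injective_iff_map_eq_zero A).2 fun w hw => ?_)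
    have := hA.2 w
    rw [hw, norm_zero, mul_zero] at this
    exact norm_le_zero_iff.1 this
  have hQc : ContinuousOn (fun A => Ring.inverse (crossExtension A)) S := by
    intro A hA
    obtain ⟨u, hu⟩ := hSu A hA
    have h1 : ContinuousAt Ring.inverse (crossExtension A) := hu ▸ NormedRing.inverse_continuousAt u
    exact (h1.comp continuous_crossExtension.continuousAt).continuousWithinAt
  -- bounds by compactness of the set `S` of admissible `A`; outside `S` the fields are set to `0`
  obtain ⟨C₁, hC₁⟩ := hScpt.exists_bound_of_continuousOn continuous_crossExtension.continuousOn
  obtain ⟨C₂, hC₂⟩ := hScpt.exists_bound_of_continuousOn hQc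
  refine ⟨S.indicator crossExtension, S.indicator fun A => Ring.inverse (crossExtension A),
    max 0 (max C₁ C₂), continuous_crossExtension.measurable.indicator hSc.measurableSet, ?_, ?_, ?_,
    ?_⟩
  · classical
    have := hQc.measurable_piecewise (g := fun _ => 0) continuousOn_const hSc.measurableSet
    convert this using 1
    exact (piecewise_eq_indicator).symm
  · intro A
    by_cases hA : A ∈ S
    · rw [indicator_of_mem hA]
      exact (hC₁ A hA).trans ((le_max_left _ _).trans (le_max_right _ _))
    · rw [indicator_of_notMem hA, norm_zero]
      exact le_max_left _ _
  · intro A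
    by_cases hA : A ∈ S
    · rw [indicator_of_mem hA]
      exact (hC₂ A hA).trans ((le_max_right _ _).trans (le_max_right _ _))
    · rw [indicator_of_notMem hA, norm_zero]
      exact le_max_left _ _
  · intro A hA1 hA2
    have hA : A ∈ S := ⟨hA1, hA2⟩
    rw [indicator_of_mem hA, indicator_of_mem hA]
    exact ⟨Ring.mul_inverse_cancel _ (hSu A hA), Ring.inverse_mul_cancel _ (hSu A hA),
      crossExtension_single A⟩

theorem range_eq_span_single {m : ℕ} {W : Type*} [NormedAddCommGroup W] [NormedSpace ℝ W]
    (A : EuclideanSpace ℝ (Fin m) →L[ℝ] W) :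
    LinearMap.range A.toLinearMap
      = Submodule.span ℝ (range fun i => A (EuclideanSpace.single i 1)) := by
  rw [LinearMap.range_eq_map, ← (EuclideanSpace.basisFun (Fin m) ℝ).toBasis.span_eq,
    Submodule.map_span, ← range_comp]
  congr 2
  ext i
  simp

/-- On `T`, the fields `P` and `Q` are essentially bounded and inverse to each other, and `P` maps
the first `d - 1` basis vectors to a basis of the tangent space of `∂Ω`. -/
structure IsTangentFrameOn {d : ℕ} (Ω : Set (EuclideanSpace ℝ (Fin d)))
    (P Q : EuclideanSpace ℝ (Fin d) → EuclideanSpace ℝ (Fin d) →L[ℝ] EuclideanSpace ℝ (Fin d))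
    (T : Set (EuclideanSpace ℝ (Fin d))) : Prop where
  memLp : MemLp P ⊤ ((surfaceMeasure Ω).restrict T)
  memLp_inv : MemLp Q ⊤ ((surfaceMeasure Ω).restrict T)
  inverse : ∀ᵐ x ∂((surfaceMeasure Ω).restrict T),
    (P x).comp (Q x) = ContinuousLinearMap.id ℝ _ ∧ (Q x).comp (P x) = ContinuousLinearMap.id ℝ _
  span : ∀ᵐ x ∂((surfaceMeasure Ω).restrict T), Submodule.span ℝ (range fun i : Fin (d - 1) =>
    P x (EuclideanSpace.single (Fin.castLE (Nat.sub_le d 1) i) 1)) = tangentSpaceAt Ω x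

section Frame

variable {d : ℕ} {Ω : Set (EuclideanSpace ℝ (Fin d))}
  {P Q P' Q' : EuclideanSpace ℝ (Fin d) → EuclideanSpace ℝ (Fin d) →L[ℝ] EuclideanSpace ℝ (Fin d)}
  {T T' : Set (EuclideanSpace ℝ (Fin d))}

open Classical in
theorem ae_restrict_union_piecewise {X W : Type*} [MeasurableSpace X] {μ : Measure X}
    {T T' : Set X} (hT : MeasurableSet T) (hT' : MeasurableSet T') {R : X → W → Prop} {f g : X → W}
    (hf : ∀ᵐ x ∂(μ.restrict T), R x (f x)) (hg : ∀ᵐ x ∂(μ.restrict T'), R x (g x)) :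
    ∀ᵐ x ∂(μ.restrict (T ∪ T')), R x (T.piecewise f g x) := by
  rw [ae_restrict_iff' hT] at hf
  rw [ae_restrict_iff' hT'] at hg
  rw [ae_restrict_iff' (hT.union hT')]
  filter_upwards [hf, hg] with x hx hx' hxT
  by_cases h : x ∈ T
  · rw [piecewise_eq_of_mem _ _ _ h]
    exact hx h
  · rw [piecewise_eq_of_notMem _ _ _ h]
    exact hx' (hxT.resolve_left h)

open Classical in
theorem memLp_piecewise_restrict_union {X W : Type*} [MeasurableSpace X] [NormedAddCommGroup W]
    {μ : Measure X} {T T' : Set X} (hT : MeasurableSet T) {p : ℝ≥0∞} {f g : X → W}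
    (hf : MemLp f p (μ.restrict T)) (hg : MemLp g p (μ.restrict T')) :
    MemLp (T.piecewise f g) p (μ.restrict (T ∪ T')) := by
  refine MemLp.piecewise hT (hf.mono_measure ?_) (hg.mono_measure ?_)
  · rw [Measure.restrict_restrict hT]
    exact Measure.restrict_mono inter_subset_left le_rfl
  · rw [Measure.restrict_restrict hT.compl]
    exact Measure.restrict_mono (fun x hx => hx.2.resolve_left hx.1) le_rfl

open Classical in
theorem IsTangentFrameOn.piecewise (h : IsTangentFrameOn Ω P Q T) (h' : IsTangentFrameOn Ω P' Q' T')
    (hT : MeasurableSet T) (hT' : MeasurableSet T') :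
    IsTangentFrameOn Ω (T.piecewise P P') (T.piecewise Q Q') (T ∪ T') := by
  have hspan := ae_restrict_union_piecewise hT hT' (R := fun x
    (A : EuclideanSpace ℝ (Fin d) →L[ℝ] EuclideanSpace ℝ (Fin d)) => Submodule.span ℝ
      (range fun i : Fin (d - 1) => A (EuclideanSpace.single (Fin.castLE (Nat.sub_le d 1) i) 1))
        = tangentSpaceAt Ω x) h.span h'.span
  have hinv := ae_restrict_union_piecewise hT hT' (f := fun x => (P x, Q x))
    (g := fun x => (P' x, Q' x)) (R := fun _
      (A : (EuclideanSpace ℝ (Fin d) →L[ℝ] EuclideanSpace ℝ (Fin d)) ×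
        (EuclideanSpace ℝ (Fin d) →L[ℝ] EuclideanSpace ℝ (Fin d))) =>
      A.1.comp A.2 = ContinuousLinearMap.id ℝ _ ∧ A.2.comp A.1 = ContinuousLinearMap.id ℝ _)
    h.inverse h'.inverse
  refine ⟨memLp_piecewise_restrict_union hT h.memLp h'.memLp,
    memLp_piecewise_restrict_union hT h.memLp_inv h'.memLp_inv, ?_, hspan⟩
  filter_upwards [hinv] with x hx
  by_cases hxT : x ∈ T
  · rw [piecewise_eq_of_mem _ _ _ hxT] at hx ⊢
    rw [piecewise_eq_of_mem _ _ _ hxT]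
    exact hx
  · rw [piecewise_eq_of_notMem _ _ _ hxT] at hx ⊢
    rw [piecewise_eq_of_notMem _ _ _ hxT]
    exact hx

theorem IsTangentFrameOn.isLInftyBasis (h : IsTangentFrameOn Ω P Q T) (hT : frontier Ω ⊆ T) :
    IsLInftyBasis Ω fun i x => P x (EuclideanSpace.single (Fin.castLE (Nat.sub_le d 1) i) 1) := by
  obtain ⟨hP, hQ, hPQ, hspan⟩ := h
  have hres : (surfaceMeasure Ω).restrict T = surfaceMeasure Ω :=
    Measure.restrict_eq_self_of_ae_mem
      ((ae_restrict_mem isClosed_frontier.measurableSet).mono fun x hx => hT hx)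
  rw [hres] at hP hQ hPQ hspan
  refine ⟨fun i => (hP.1.apply_continuousLinearMap _).aemeasurable, ?_, P, Q, hP, hQ, ?_⟩
  · filter_upwards [hPQ, hspan] with x hx hx'
    refine ⟨?_, hx'⟩
    have hker : LinearMap.ker (P x).toLinearMap = ⊥ := by
      refine LinearMap.ker_eq_bot.2 (Function.LeftInverse.injective (g := Q x) fun y => ?_)
      exact congrArg (fun L : EuclideanSpace ℝ (Fin d) →L[ℝ] EuclideanSpace ℝ (Fin d) => L y) hx.2
    have hli : LinearIndependent ℝ fun i : Fin (d - 1) => (EuclideanSpace.single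
        (Fin.castLE (Nat.sub_le d 1) i) 1 : EuclideanSpace ℝ (Fin d)) := by
      have := (EuclideanSpace.basisFun (Fin d) ℝ).toBasis.linearIndependent.comp
        (Fin.castLE (Nat.sub_le d 1)) (Fin.castLE_injective _)
      simpa [Function.comp_def] using this
    exact hli.map' _ hker
  · filter_upwards [hPQ] with x hx
    exact ⟨hx.1, hx.2, fun i => rfl⟩

end Frame

theorem IsBoundaryParam.exists_isTangentFrameOn {d : ℕ} (hd : 1 ≤ d)
    {Ω : Set (EuclideanSpace ℝ (Fin d))} {U : Set (EuclideanSpace ℝ (Fin (d - 1)))}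
    {Ψ : EuclideanSpace ℝ (Fin (d - 1)) → EuclideanSpace ℝ (Fin d)} (hΨ : IsBoundaryParam Ω U Ψ) :
    ∃ P Q, IsTangentFrameOn Ω P Q (Ψ '' U) := by
  obtain ⟨K, -, hK⟩ := hΨ.exists_ae_differentiableAt
  obtain ⟨P, Q, C, hPm, hQm, hPC, hQC, hPQ⟩ := exists_measurable_extension hd K
  have hDm : AEMeasurable (fun x => fderiv ℝ Ψ (chartInv U Ψ x))
      ((surfaceMeasure Ω).restrict (Ψ '' U)) :=
    (measurable_fderiv ℝ Ψ).comp_aemeasurable hΨ.aemeasurable_chartInv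
  refine ⟨fun x => P (fderiv ℝ Ψ (chartInv U Ψ x)), fun x => Q (fderiv ℝ Ψ (chartInv U Ψ x)),
    memLp_top_of_bound (hPm.comp_aemeasurable hDm).aestronglyMeasurable C
      (Eventually.of_forall fun x => hPC _),
    memLp_top_of_bound (hQm.comp_aemeasurable hDm).aestronglyMeasurable C
      (Eventually.of_forall fun x => hQC _), hΨ.ae_image ?_, hΨ.ae_image ?_⟩
  · filter_upwards [hK, ae_restrict_mem hΨ.isOpen.measurableSet] with z hz hzU
    obtain ⟨h1, h2, -⟩ := hPQ _ hz.2.1 hz.2.2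
    simp only [hΨ.chartInv_apply hzU]
    exact ⟨h1, h2⟩
  · filter_upwards [hK, ae_restrict_mem hΨ.isOpen.measurableSet] with z hz hzU
    obtain ⟨-, -, h3⟩ := hPQ _ hz.2.1 hz.2.2
    simp only [hΨ.chartInv_apply hzU]
    rw [hΨ.tangentSpaceAt_eq_range hzU hz.1, range_eq_span_single]
    simp only [h3]

/-- A Lipschitz boundary has an `L^∞` basis of its tangent bundle. Locally one takes the columns of
the derivative of a parametrization; finitely many local choices are combined measurably. -/
theorem IsLipschitzDomain.exists_isLInftyBasis {d : ℕ} (hd : 1 ≤ d)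
    {Ω : Set (EuclideanSpace ℝ (Fin d))} (hΩ : IsLipschitzDomain Ω) :
    ∃ v, IsLInftyBasis Ω v := by
  obtain ⟨T, hT, -, P, Q, h⟩ : ∃ T, frontier Ω ⊆ T ∧ MeasurableSet T ∧
      ∃ P Q, IsTangentFrameOn Ω P Q T := by
    refine hΩ.isCompact_frontier.induction_on
      (p := fun S => ∃ T, S ⊆ T ∧ MeasurableSet T ∧ ∃ P Q, IsTangentFrameOn Ω P Q T) ?_ ?_ ?_ ?_
    · exact ⟨∅, subset_rfl, MeasurableSet.empty, 0, 0, by simp, by simp, by simp, by simp⟩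
    · rintro S S' hSS' ⟨T, hT, h⟩
      exact ⟨T, hSS'.trans hT, h⟩
    · classical
      rintro S S' ⟨T, hST, hT, P, Q, h⟩ ⟨T', hST', hT', P', Q', h'⟩
      exact ⟨T ∪ T', union_subset_union hST hST', hT.union hT', _, _, h.piecewise h' hT hT'⟩
    · intro x hx
      obtain ⟨U, Ψ, hΨ, -, hnhds⟩ := hΩ.exists_isBoundaryParam hx
      exact ⟨Ψ '' U, hnhds, Ψ '' U, subset_rfl, hΨ.measurableSet_image,
        hΨ.exists_isTangentFrameOn hd⟩
  exact ⟨_, h.isLInftyBasis hT⟩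

/-! ### Weak convergence in normed spaces and in `L¹` -/

section Weak

variable {X : Type*} [NormedAddCommGroup X] [NormedSpace ℝ X] {x : ℕ → X} {a : X}

theorem weaklyConverges_iff :
    WeaklyConverges x a ↔ ∀ L : X →L[ℝ] ℝ, Tendsto (fun n => L (x n)) atTop (𝓝 (L a)) := by
  constructor
  · intro h L
    exact ((WeakBilin.eval_continuous (topDualPairing ℝ X).flip L).tendsto _).comp h
  · intro h
    refine (WeakBilin.tendsto_iff_forall_eval_tendsto (topDualPairing ℝ X).flip ?_).2 h
    intro y y' hyy'
    exact (SeparatingDual.eq_iff_forall_dual_eq (R := ℝ)).2 fun L => LinearMap.congr_fun hyy' L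

/-- Weakly convergent sequences are bounded, by the uniform boundedness principle in the dual. -/
theorem WeaklyConverges.exists_norm_le (h : WeaklyConverges x a) : ∃ C, ∀ n, ‖x n‖ ≤ C := by
  rw [weaklyConverges_iff] at h
  obtain ⟨C, hC⟩ := banach_steinhaus (g := fun n => NormedSpace.inclusionInDoubleDual ℝ X (x n))
    fun L => by
      obtain ⟨C, hC⟩ := (h L).norm.bddAbove_range
      exact ⟨C, fun n => hC ⟨n, rfl⟩⟩
  refine ⟨C, fun n => ?_⟩
  rw [← (NormedSpace.inclusionInDoubleDualLi ℝ (E := X)).norm_map]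
  exact hC n

end Weak

section DualL1

variable {X : Type*} [MeasurableSpace X] {μ : Measure X} [IsFiniteMeasure μ]

/-- The continuous linear functionals on `L¹` of a finite measure are given by bounded functions. On
`L² ⊆ L¹` the functional is represented by some `b ∈ L²`, and testing with indicator functions
shows `|b| ≤ ‖Λ‖`. -/
theorem exists_memLp_top_forall_eq_integral (Λ : Lp ℝ 1 μ →L[ℝ] ℝ) :
    ∃ b : X → ℝ, MemLp b ⊤ μ ∧ ∀ f (hf : Integrable f μ),
      Λ (hf.toL1 f) = ∫ x, b x * f x ∂μ := by
  set J : Lp ℝ 2 μ →L[ℝ] Lp ℝ 1 μ :=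
    (ContinuousLinearMap.mul ℝ ℝ).holderL μ 2 2 1 (indicatorConstLp 2 MeasurableSet.univ
      (measure_ne_top μ _) 1) with hJ
  have hJf : ∀ f, J f =ᵐ[μ] f := by
    intro f
    have h1 := (ContinuousLinearMap.mul ℝ ℝ).coeFn_holder (r := 1) (indicatorConstLp 2
      MeasurableSet.univ (measure_ne_top μ _) 1) f
    filter_upwards [h1, indicatorConstLp_coeFn_mem (p := 2) (hs := MeasurableSet.univ)
      (hμs := measure_ne_top μ _) (c := (1 : ℝ))] with x hx hx'
    rw [hJ, ContinuousLinearMap.holderL_apply_apply, hx, hx' (mem_univ x)]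
    simp
  set b : Lp ℝ 2 μ := (InnerProductSpace.toDual ℝ (Lp ℝ 2 μ)).symm (Λ.comp J) with hb
  have hset : ∀ s (hs : MeasurableSet s),
      Λ (indicatorConstLp 1 hs (measure_ne_top μ s) 1) = ∫ x in s, b x ∂μ := by
    intro s hs
    have h1 : J (indicatorConstLp 2 hs (measure_ne_top μ s) 1)
        = indicatorConstLp 1 hs (measure_ne_top μ s) 1 :=
      Lp.ext ((hJf _).trans (indicatorConstLp_coeFn.trans indicatorConstLp_coeFn.symm))
    rw [← L2.inner_indicatorConstLp_one hs (measure_ne_top μ s) b, real_inner_comm, hb,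
      InnerProductSpace.toDual_symm_apply, ← h1]
    rfl
  have hbi : Integrable b μ := (Lp.memLp b).integrable (by norm_num)
  have hle : ∀ s (hs : MeasurableSet s), |∫ x in s, b x ∂μ| ≤ ∫ x in s, ‖Λ‖ ∂μ := by
    intro s hs
    rw [← hset s hs, setIntegral_const, smul_eq_mul, mul_comm]
    refine (Λ.le_opNorm _).trans_eq ?_
    rw [norm_indicatorConstLp one_ne_zero ENNReal.one_ne_top]
    simp
  have hub : b ≤ᵐ[μ] fun _ => ‖Λ‖ := ae_le_of_forall_setIntegral_le hbi (integrable_const _)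
    fun s hs _ => (le_abs_self _).trans (hle s hs)
  have hlb : (fun x => - b x) ≤ᵐ[μ] fun _ => ‖Λ‖ :=
    ae_le_of_forall_setIntegral_le hbi.neg (integrable_const _) fun s hs _ => by
      rw [integral_neg]
      exact (neg_le_abs _).trans (hle s hs)
  have hbtop : MemLp b ⊤ μ := by
    refine memLp_top_of_bound (Lp.aestronglyMeasurable b) ‖Λ‖ ?_
    filter_upwards [hub, hlb] with x h1 h2
    exact abs_le'.2 ⟨h1, h2⟩
  refine ⟨b, hbtop, ?_⟩
  set Λ' : Lp ℝ 1 μ →L[ℝ] ℝ := (ContinuousLinearMap.mul ℝ ℝ).lpPairing μ ⊤ 1 (hbtop.toLp b)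
    with hΛ'
  have hΛ'f : ∀ f, Λ' f = ∫ x, b x * f x ∂μ := by
    intro f
    rw [hΛ', ContinuousLinearMap.lpPairing_eq_integral]
    refine integral_congr_ae ?_
    filter_upwards [hbtop.coeFn_toLp] with x hx
    rw [hx]
    rfl
  have heq : ∀ f, Λ f = Λ' f := by
    intro f
    induction f using Lp.induction ENNReal.one_ne_top with
    | indicatorConst c hs hμs =>
      rename_i s
      have h1 : (Lp.simpleFunc.indicatorConst 1 hs hμs.ne c : Lp ℝ 1 μ)
          = c • indicatorConstLp 1 hs (measure_ne_top μ s) 1 := by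
        rw [Lp.simpleFunc.coe_indicatorConst]
        refine Lp.ext ?_
        filter_upwards [indicatorConstLp_coeFn (p := 1) (hs := hs) (hμs := hμs.ne) (c := c),
          indicatorConstLp_coeFn (p := 1) (hs := hs) (hμs := measure_ne_top μ s) (c := (1 : ℝ)),
          Lp.coeFn_smul c (indicatorConstLp 1 hs (measure_ne_top μ s) (1 : ℝ))] with x h1 h2 h3
        rw [h1, h3, Pi.smul_apply, h2]
        by_cases hx : x ∈ s <;> simp [hx]
      rw [h1, map_smul, map_smul, hset s hs, hΛ'f, ← integral_indicator hs]
      congr 1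
      refine integral_congr_ae ?_
      filter_upwards [indicatorConstLp_coeFn (p := 1) (hs := hs) (hμs := measure_ne_top μ s)
        (c := (1 : ℝ))] with x hx
      rw [hx]
      by_cases hxs : x ∈ s <;> simp [hxs]
    | add hf hg _ h1 h2 => rw [map_add, map_add, h1, h2]
    | isClosed => exact isClosed_eq Λ.continuous Λ'.continuous
  intro f hf
  rw [heq, hΛ'f]
  refine integral_congr_ae ?_
  filter_upwards [hf.coeFn_toL1] with x hx
  rw [hx]

/-- Weak convergence in `L¹` may be tested componentwise with bounded functions. -/
theorem weaklyConvergesL1_of_forall_tendsto {κ : Type*} [Fintype κ]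
    {f : ℕ → X → EuclideanSpace ℝ κ} {g : X → EuclideanSpace ℝ κ}
    (hf : ∀ n i, Integrable (fun x => f n x i) μ) (hg : ∀ i, Integrable (fun x => g x i) μ)
    (h : ∀ i (b : X → ℝ), MemLp b ⊤ μ →
      Tendsto (fun n => ∫ x, b x * f n x i ∂μ) atTop (𝓝 (∫ x, b x * g x i ∂μ))) :
    WeaklyConvergesL1 μ f g := by
  classical
  have hint : ∀ F : X → EuclideanSpace ℝ κ, (∀ i, Integrable (fun x => F x i) μ) →
      Integrable F μ := fun F hF => by
    have := (PiLp.continuousLinearEquiv 2 ℝ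
      (fun _ : κ => ℝ)).symm.toContinuousLinearMap.integrable_comp (integrable_pi_iff.2 hF)
    exact this
  refine ⟨fun n => hint _ (hf n), hint _ hg, weaklyConverges_iff.2 fun Λ => ?_⟩
  have hrep : ∀ i, ∃ b : X → ℝ, MemLp b ⊤ μ ∧ ∀ f (hf : Integrable f μ),
      Λ ((ContinuousLinearMap.toSpanSingleton ℝ (EuclideanSpace.single i (1 : ℝ))).compLpL 1 μ
        (hf.toL1 f)) = ∫ x, b x * f x ∂μ := fun i =>
    exists_memLp_top_forall_eq_integral (Λ.comp
      ((ContinuousLinearMap.toSpanSingleton ℝ (EuclideanSpace.single i (1 : ℝ))).compLpL 1 μ))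
  choose b hb hbΛ using hrep
  have hΛ : ∀ (F : X → EuclideanSpace ℝ κ) (hF : ∀ i, Integrable (fun x => F x i) μ),
      Λ ((hint F hF).toL1 F) = ∑ i, ∫ x, b i x * F x i ∂μ := by
    intro F hF
    simp only [← hbΛ _ _ (hF _)]
    rw [← _root_.map_sum]
    congr 1
    refine Lp.ext ?_
    have h1 : ∀ᵐ x ∂μ, ∀ i, ((ContinuousLinearMap.toSpanSingleton ℝ
        (EuclideanSpace.single i (1 : ℝ))).compLpL 1 μ ((hF i).toL1 fun x => F x i)) x
        = F x i • EuclideanSpace.single i (1 : ℝ) := by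
      refine ae_all_iff.2 fun i => ?_
      filter_upwards [ContinuousLinearMap.coeFn_compLpL (p := 1) (μ := μ)
        (ContinuousLinearMap.toSpanSingleton ℝ (EuclideanSpace.single i (1 : ℝ)))
        ((hF i).toL1 fun x => F x i), (hF i).coeFn_toL1] with x hx hx'
      rw [hx, hx']
      rfl
    filter_upwards [(hint F hF).coeFn_toL1, h1, Lp.coeFn_finsetSum (μ := μ) Finset.univ fun i =>
      (ContinuousLinearMap.toSpanSingleton ℝ
        (EuclideanSpace.single i (1 : ℝ))).compLpL 1 μ ((hF i).toL1 fun x => F x i)] with x hx h2 h3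
    rw [hx, h3, Finset.sum_apply, Finset.sum_congr rfl fun i _ => h2 i]
    ext j
    simp [Pi.single_apply]
  simp only [hΛ _ (hf _), hΛ _ hg]
  exact tendsto_finsetSum _ fun i _ => h i (b i) (hb i)

end DualL1

/-! ### Pulling back functions on the boundary to a parameter domain -/

namespace IsBoundaryParam

variable {d : ℕ} {Ω : Set (EuclideanSpace ℝ (Fin d))} {U : Set (EuclideanSpace ℝ (Fin (d - 1)))}
  {Ψ : EuclideanSpace ℝ (Fin (d - 1)) → EuclideanSpace ℝ (Fin d)} (hΨ : IsBoundaryParam Ω U Ψ)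
include hΨ

theorem aestronglyMeasurable_comp {W : Type*} [NormedAddCommGroup W]
    {f : EuclideanSpace ℝ (Fin d) → W} (hf : AEStronglyMeasurable f (surfaceMeasure Ω)) :
    AEStronglyMeasurable (fun z => f (Ψ z)) (volume.restrict U) := by
  have h1 : AEStronglyMeasurable f ((chartMeasure Ω U Ψ).map Ψ) :=
    hΨ.map_chartMeasure ▸ hf.restrict
  exact (h1.comp_aemeasurable hΨ.aemeasurable_chartMeasure).mono_ac
    hΨ.absolutelyContinuous_chartMeasure

/-- Composition with a parametrization is bounded from `L^q(∂Ω)` to `L^q(U)`. -/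
theorem exists_eLpNorm_comp_le (q : ℝ≥0∞) : ∃ C : ℝ≥0, ∀ (W : Type) [NormedAddCommGroup W]
    (f : EuclideanSpace ℝ (Fin d) → W), AEStronglyMeasurable f (surfaceMeasure Ω) →
    eLpNorm (fun z => f (Ψ z)) q (volume.restrict U) ≤ C * eLpNorm f q (surfaceMeasure Ω) := by
  obtain ⟨C, -, hC⟩ := hΨ.exists_chartMeasure_le
  have htop : (C : ℝ≥0∞) ^ (1 / q).toReal ≠ ⊤ :=
    ENNReal.rpow_ne_top_of_nonneg ENNReal.toReal_nonneg ENNReal.coe_ne_top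
  refine ⟨((C : ℝ≥0∞) ^ (1 / q).toReal).toNNReal, fun W _ f hf => ?_⟩
  have h1 : AEStronglyMeasurable f ((chartMeasure Ω U Ψ).map Ψ) :=
    hΨ.map_chartMeasure ▸ hf.restrict
  have h2 := eLpNorm_map_measure (p := q) h1 hΨ.aemeasurable_chartMeasure
  rw [hΨ.map_chartMeasure] at h2
  rw [ENNReal.coe_toNNReal htop]
  refine (eLpNorm_le_of_measure_le_smul (c := (C : ℝ≥0∞)) hC).trans ?_
  rw [smul_eq_mul]
  gcongr
  exact h2.symm.le.trans (eLpNorm_mono_measure _ Measure.restrict_le_self)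

theorem memLp_comp {W : Type} [NormedAddCommGroup W] {q : ℝ≥0∞}
    {f : EuclideanSpace ℝ (Fin d) → W} (hf : MemLp f q (surfaceMeasure Ω)) :
    MemLp (fun z => f (Ψ z)) q (volume.restrict U) := by
  obtain ⟨C, hC⟩ := hΨ.exists_eLpNorm_comp_le q
  exact ⟨hΨ.aestronglyMeasurable_comp hf.1,
    (hC W f hf.1).trans_lt (ENNReal.mul_lt_top ENNReal.coe_lt_top hf.2)⟩

theorem isFiniteMeasure_chartMeasure (hU : volume U ≠ ⊤) :
    IsFiniteMeasure (chartMeasure Ω U Ψ) := by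
  obtain ⟨C, hC, -⟩ := hΨ.exists_chartMeasure_le
  refine ⟨(hC univ).trans_lt ?_⟩
  rw [Measure.smul_apply, ENNReal.smul_def, restrict_apply_univ]
  exact ENNReal.mul_lt_top (by simp) hU.lt_top

theorem integrableOn_image {W : Type*} [NormedAddCommGroup W]
    {f : EuclideanSpace ℝ (Fin d) → W} (hf : AEStronglyMeasurable f (surfaceMeasure Ω))
    (h : IntegrableOn (fun z => f (Ψ z)) U) : IntegrableOn f (Ψ '' U) (surfaceMeasure Ω) := by
  have h1 : AEStronglyMeasurable f ((chartMeasure Ω U Ψ).map Ψ) :=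
    hΨ.map_chartMeasure ▸ hf.restrict
  obtain ⟨C, hC, -⟩ := hΨ.exists_chartMeasure_le
  rw [IntegrableOn, ← hΨ.map_chartMeasure,
    integrable_map_measure h1 hΨ.aemeasurable_chartMeasure]
  exact (h.integrable.smul_measure_nnreal (c := C)).mono_measure hC

/-- In the coordinates of a parametrization, the surface measure has a bounded density. -/
theorem exists_density (hU : volume U ≠ ⊤) : ∃ ρ : EuclideanSpace ℝ (Fin (d - 1)) → ℝ,
    MemLp ρ ⊤ (volume.restrict U) ∧ ∀ f : EuclideanSpace ℝ (Fin d) → ℝ,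
      AEStronglyMeasurable f (surfaceMeasure Ω) →
      ∫ x in Ψ '' U, f x ∂(surfaceMeasure Ω) = ∫ z in U, ρ z * f (Ψ z) := by
  obtain ⟨C, hC, -⟩ := hΨ.exists_chartMeasure_le
  have : IsFiniteMeasure (volume.restrict U) := ⟨by simpa using hU.lt_top⟩
  have hfin := hΨ.isFiniteMeasure_chartMeasure hU
  set ν : Measure (EuclideanSpace ℝ (Fin (d - 1))) := (C : ℝ≥0∞) • volume.restrict U with hν
  replace hC : chartMeasure Ω U Ψ ≤ ν := hC
  have : IsFiniteMeasure ν := Measure.smul_finite _ ENNReal.coe_ne_top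
  have : (chartMeasure Ω U Ψ).HaveLebesgueDecomposition ν :=
    haveLebesgueDecomposition_of_sigmaFinite _ _
  have hle : ∀ᵐ z ∂ν, ((chartMeasure Ω U Ψ).rnDeriv ν z).toReal ≤ 1 := by
    filter_upwards [rnDeriv_le_one_of_le hC] with z hz
    exact ENNReal.toReal_le_of_le_ofReal zero_le_one (by simpa using hz)
  refine ⟨fun z => C * ((chartMeasure Ω U Ψ).rnDeriv ν z).toReal, ?_, fun f hf => ?_⟩
  · rcases eq_or_ne C 0 with hC0 | hC0
    · simp [hC0]
    · refine memLp_top_of_bound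
        ((measurable_rnDeriv _ _).ennreal_toReal.const_mul _).aestronglyMeasurable C ?_
      have hle' : ∀ᵐ z ∂(volume.restrict U), ((chartMeasure Ω U Ψ).rnDeriv ν z).toReal ≤ 1 :=
        (Measure.ae_ennreal_smul_measure_iff (by exact_mod_cast hC0)).1 hle
      filter_upwards [hle'] with z hz
      rw [Real.norm_of_nonneg (by positivity)]
      exact mul_le_of_le_one_right (by positivity) hz
  · have h1 : AEStronglyMeasurable f ((chartMeasure Ω U Ψ).map Ψ) :=
      hΨ.map_chartMeasure ▸ hf.restrict
    rw [← hΨ.map_chartMeasure, integral_map hΨ.aemeasurable_chartMeasure h1,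
      ← integral_rnDeriv_smul (absolutelyContinuous_of_le hC), hν, integral_smul_measure,
      ← integral_smul]
    refine integral_congr_ae (Eventually.of_forall fun z => ?_)
    simp [mul_assoc]

/-- Pairing the pullback of `w` with a bounded function is a continuous functional of `w`. -/
theorem exists_clm_pairing (hU : volume U ≠ ⊤) {p : ℝ≥0∞} [hp : Fact (1 ≤ p)] (i : Fin d)
    {ψ : EuclideanSpace ℝ (Fin (d - 1)) → ℝ} (hψ : MemLp ψ ⊤ (volume.restrict U)) :
    ∃ Λ : Lp (EuclideanSpace ℝ (Fin d)) p (surfaceMeasure Ω) →L[ℝ] ℝ,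
      ∀ w, Λ w = ∫ z in U, ψ z * w (Ψ z) i := by
  have : IsFiniteMeasure (volume.restrict U) := ⟨by simpa using hU.lt_top⟩
  obtain ⟨C₁, hC₁⟩ := exists_eLpNorm_le_mul_eLpNorm (volume.restrict U) le_rfl hp.out
  obtain ⟨C₂, hC₂⟩ := hΨ.exists_eLpNorm_comp_le p
  set B : ℝ≥0 := (eLpNorm ψ ⊤ (volume.restrict U)).toNNReal with hB
  have hBψ : eLpNorm ψ ⊤ (volume.restrict U) = B := (ENNReal.coe_toNNReal hψ.2.ne).symm
  have hcomp : ∀ w : Lp (EuclideanSpace ℝ (Fin d)) p (surfaceMeasure Ω),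
      MemLp (fun z => w (Ψ z) i) p (volume.restrict U) := fun w =>
    (EuclideanSpace.proj i : EuclideanSpace ℝ (Fin d) →L[ℝ] ℝ).comp_memLp'
      (hΨ.memLp_comp (Lp.memLp w))
  have hle : ∀ w : Lp (EuclideanSpace ℝ (Fin d)) p (surfaceMeasure Ω),
      eLpNorm (fun z => ψ z * w (Ψ z) i) 1 (volume.restrict U) ≤ B * (C₁ * (C₂ * ‖w‖ₑ)) := by
    intro w
    have h1 := eLpNorm_smul_le_eLpNorm_top_mul_eLpNorm 1 (hcomp w).1 ψ
    refine h1.trans ?_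
    rw [hBψ]
    gcongr
    refine (hC₁ ℝ _ (hcomp w).1).trans ?_
    gcongr
    rw [Lp.enorm_def]
    refine le_trans (eLpNorm_mono fun z => ?_) (hC₂ _ w (Lp.aestronglyMeasurable w))
    exact PiLp.norm_apply_le _ _
  have hint : ∀ w : Lp (EuclideanSpace ℝ (Fin d)) p (surfaceMeasure Ω),
      Integrable (fun z => ψ z * w (Ψ z) i) (volume.restrict U) := fun w =>
    memLp_one_iff_integrable.1 ⟨hψ.1.mul (hcomp w).1, (hle w).trans_lt (by finiteness)⟩
  refine ⟨LinearMap.mkContinuous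
    { toFun := fun w => ∫ z in U, ψ z * w (Ψ z) i
      map_add' := fun w w' => ?_
      map_smul' := fun c w => ?_ } (B * (C₁ * C₂)) fun w => ?_, fun w => rfl⟩
  · rw [← integral_add (hint w) (hint w')]
    refine integral_congr_ae ?_
    filter_upwards [hΨ.ae_comp (Lp.coeFn_add w w')] with z hz
    rw [hz, Pi.add_apply, PiLp.add_apply, mul_add]
  · rw [RingHom.id_apply, ← integral_smul]
    refine integral_congr_ae ?_
    filter_upwards [hΨ.ae_comp (Lp.coeFn_smul c w)] with z hz
    rw [hz, Pi.smul_apply, PiLp.smul_apply, smul_eq_mul, smul_eq_mul, mul_left_comm]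
  · refine (norm_integral_le_lintegral_norm _).trans ?_
    refine ENNReal.toReal_le_of_le_ofReal (by positivity) ?_
    have h1 := hle w
    rw [eLpNorm_one_eq_lintegral_enorm] at h1
    simp only [ofReal_norm]
    refine h1.trans_eq ?_
    rw [ENNReal.ofReal_mul (by positivity), ofReal_norm, ← mul_assoc, ← mul_assoc,
      mul_assoc (B : ℝ≥0∞)]
    congr 1
    rw [← NNReal.coe_mul, ← NNReal.coe_mul, ENNReal.ofReal_coe_nnreal]
    simp

end IsBoundaryParam

/-! ### Minors in local coordinates -/

/-- The determinant of a product with a matrix of coefficients, expanded along the columns. -/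
theorem det_sum_mul_eq_sum {k m : ℕ} (N : Matrix (Fin k) (Fin m) ℝ) (c : Fin k → Fin m → ℝ) :
    (Matrix.of fun i j => ∑ l, c j l * N i l).det
      = ∑ φ : Fin k → Fin m, (∏ j, c j (φ j)) * (Matrix.of fun i j => N i (φ j)).det := by
  classical
  set D := (Matrix.detRowAlternating (n := Fin k) (R := ℝ)).toMultilinearMap
  have h1 : (Matrix.of fun i j => ∑ l, c j l * N i l).det
      = D fun j => ∑ l, c j l • fun i => N i l := by
    rw [← Matrix.det_transpose]
    change Matrix.det _ = Matrix.det _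
    congr 1
    ext j i
    simp [Finset.sum_apply]
  rw [h1, MultilinearMap.map_sum]
  refine Finset.sum_congr rfl fun φ _ => ?_
  rw [MultilinearMap.map_smul_univ, smul_eq_mul, ← Matrix.det_transpose]
  rfl

/-- If the fields `b j` have coefficients `c j` with respect to the columns of `A`, a minor with
respect to the `b j` is a combination of minors of the derivative `L ∘ A` in coordinates. -/
theorem minors_matrixWrt_eq_sum {d m : ℕ} {b : Fin m → EuclideanSpace ℝ (Fin d)}
    {A : EuclideanSpace ℝ (Fin m) →L[ℝ] EuclideanSpace ℝ (Fin d)} {c : Fin m → Fin m → ℝ}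
    (hb : ∀ j, b j = ∑ l, c j l • A (EuclideanSpace.single l 1))
    (L : EuclideanSpace ℝ (Fin d) →L[ℝ] EuclideanSpace ℝ (Fin d)) (I : MinorIndex d m) :
    minors (matrixWrt b L) I = ∑ φ : Fin (I.1 + 1) → Fin m, (∏ j, c (I.2.2 j) (φ j)) *
      gradDet (fun j => EuclideanSpace.single (φ j) 1)
        (fun i => (EuclideanSpace.proj (I.2.1 i) : EuclideanSpace ℝ (Fin d) →L[ℝ] ℝ).comp
          (L.comp A)) := by
  have h1 := det_sum_mul_eq_sum (Matrix.of fun (i : Fin (I.1 + 1)) (l : Fin m) =>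
    L (A (EuclideanSpace.single l 1)) (I.2.1 i)) fun j => c (I.2.2 j)
  refine Eq.trans ?_ h1
  change Matrix.det _ = Matrix.det _
  congr 1
  ext i j
  simp [matrixWrt, hb]

theorem IsLInftyBasis.memLp {d : ℕ} {Ω : Set (EuclideanSpace ℝ (Fin d))}
    {v : Fin (d - 1) → EuclideanSpace ℝ (Fin d) → EuclideanSpace ℝ (Fin d)}
    (hv : IsLInftyBasis Ω v) (j : Fin (d - 1)) : MemLp (v j) ⊤ (surfaceMeasure Ω) := by
  obtain ⟨P, Q, hP, -, hPQ⟩ := hv.bounded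
  have h1 := (ContinuousLinearMap.apply ℝ (EuclideanSpace ℝ (Fin d))
    (EuclideanSpace.single (Fin.castLE (Nat.sub_le d 1) j) 1 :
      EuclideanSpace ℝ (Fin d))).comp_memLp' hP
  refine h1.ae_eq ?_
  filter_upwards [hPQ] with x hx
  exact hx.2.2 j

/-- The minors with respect to fixed measurable fields are measurable. -/
theorem aestronglyMeasurable_minors {X : Type*} [MeasurableSpace X] {μ : Measure X} {d m : ℕ}
    {v : Fin m → X → EuclideanSpace ℝ (Fin d)}
    {F : X → EuclideanSpace ℝ (Fin d) →L[ℝ] EuclideanSpace ℝ (Fin d)}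
    (hv : ∀ j, AEStronglyMeasurable (v j) μ) (hF : AEStronglyMeasurable F μ) (I : MinorIndex d m) :
    AEStronglyMeasurable (fun x => minors (matrixWrt (fun j => v j x) (F x)) I) μ := by
  have hentry : ∀ i j, AEStronglyMeasurable (fun x => F x (v j x) i) μ := fun i j =>
    (EuclideanSpace.proj i : EuclideanSpace ℝ (Fin d) →L[ℝ] ℝ).continuous.comp_aestronglyMeasurable
      (isBoundedBilinearMap_apply.continuous.comp_aestronglyMeasurable₂ hF (hv j))
  change AEStronglyMeasurable (fun x => Matrix.det _) μ
  simp only [Matrix.det_apply]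
  refine Finset.aestronglyMeasurable_fun_sum _ fun σ _ => ?_
  refine AEStronglyMeasurable.const_smul ?_ _
  exact Finset.aestronglyMeasurable_fun_prod _ fun i _ => hentry _ _

namespace IsBoundaryParam

variable {d : ℕ} {Ω : Set (EuclideanSpace ℝ (Fin d))} {U : Set (EuclideanSpace ℝ (Fin (d - 1)))}
  {Ψ : EuclideanSpace ℝ (Fin (d - 1)) → EuclideanSpace ℝ (Fin d)} (hΨ : IsBoundaryParam Ω U Ψ)
include hΨ

theorem memLp_fderiv : MemLp (fderiv ℝ Ψ) ⊤ (volume.restrict U) := by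
  obtain ⟨K, -, hK⟩ := hΨ.exists_ae_differentiableAt
  exact memLp_top_of_bound (measurable_fderiv ℝ Ψ).aestronglyMeasurable K
    (hK.mono fun z hz => hz.2.1)

/-- With respect to the columns of `DΨ`, the fields of an `L^∞` basis have bounded measurable
coefficients. -/
theorem exists_coefficients (hd : 1 ≤ d)
    {v : Fin (d - 1) → EuclideanSpace ℝ (Fin d) → EuclideanSpace ℝ (Fin d)}
    (hv : IsLInftyBasis Ω v) :
    ∃ c : Fin (d - 1) → Fin (d - 1) → EuclideanSpace ℝ (Fin (d - 1)) → ℝ,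
      (∀ j l, MemLp (c j l) ⊤ (volume.restrict U)) ∧
      ∀ᵐ z ∂(volume.restrict U), ∀ j, v j (Ψ z)
        = ∑ l, c j l z • fderiv ℝ Ψ z (EuclideanSpace.single l 1) := by
  obtain ⟨K, -, hK⟩ := hΨ.exists_ae_differentiableAt
  obtain ⟨P, Q, C, -, hQm, -, hQC, hPQ⟩ := exists_measurable_extension hd K
  -- the coefficients are read off with the inverse `Q` of an invertible extension of `DΨ`
  refine ⟨fun j l z => Q (fderiv ℝ Ψ z) (v j (Ψ z)) (Fin.castLE (Nat.sub_le d 1) l),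
    fun j l => ?_, ?_⟩
  · have hvΨ := hΨ.memLp_comp (hv.memLp j)
    have h1 : AEStronglyMeasurable (fun z => Q (fderiv ℝ Ψ z)) (volume.restrict U) :=
      (hQm.comp (measurable_fderiv ℝ Ψ)).aestronglyMeasurable
    refine (EuclideanSpace.proj _ : EuclideanSpace ℝ (Fin d) →L[ℝ] ℝ).comp_memLp'
      (f := fun z => Q (fderiv ℝ Ψ z) (v j (Ψ z))) ?_
    refine hvΨ.of_le_mul (c := C)
      (isBoundedBilinearMap_apply.continuous.comp_aestronglyMeasurable₂ h1 hvΨ.1) ?_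
    exact Eventually.of_forall fun z => ((Q _).le_opNorm _).trans (by gcongr; exact hQC _)
  · filter_upwards [hK, ae_restrict_mem hΨ.isOpen.measurableSet, hΨ.ae_comp hv.basis]
      with z hz hzU hbasis j
    obtain ⟨-, hQP, hPe⟩ := hPQ _ hz.2.1 hz.2.2
    have hmem : v j (Ψ z) ∈ Submodule.span ℝ
        (range fun l => fderiv ℝ Ψ z (EuclideanSpace.single l 1)) := by
      rw [← range_eq_span_single, ← hΨ.tangentSpaceAt_eq_range hzU hz.1, ← hbasis.2]
      exact Submodule.subset_span ⟨j, rfl⟩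
    obtain ⟨a, ha⟩ := (Submodule.mem_span_range_iff_exists_fun ℝ).1 hmem
    rw [← ha]
    refine Finset.sum_congr rfl fun l _ => ?_
    congr 1
    have hQP' : ∀ y, Q (fderiv ℝ Ψ z) (P (fderiv ℝ Ψ z) y) = y := fun y =>
      congrArg (fun L : EuclideanSpace ℝ (Fin d) →L[ℝ] EuclideanSpace ℝ (Fin d) => L y) hQP
    simp only [← hPe, _root_.map_sum, map_smul, hQP']
    simp [Pi.single_apply]

end IsBoundaryParam

/-! ### Weak convergence of minors -/

theorem memLp_clm_comp {X E F G : Type*} [MeasurableSpace X] {μ : Measure X}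
    [NormedAddCommGroup E] [NormedSpace ℝ E] [NormedAddCommGroup F] [NormedSpace ℝ F]
    [NormedAddCommGroup G] [NormedSpace ℝ G] {q : ℝ≥0∞} {A : X → E →L[ℝ] F} (hA : MemLp A q μ)
    (L : F →L[ℝ] G) : MemLp (fun x => L.comp (A x)) q μ :=
  (ContinuousLinearMap.compL ℝ E F G L).comp_memLp' hA

namespace IsBoundaryParam

variable {d : ℕ} {Ω : Set (EuclideanSpace ℝ (Fin d))} {U : Set (EuclideanSpace ℝ (Fin (d - 1)))}
  {Ψ : EuclideanSpace ℝ (Fin (d - 1)) → EuclideanSpace ℝ (Fin d)} (hΨ : IsBoundaryParam Ω U Ψ)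
  {p : ℝ≥0∞} [Fact (1 ≤ p)]
include hΨ

/-- The pullback of an element of `W^{1,p}(∂Ω)` has its weak derivative in `L^p(U)`. -/
theorem exists_eLpNorm_deriv_comp_le : ∃ C : ℝ≥0, ∀ u : boundarySobolev Ω p,
    MemLp (fun z => (tangentialDeriv u (Ψ z)).comp (fderiv ℝ Ψ z)) p (volume.restrict U) ∧
    eLpNorm (fun z => (tangentialDeriv u (Ψ z)).comp (fderiv ℝ Ψ z)) p (volume.restrict U)
      ≤ C * ‖u‖ₑ := by
  obtain ⟨K, hK0, hK⟩ := hΨ.exists_ae_differentiableAt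
  obtain ⟨C, hC⟩ := hΨ.exists_eLpNorm_comp_le p
  refine ⟨K.toNNReal * C, fun u => ?_⟩
  have hF : MemLp (tangentialDeriv u) p (surfaceMeasure Ω) := Lp.memLp u.1.2
  have hle : ∀ᵐ z ∂(volume.restrict U), ‖(tangentialDeriv u (Ψ z)).comp (fderiv ℝ Ψ z)‖
      ≤ K.toNNReal * ‖tangentialDeriv u (Ψ z)‖ := by
    filter_upwards [hK] with z hz
    rw [Real.coe_toNNReal _ hK0.le, mul_comm]
    exact (ContinuousLinearMap.opNorm_comp_le _ _).trans (by gcongr; exact hz.2.1)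
  have hm : AEStronglyMeasurable (fun z => (tangentialDeriv u (Ψ z)).comp (fderiv ℝ Ψ z))
      (volume.restrict U) :=
    isBoundedBilinearMap_comp.continuous.comp_aestronglyMeasurable₂ (hΨ.memLp_comp hF).1
      hΨ.memLp_fderiv.1
  refine ⟨(hΨ.memLp_comp hF).of_le_mul hm hle, ?_⟩
  refine (eLpNorm_le_nnreal_smul_eLpNorm_of_ae_le_mul hle p).trans ?_
  rw [ENNReal.smul_def, smul_eq_mul, ENNReal.coe_mul, mul_assoc]
  gcongr
  refine (hC _ _ hF.1).trans ?_
  gcongr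
  change eLpNorm u.1.2 p (surfaceMeasure Ω) ≤ ‖u.1‖ₑ
  rw [← Lp.enorm_def]
  exact enorm_le_iff_norm_le.2 (norm_snd_le u.1)

/-- The pullback of an element of `W^{1,p}(∂Ω)` is in `L^p(U)`. -/
theorem exists_eLpNorm_sobolev_comp_le : ∃ C : ℝ≥0, ∀ u : boundarySobolev Ω p,
    MemLp (fun z => u.1.1 (Ψ z)) p (volume.restrict U) ∧
    eLpNorm (fun z => u.1.1 (Ψ z)) p (volume.restrict U) ≤ C * ‖u‖ₑ := by
  obtain ⟨C, hC⟩ := hΨ.exists_eLpNorm_comp_le p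
  refine ⟨C, fun u => ⟨hΨ.memLp_comp (Lp.memLp u.1.1), (hC _ _ (Lp.memLp u.1.1).1).trans ?_⟩⟩
  gcongr
  change eLpNorm u.1.1 p (surfaceMeasure Ω) ≤ ‖u.1‖ₑ
  rw [← Lp.enorm_def]
  exact enorm_le_iff_norm_le.2 (norm_fst_le u.1)

/-- Weak continuity of the determinants formed from derivatives of components of `u ∘ Ψ`. Weak
convergence in `W^{1,p}(∂Ω)` bounds the pullbacks, by the uniform boundedness principle, and makes
them converge weakly. -/
theorem tendsto_setIntegral_mul_gradDet_comp (hU : volume U ≠ ⊤) {k : ℕ}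
    (hk : ((k + 1 : ℕ) : ℝ≥0∞) < p) (r : Fin (k + 1) → Fin d)
    (e : Fin (k + 1) → EuclideanSpace ℝ (Fin (d - 1)))
    {u : ℕ → boundarySobolev Ω p} {u₀ : boundarySobolev Ω p} (hu : WeaklyConverges u u₀)
    {ψ : EuclideanSpace ℝ (Fin (d - 1)) → ℝ} (hψ : MemLp ψ ⊤ (volume.restrict U)) :
    Tendsto (fun n => ∫ z in U, ψ z * gradDet e fun i =>
        (EuclideanSpace.proj (r i) : EuclideanSpace ℝ (Fin d) →L[ℝ] ℝ).comp
          ((tangentialDeriv (u n) (Ψ z)).comp (fderiv ℝ Ψ z))) atTop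
      (𝓝 (∫ z in U, ψ z * gradDet e fun i =>
        (EuclideanSpace.proj (r i) : EuclideanSpace ℝ (Fin d) →L[ℝ] ℝ).comp
          ((tangentialDeriv u₀ (Ψ z)).comp (fderiv ℝ Ψ z)))) := by
  obtain ⟨C₁, hC₁⟩ := hΨ.exists_eLpNorm_sobolev_comp_le (p := p)
  obtain ⟨C₂, hC₂⟩ := hΨ.exists_eLpNorm_deriv_comp_le (p := p)
  obtain ⟨B, hB⟩ := hu.exists_norm_le
  have hB' : ∀ n, ‖u n‖ₑ ≤ B.toNNReal := fun n => by
    rw [← ofReal_norm]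
    exact ENNReal.ofReal_le_ofReal (hB n)
  have hproj : ∀ (i : Fin (k + 1)) (y : EuclideanSpace ℝ (Fin d)), ‖y (r i)‖ ≤ ‖y‖ := fun i y =>
    PiLp.norm_apply_le y (r i)
  have hprojL : ∀ (i : Fin (k + 1))
      (L : EuclideanSpace ℝ (Fin (d - 1)) →L[ℝ] EuclideanSpace ℝ (Fin d)),
      ‖(EuclideanSpace.proj (r i) : EuclideanSpace ℝ (Fin d) →L[ℝ] ℝ).comp L‖ ≤ ‖L‖ := fun i L =>
    ContinuousLinearMap.opNorm_le_bound _ (norm_nonneg _) fun w =>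
      (hproj i (L w)).trans (L.le_opNorm w)
  have hf : ∀ (w : boundarySobolev Ω p) i,
      MemLp (fun z => w.1.1 (Ψ z) (r i)) p (volume.restrict U) := fun w i =>
    (EuclideanSpace.proj (r i) : EuclideanSpace ℝ (Fin d) →L[ℝ] ℝ).comp_memLp' (hC₁ w).1
  have hg : ∀ (w : boundarySobolev Ω p) i, MemLp (fun z =>
      (EuclideanSpace.proj (r i) : EuclideanSpace ℝ (Fin d) →L[ℝ] ℝ).comp
        ((tangentialDeriv w (Ψ z)).comp (fderiv ℝ Ψ z))) p (volume.restrict U) := fun w i =>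
    memLp_clm_comp (hC₂ w).1 _
  have hweak : ∀ (w : boundarySobolev Ω p) i, HasWeakFDerivOn (fun z => w.1.1 (Ψ z) (r i))
      (fun z => (EuclideanSpace.proj (r i) : EuclideanSpace ℝ (Fin d) →L[ℝ] ℝ).comp
        ((tangentialDeriv w (Ψ z)).comp (fderiv ℝ Ψ z))) U := fun w i =>
    (w.2.weakDeriv U Ψ hΨ).clm_comp (EuclideanSpace.proj (r i))
  refine tendsto_setIntegral_mul_gradDet (r := p) (M := (C₁ + C₂) * B.toNNReal) e hΨ.isOpen hU
    (fun n => hweak (u n)) (hweak u₀) (by simpa using hk) (fun n => hf (u n)) (hf u₀)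
    (fun n => hg (u n)) (hg u₀) (fun n i => ?_) (fun n i => ?_) (fun i φ hφ hφc => ?_) hψ
  · refine (eLpNorm_mono fun z => hproj i _).trans ((hC₁ (u n)).2.trans ?_)
    rw [ENNReal.coe_mul]
    gcongr
    · exact le_self_add
    · exact hB' n
  · refine (eLpNorm_mono fun z => hprojL i _).trans ((hC₂ (u n)).2.trans ?_)
    rw [ENNReal.coe_mul]
    gcongr
    · exact le_add_self
    · exact hB' n
  · obtain ⟨Λ, hΛ⟩ := hΨ.exists_clm_pairing hU (p := p) (r i)
      ((hφ.memLp_of_hasCompactSupport (p := ⊤) (μ := volume) hφc).restrict U)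
    have h1 := weaklyConverges_iff.1 hu
      ((Λ.comp (ContinuousLinearMap.fst ℝ _ _)).comp (boundarySobolev Ω p).subtypeL)
    simpa [hΛ] using h1

/-- If minors are, in coordinates, combinations of functions with bounded coefficients, then weak
convergence of these functions gives that of the minors. -/
theorem tendsto_setIntegral_of_eq_sum (hU : volume U ≠ ⊤) {κ : Type*} [Fintype κ]
    {f : ℕ → EuclideanSpace ℝ (Fin d) → ℝ} {f₀ : EuclideanSpace ℝ (Fin d) → ℝ}
    (hf : ∀ n, AEStronglyMeasurable (f n) (surfaceMeasure Ω))
    (hf₀ : AEStronglyMeasurable f₀ (surfaceMeasure Ω))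
    {a : κ → EuclideanSpace ℝ (Fin (d - 1)) → ℝ} (ha : ∀ φ, MemLp (a φ) ⊤ (volume.restrict U))
    {D : ℕ → κ → EuclideanSpace ℝ (Fin (d - 1)) → ℝ} {D₀ : κ → EuclideanSpace ℝ (Fin (d - 1)) → ℝ}
    (hD : ∀ n φ, IntegrableOn (D n φ) U) (hD₀ : ∀ φ, IntegrableOn (D₀ φ) U)
    (hfD : ∀ n, ∀ᵐ z ∂(volume.restrict U), f n (Ψ z) = ∑ φ, a φ z * D n φ z)
    (hfD₀ : ∀ᵐ z ∂(volume.restrict U), f₀ (Ψ z) = ∑ φ, a φ z * D₀ φ z)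
    (h : ∀ φ ψ, MemLp ψ ⊤ (volume.restrict U) → Tendsto (fun n => ∫ z in U, ψ z * D n φ z) atTop
      (𝓝 (∫ z in U, ψ z * D₀ φ z)))
    {b : EuclideanSpace ℝ (Fin d) → ℝ} (hb : MemLp b ⊤ (surfaceMeasure Ω)) :
    Tendsto (fun n => ∫ x in Ψ '' U, b x * f n x ∂(surfaceMeasure Ω)) atTop
      (𝓝 (∫ x in Ψ '' U, b x * f₀ x ∂(surfaceMeasure Ω))) := by
  obtain ⟨ρ, hρ, hρint⟩ := hΨ.exists_density hU
  have hψ : ∀ φ, MemLp (fun z => ρ z * b (Ψ z) * a φ z) ⊤ (volume.restrict U) := fun φ =>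
    (ha φ).mul (p := ⊤) (q := ⊤) (r := ⊤) ((hΨ.memLp_comp hb).mul (p := ⊤) (q := ⊤) (r := ⊤) hρ)
  have hint : ∀ (F : EuclideanSpace ℝ (Fin d) → ℝ) (G : κ → EuclideanSpace ℝ (Fin (d - 1)) → ℝ),
      AEStronglyMeasurable F (surfaceMeasure Ω) → (∀ φ, IntegrableOn (G φ) U) →
      (∀ᵐ z ∂(volume.restrict U), F (Ψ z) = ∑ φ, a φ z * G φ z) →
      ∫ x in Ψ '' U, b x * F x ∂(surfaceMeasure Ω)
        = ∑ φ, ∫ z in U, (ρ z * b (Ψ z) * a φ z) * G φ z := by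
    intro F G hF hG hFG
    have hterm : ∀ φ ∈ Finset.univ, Integrable (fun z => ρ z * b (Ψ z) * a φ z * G φ z)
        (volume.restrict U) := fun φ _ => (hG φ).mul_of_top_right (hψ φ)
    rw [hρint (fun x => b x * F x) (hb.1.mul hF), ← integral_finsetSum _ hterm]
    refine integral_congr_ae ?_
    filter_upwards [hFG] with z hz
    rw [hz, Finset.mul_sum, Finset.mul_sum]
    exact Finset.sum_congr rfl fun φ _ => by ring
  simp only [hint _ _ (hf _) (hD _) (hfD _), hint _ _ hf₀ hD₀ hfD₀]
  exact tendsto_finsetSum _ fun φ _ => h φ _ (hψ φ)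

theorem integrableOn_gradDet_comp (hU : volume U ≠ ⊤) {k : ℕ}
    (hk : ((k + 1 : ℕ) : ℝ≥0∞) < p) (r : Fin (k + 1) → Fin d)
    (e : Fin (k + 1) → EuclideanSpace ℝ (Fin (d - 1))) (w : boundarySobolev Ω p) :
    IntegrableOn (fun z => gradDet e fun i =>
      (EuclideanSpace.proj (r i) : EuclideanSpace ℝ (Fin d) →L[ℝ] ℝ).comp
        ((tangentialDeriv w (Ψ z)).comp (fderiv ℝ Ψ z))) U := by
  have : IsFiniteMeasure (volume.restrict U) := ⟨by simpa using hU.lt_top⟩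
  obtain ⟨C, hC⟩ := hΨ.exists_eLpNorm_deriv_comp_le (p := p)
  exact integrable_gradDet e fun i =>
    (memLp_clm_comp (hC w).1 _).mono_exponent (by simpa using hk.le)

/-- On the image of a parametrization, all minors are integrable and converge weakly. -/
theorem tendsto_setIntegral_mul_minors (hd : 1 ≤ d) (hU : volume U ≠ ⊤)
    (hp : ((d - 1 : ℕ) : ℝ≥0∞) < p) {u : ℕ → boundarySobolev Ω p} {u₀ : boundarySobolev Ω p}
    (hu : WeaklyConverges u u₀)
    {v : Fin (d - 1) → EuclideanSpace ℝ (Fin d) → EuclideanSpace ℝ (Fin d)}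
    (hv : IsLInftyBasis Ω v) (I : MinorIndex d (d - 1)) :
    (∀ w : boundarySobolev Ω p, IntegrableOn (fun x =>
      minors (matrixWrt (fun j => v j x) (tangentialDeriv w x)) I) (Ψ '' U) (surfaceMeasure Ω)) ∧
    ∀ b : EuclideanSpace ℝ (Fin d) → ℝ, MemLp b ⊤ (surfaceMeasure Ω) →
      Tendsto (fun n => ∫ x in Ψ '' U, b x *
          minors (matrixWrt (fun j => v j x) (tangentialDeriv (u n) x)) I ∂(surfaceMeasure Ω)) atTop
        (𝓝 (∫ x in Ψ '' U, b x *
          minors (matrixWrt (fun j => v j x) (tangentialDeriv u₀ x)) I ∂(surfaceMeasure Ω))) := by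
  obtain ⟨c, hc, hvc⟩ := hΨ.exists_coefficients hd hv
  have hk : ((I.1 + 1 : ℕ) : ℝ≥0∞) < p := lt_of_le_of_lt (by exact_mod_cast I.1.2) hp
  have ha : ∀ φ : Fin (I.1 + 1) → Fin (d - 1),
      MemLp (fun z => ∏ j, c (I.2.2 j) (φ j) z) ⊤ (volume.restrict U) := fun φ => by
    simpa using MemLp.prod' (s := Finset.univ) (p := fun _ => ⊤) fun j _ => hc (I.2.2 j) (φ j)
  have hmeas : ∀ w : boundarySobolev Ω p, AEStronglyMeasurable (fun x =>
      minors (matrixWrt (fun j => v j x) (tangentialDeriv w x)) I) (surfaceMeasure Ω) := fun w =>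
    aestronglyMeasurable_minors (fun j => (hv.memLp j).1) (Lp.aestronglyMeasurable w.1.2) I
  have hmin : ∀ w : boundarySobolev Ω p, ∀ᵐ z ∂(volume.restrict U),
      minors (matrixWrt (fun j => v j (Ψ z)) (tangentialDeriv w (Ψ z))) I
        = ∑ φ : Fin (I.1 + 1) → Fin (d - 1), (∏ j, c (I.2.2 j) (φ j) z) *
          gradDet (fun j => EuclideanSpace.single (φ j) 1) fun i =>
            (EuclideanSpace.proj (I.2.1 i) : EuclideanSpace ℝ (Fin d) →L[ℝ] ℝ).comp
              ((tangentialDeriv w (Ψ z)).comp (fderiv ℝ Ψ z)) := fun w =>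
    hvc.mono fun z hz => minors_matrixWrt_eq_sum hz _ I
  have hint := fun w (φ : Fin (I.1 + 1) → Fin (d - 1)) => hΨ.integrableOn_gradDet_comp hU hk I.2.1
    (fun j => EuclideanSpace.single (φ j) 1) w
  refine ⟨fun w => hΨ.integrableOn_image (hmeas w) ?_, fun b hb => ?_⟩
  · refine Integrable.congr ?_ ((hmin w).mono fun z hz => hz.symm)
    exact integrable_finsetSum _ fun φ _ => (hint w φ).mul_of_top_right (ha φ)
  · exact hΨ.tendsto_setIntegral_of_eq_sum hU (fun n => hmeas (u n)) (hmeas u₀) ha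
      (fun n => hint (u n)) (hint u₀) (fun n => hmin (u n)) (hmin u₀)
      (fun φ ψ hψ => hΨ.tendsto_setIntegral_mul_gradDet_comp hU hk _ _ hu hψ) hb

end IsBoundaryParam

/-- Weak convergence in `L¹` on a compact set follows from weak convergence near every point. -/
theorem exists_superset_tendsto_setIntegral_mul {X : Type*} [TopologicalSpace X]
    [MeasurableSpace X] {μ : Measure X} {K : Set X} (hK : IsCompact K) {f : ℕ → X → ℝ} {g : X → ℝ}
    (h : ∀ x ∈ K, ∃ T ∈ 𝓝[K] x, MeasurableSet T ∧ (∀ n, IntegrableOn (f n) T μ) ∧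
      IntegrableOn g T μ ∧ ∀ b, MemLp b ⊤ μ →
        Tendsto (fun n => ∫ x in T, b x * f n x ∂μ) atTop (𝓝 (∫ x in T, b x * g x ∂μ))) :
    ∃ T, K ⊆ T ∧ MeasurableSet T ∧ (∀ n, IntegrableOn (f n) T μ) ∧
      IntegrableOn g T μ ∧ ∀ b, MemLp b ⊤ μ →
        Tendsto (fun n => ∫ x in T, b x * f n x ∂μ) atTop (𝓝 (∫ x in T, b x * g x ∂μ)) := by
  refine hK.induction_on (p := fun S => ∃ T, S ⊆ T ∧ MeasurableSet T ∧
    (∀ n, IntegrableOn (f n) T μ) ∧ IntegrableOn g T μ ∧ ∀ b, MemLp b ⊤ μ →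
      Tendsto (fun n => ∫ x in T, b x * f n x ∂μ) atTop (𝓝 (∫ x in T, b x * g x ∂μ)))
    ?_ ?_ ?_ ?_
  · exact ⟨∅, subset_rfl, MeasurableSet.empty, by simp, by simp, by simp⟩
  · rintro S S' hSS' ⟨T, hT, h⟩
    exact ⟨T, hSS'.trans hT, h⟩
  · rintro S S' ⟨T, hST, hT, hf, hg, hlim⟩ ⟨T', hST', hT', hf', hg', hlim'⟩
    refine ⟨T ∪ T', union_subset_union hST hST', hT.union hT', fun n => (hf n).union (hf' n),
      hg.union hg', fun b hb => ?_⟩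
    -- `T'` counts only outside `T`, which is achieved by cutting off the test function `b`
    have hsplit : ∀ F : X → ℝ, IntegrableOn F T μ → IntegrableOn F T' μ →
        ∫ x in T ∪ T', b x * F x ∂μ
          = ∫ x in T, b x * F x ∂μ + ∫ x in T', Tᶜ.indicator b x * F x ∂μ := by
      intro F hF hF'
      have h1 : IntegrableOn (fun x => b x * F x) T μ := hF.mul_of_top_right (hb.restrict T)
      have h2 : IntegrableOn (fun x => b x * F x) T' μ := hF'.mul_of_top_right (hb.restrict T')
      have h3 : (fun x => Tᶜ.indicator b x * F x) = Tᶜ.indicator fun x => b x * F x := by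
        ext x
        by_cases hx : x ∈ T <;> simp [hx]
      rw [← union_sdiff_self, setIntegral_union disjoint_sdiff_right (hT'.diff hT) h1
        (h2.mono_set sdiff_subset), h3, setIntegral_indicator hT.compl]
      rfl
    simp only [hsplit _ (hf _) (hf' _), hsplit _ hg hg']
    exact (hlim b hb).add (hlim' _ (hb.indicator hT.compl))
  · intro x hx
    obtain ⟨T, hT, h⟩ := h x hx
    exact ⟨T, hT, T, subset_rfl, h⟩

theorem IsLipschitzDomain.isFiniteMeasure_surfaceMeasure {d : ℕ}
    {Ω : Set (EuclideanSpace ℝ (Fin d))} (hΩ : IsLipschitzDomain Ω) :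
    IsFiniteMeasure (surfaceMeasure Ω) := by
  have h1 : surfaceMeasure Ω (frontier Ω) < ⊤ := by
    refine hΩ.isCompact_frontier.induction_on (p := fun S => surfaceMeasure Ω S < ⊤) (by simp)
      (fun S S' hSS' h => (measure_mono hSS').trans_lt h)
      (fun S S' h h' => (measure_union_le _ _).trans_lt (ENNReal.add_lt_top.2 ⟨h, h'⟩))
      fun x hx => ?_
    obtain ⟨U, Ψ, hΨ, hU, hnhds⟩ := hΩ.exists_isBoundaryParam hx
    exact ⟨Ψ '' U, hnhds, hΨ.surfaceMeasure_image_lt_top hU⟩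
  refine ⟨lt_of_le_of_lt ?_ h1⟩
  rw [surfaceMeasure, restrict_apply_univ, restrict_apply_self]

end

theorem proposition6p3 (d : ℕ) (hd : 2 ≤ d) (Ω : Set (EuclideanSpace ℝ (Fin d)))
    (hΩ : IsLipschitzDomain Ω) (p : ℝ≥0∞) [Fact (1 ≤ p)] (hp : ((d - 1 : ℕ) : ℝ≥0∞) < p)
    (u : ℕ → boundarySobolev Ω p) (u₀ : boundarySobolev Ω p) (hu : WeaklyConverges u u₀) :
    (∃ v, IsLInftyBasis Ω v) ∧
    ∀ v, IsLInftyBasis Ω v →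
      WeaklyConvergesL1 (surfaceMeasure Ω)
        (fun n x => minors (matrixWrt (fun j => v j x) (tangentialDeriv (u n) x)))
        (fun x => minors (matrixWrt (fun j => v j x) (tangentialDeriv u₀ x))) := by
  have hd1 : 1 ≤ d := by omega
  refine ⟨hΩ.exists_isLInftyBasis hd1, fun v hv => ?_⟩
  have := hΩ.isFiniteMeasure_surfaceMeasure
  have key : ∀ I : MinorIndex d (d - 1),
      (∀ n, Integrable (fun x =>
        minors (matrixWrt (fun j => v j x) (tangentialDeriv (u n) x)) I) (surfaceMeasure Ω)) ∧
      Integrable (fun x =>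
        minors (matrixWrt (fun j => v j x) (tangentialDeriv u₀ x)) I) (surfaceMeasure Ω) ∧
      ∀ b : EuclideanSpace ℝ (Fin d) → ℝ, MemLp b ⊤ (surfaceMeasure Ω) →
        Tendsto (fun n => ∫ x, b x *
          minors (matrixWrt (fun j => v j x) (tangentialDeriv (u n) x)) I ∂(surfaceMeasure Ω)) atTop
        (𝓝 (∫ x, b x *
          minors (matrixWrt (fun j => v j x) (tangentialDeriv u₀ x)) I ∂(surfaceMeasure Ω))) := by
    intro I
    obtain ⟨T, hT, -, hf, hg, hlim⟩ := exists_superset_tendsto_setIntegral_mul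
      (μ := surfaceMeasure Ω) hΩ.isCompact_frontier
      (f := fun n x => minors (matrixWrt (fun j => v j x) (tangentialDeriv (u n) x)) I)
      (g := fun x => minors (matrixWrt (fun j => v j x) (tangentialDeriv u₀ x)) I) fun x hx => by
        obtain ⟨U, Ψ, hΨ, hU, hnhds⟩ := hΩ.exists_isBoundaryParam hx
        obtain ⟨h1, h2⟩ := hΨ.tendsto_setIntegral_mul_minors hd1 hU hp hu hv I
        exact ⟨Ψ '' U, hnhds, hΨ.measurableSet_image, fun n => h1 (u n), h1 u₀, h2⟩
    have hres : (surfaceMeasure Ω).restrict T = surfaceMeasure Ω :=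
      Measure.restrict_eq_self_of_ae_mem
        ((ae_restrict_mem isClosed_frontier.measurableSet).mono fun x hx => hT hx)
    simp only [IntegrableOn, hres] at hf hg hlim
    exact ⟨hf, hg, hlim⟩
  exact weaklyConvergesL1_of_forall_tendsto (fun n I => (key I).1 n) (fun I => (key I).2.1)
    fun I b hb => (key I).2.2 b hb
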